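/- All closed curves are $C^\infty$ maps $\mathbb R\to\mathbb R^3$ of period $1$. For two disjoint closed curves $\gamma_1,\gamma_2$ the Gauss linking integral is $$\mathrm{lk}(\gamma_1,\gamma_2)=\frac1{4\pi}\int_0^1\!\!\int_0^1 \det\Bigl(r,\frac{\partial\gamma_1}{\partial s},\frac{\partial\gamma_2}{\partial t}\Bigr)\frac{dt\,ds}{\|r\|^3},\qquad r=\gamma_2(t)-\gamma_1(s).$$ A disjoint homotopy from $(\gamma_1,\gamma_2)$ to $(\eta_1,\eta_2)$ is a pair of smooth homotopies through closed curves (not necessarily immersed) from $\gamma_1$ to $\eta_1$ and from $\gamma_2$ to $\eta_2$ such that the two curves are disjoint at every time. The pair $(\eta_1,\eta_2)$ is in planar position if $\eta_1$ lies in the plane $x_3=0$ and, whenever $\eta_2(t)$ is in this plane, $\eta_2'(t)$ is a non-zero multiple of $e_3$. A Seifert surface of an embedded closed curve $\sigma$ is a compact connected smoothly embedded surface with boundary $S\subset\mathbb R^3$, oriented by a unit normal field $n$, whose oriented boundary is $\sigma$. A curve $\eta$ crosses $S$ transversally if $\langle n(\eta(t)),\eta'(t)\rangle\ne0$ whenever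 $\eta(t)\in S$. Proposition. Let $\gamma_1,\gamma_2$ be disjoint immersed closed curves in $\mathbb R^3$. (1) There is a disjoint homotopy from $(\gamma_1,\gamma_2)$ to a pair $(\eta_1,\eta_2)$ of immersed closed curves in planar position. It can be chosen so that, moreover, for every $\varepsilon>0$ there is an embedded closed curve $\sigma_1$ uniformly $\varepsilon$-close to $\eta_1$, with $(\gamma_1,\gamma_2)$ disjointly homotopic to $(\sigma_1,\eta_2)$, that has a Seifert surface which $\eta_2$ crosses transversally. (2) For every disjoint homotopy from $(\gamma_1,\gamma_2)$ to a pair $(\eta_1,\eta_2)$ in planar position, the set of $t\in[0,1)$ with $\eta_2(t)$ in the plane $x_3=0$ is a finite set $\{t_1,\dots,t_k\}$, and with $p_i=\eta_2(t_i)$ and $o_i=\pm1$ the sign of the third coordinate of $\eta_2'(t_i)$, $$\mathrm{lk}(\gamma_1,\gamma_2)=-\sum_{i=1}^k o_i\,w(\eta_1,p_i).$$ Here $w(\eta_1,p)=\frac1{2\pi}\oint\frac{(x_1-p_1)\,dx_2-(x_2-p_2)\,dx_1}{(x_1-p_1)^2+(x_2-p_2)^2}$, taken along $\eta_1$, is the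 counterclockwise winding number. For each $p=p_i$ it is an integer: $2\pi w(\eta_1,p)$ is the increase over one period of a continuous polar angle of $\eta_1$ about $p$. (3) For every disjoint homotopy from $(\gamma_1,\gamma_2)$ to a pair $(\sigma_1,\sigma_2)$ with $\sigma_1$ embedded, and every Seifert surface $(S,n)$ of $\sigma_1$ that $\sigma_2$ crosses transversally, the set of $t\in[0,1)$ with $\sigma_2(t)\in S$ is finite and $$\mathrm{lk}(\gamma_1,\gamma_2)=-\sum_{t\in[0,1),\ \sigma_2(t)\in S}\operatorname{sign}\,\langle n(\sigma_2(t)),\sigma_2'(t)\rangle,$$ which is minus the signed intersection number of $\sigma_2$ with $S$. -/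

import Mathlib

open Set
open scoped ContDiff Gradient

/-- Euclidean three-space; the coordinates `x₁, x₂, x₃` are `x 0, x 1, x 2`. -/
abbrev E3 : Type := EuclideanSpace ℝ (Fin 3)

/-- A smooth closed curve, parametrised over one period `[0, 1]`. -/
structure IsClosedCurve (γ : ℝ → E3) : Prop where
  smooth : ContDiff ℝ ∞ γ
  periodic : Function.Periodic γ 1

/-- A smooth immersed closed curve (self-intersections are allowed). -/
structure IsImmersedClosedCurve (γ : ℝ → E3) : Prop extends IsClosedCurve γ where
  immersed : ∀ s, deriv γ s ≠ 0

/-- A smoothly embedded closed curve. -/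
structure IsEmbeddedClosedCurve (γ : ℝ → E3) : Prop extends IsImmersedClosedCurve γ where
  injective : InjOn γ (Ico 0 1)

/-- The determinant of the matrix with columns `a`, `b`, `c`. -/
noncomputable def det3 (a b c : E3) : ℝ :=
  Matrix.det (Matrix.of fun i j : Fin 3 => (![a, b, c] j) i)

/-- The Gauss linking integral
`(1 / 4π) ∫∫ det (r, ∂γ₁/∂s, ∂γ₂/∂t) / ‖r‖³ ds dt` with `r = γ₂ - γ₁`. -/
noncomputable def gaussLinkingIntegral (γ₁ γ₂ : ℝ → E3) : ℝ :=
  (4 * Real.pi)⁻¹ * ∫ s in (0 : ℝ)..1, ∫ t in (0 : ℝ)..1,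
    det3 (γ₂ t - γ₁ s) (deriv γ₁ s) (deriv γ₂ t) / ‖γ₂ t - γ₁ s‖ ^ 3

/-- The pairs of closed curves `(γ₁, γ₂)` and `(η₁, η₂)` are joined by smooth homotopies of closed
curves (not necessarily immersed) that stay disjoint from each other at every time. -/
def DisjointlyHomotopic (γ₁ γ₂ η₁ η₂ : ℝ → E3) : Prop :=
  ∃ H₁ H₂ : ℝ → ℝ → E3,
    ContDiff ℝ ∞ (fun x : ℝ × ℝ => H₁ x.1 x.2) ∧
    ContDiff ℝ ∞ (fun x : ℝ × ℝ => H₂ x.1 x.2) ∧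
    (∀ τ ∈ Icc (0 : ℝ) 1, Function.Periodic (H₁ τ) 1 ∧ Function.Periodic (H₂ τ) 1) ∧
    (∀ τ ∈ Icc (0 : ℝ) 1, ∀ s t, H₁ τ s ≠ H₂ τ t) ∧
    H₁ 0 = γ₁ ∧ H₂ 0 = γ₂ ∧ H₁ 1 = η₁ ∧ H₂ 1 = η₂

/-- `η₁` lies in the plane `x₃ = 0`, and `η₂` is perpendicular to this plane, with non-zero
velocity, whenever it meets the plane. -/
structure IsPlanarPosition (η₁ η₂ : ℝ → E3) : Prop where
  planar : ∀ s, η₁ s 2 = 0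
  perpendicular : ∀ t, η₂ t 2 = 0 →
    deriv η₂ t 0 = 0 ∧ deriv η₂ t 1 = 0 ∧ deriv η₂ t 2 ≠ 0

/-- The parameters, in one period, at which `η` meets the plane `x₃ = 0`. -/
def planeCrossings (η : ℝ → E3) : Set ℝ := {t | t ∈ Ico (0 : ℝ) 1 ∧ η t 2 = 0}

/-- `+1` if `η` crosses the plane `x₃ = 0` upwards at time `t`, `-1` if it crosses downwards. -/
noncomputable def planeCrossingSign (η : ℝ → E3) (t : ℝ) : ℝ := Real.sign (deriv η t 2)

/-- The winding number (counterclockwise positive) of a closed curve in the plane `x₃ = 0` about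
a point `p` of that plane, as the integral `(1 / 2π) ∮ (x dy - y dx) / (x² + y²)` in coordinates
centred at `p`. -/
noncomputable def windingNumber (c : ℝ → E3) (p : E3) : ℝ :=
  (2 * Real.pi)⁻¹ * ∫ s in (0 : ℝ)..1,
    ((c s 0 - p 0) * deriv c s 1 - (c s 1 - p 1) * deriv c s 0) /
      ((c s 0 - p 0) ^ 2 + (c s 1 - p 1) ^ 2)

/-- A continuous polar angle of `c` about `p` increases by `2πk` over one period: `c` winds `k`
times about `p`. -/
def WindsAround (c : ℝ → E3) (p : E3) (k : ℤ) : Prop :=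
  ∃ ρ θ : ℝ → ℝ, Continuous ρ ∧ Continuous θ ∧ (∀ s, 0 < ρ s) ∧
    (∀ s, c s 0 = p 0 + ρ s * Real.cos (θ s) ∧ c s 1 = p 1 + ρ s * Real.sin (θ s)) ∧
    θ 1 - θ 0 = 2 * Real.pi * k

/-- `S` is a Seifert surface of the embedded closed curve `σ`: a compact connected smooth surface
with boundary embedded in three-space, oriented by the unit normal field `n`, whose oriented
boundary is `σ`.

Near a point off `σ` the surface is a regular level set `f = 0`. Near a point of `σ` it is
`f = 0, g ≥ 0` and `σ` is `f = g = 0`; here `-∇g` points out of the surface along `σ`, so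
`σ` has the boundary orientation when `(-∇g, σ', n)` is a positive frame. -/
structure IsSeifertSurface (S : Set E3) (n : E3 → E3) (σ : ℝ → E3) : Prop where
  embedded : IsEmbeddedClosedCurve σ
  compact : IsCompact S
  connected : IsConnected S
  interior_chart : ∀ p ∈ S \ range σ, ∃ (U : Set E3) (f : E3 → ℝ),
    IsOpen U ∧ p ∈ U ∧ ContDiffOn ℝ ∞ f U ∧
    (∀ q ∈ U, q ∈ S ↔ f q = 0) ∧
    (∀ q ∈ U ∩ S, ∇ f q ≠ 0 ∧ n q = ‖∇ f q‖⁻¹ • ∇ f q)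
  boundary_chart : ∀ p ∈ range σ, ∃ (U : Set E3) (f g : E3 → ℝ),
    IsOpen U ∧ p ∈ U ∧ ContDiffOn ℝ ∞ f U ∧ ContDiffOn ℝ ∞ g U ∧
    (∀ q ∈ U, q ∈ S ↔ f q = 0 ∧ 0 ≤ g q) ∧
    (∀ q ∈ U, q ∈ range σ ↔ f q = 0 ∧ g q = 0) ∧
    (∀ q ∈ U ∩ S, ∇ f q ≠ 0 ∧ n q = ‖∇ f q‖⁻¹ • ∇ f q) ∧
    (∀ s, σ s ∈ U → 0 < det3 (-∇ g (σ s)) (deriv σ s) (n (σ s)))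

/-- The curve `η` crosses the surface `S` with normal field `n` transversally wherever it
meets it. -/
def CrossesTransversally (η : ℝ → E3) (S : Set E3) (n : E3 → E3) : Prop :=
  ∀ t, η t ∈ S → inner ℝ (n (η t)) (deriv η t) ≠ 0

/-- The parameters, in one period, at which `η` meets `S`. -/
def surfaceCrossings (η : ℝ → E3) (S : Set E3) : Set ℝ := {t | t ∈ Ico (0 : ℝ) 1 ∧ η t ∈ S}

/-- The signed intersection number of the closed curve `η` with the surface `S` oriented by `n`. -/
noncomputable def intersectionNumber (η : ℝ → E3) (S : Set E3) (n : E3 → E3) : ℝ :=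
  ∑ᶠ t ∈ surfaceCrossings η S, Real.sign (inner ℝ (n (η t)) (deriv η t))

/-!
The linking form of a closed curve `σ` is the closed one-form on the complement of `σ` whose
integral along a disjoint closed curve is the Gauss integral (`linkingForm`,
`gaussLinkingIntegral_eq_integral_linkingForm`). Up to the factor `-1 / 4π` its local primitives
are the solid angles under which `σ` is seen (`solidAngle`): the form `det (r, v, w) / ‖r‖³` is the
exterior derivative of the potential `det (e, r, w) / (‖r‖ (‖r‖ + ⟨e, r⟩))` of a magnetic monopole,
which is smooth off the ray spanned by `-e`, and one integrates it along `σ`. By dimension, a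
generic direction `e` serves near any given point (`exists_isPrimitiveNear`). Closedness of
`det (r, v, w) / ‖r‖³` also shows that the Gauss integral is constant along disjoint homotopies
(`gaussLinkingIntegral_eq_of_homotopic`), so that only the end of a homotopy matters.

Both formulas then come from one fact about functions of one variable: if a periodic function has
derivative `b` except for finitely many jumps, then `b` integrates over a period to minus the sum of
the jumps (`integral_eq_neg_sum_jumps`). In planar position the function is the solid angle of
`η₁` for `e = e₃` above the plane and for `e = -e₃` below it; the two differ on the plane by the
winding number (`gaussLinkingIntegral_planar`). For a Seifert surface `S` one needs a primitive of
the linking form that jumps by `1` across `S` (`exists_jumpPrimitive`). Such primitives are local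
objects defined up to constants, and can be glued over a large ball because a curve does not
disconnect convex open sets (`HasSection.of_local`). They exist trivially near interior points of
`S`. Near a point of the boundary curve one passes to logarithmic coordinates around `σ`, in which
the linking form has a primitive on a whole slab; its increment over one turn is the Gauss integral
of `σ` with a small meridian circle, which tends to `-1` with the radius of the circle
(`gaussLinkingIntegral_circle`), because all but a short arc of `σ` contributes little and the disk
bounded by the circle is seen from its centre under half of the full solid angle.

For the existence of planar positions, the first curve is moved to the unit circle, whose Seifert
surface is the disk (`exists_disjointlyHomotopic_unitCircle`). After a generic shear and
translation no point of the second curve lies vertically between two points of the first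
(`exists_notBetween`). Then the heights of the first curve may be prescribed at will, if those of the
second one are adapted (`disjointlyHomotopic_heights`). Let the first curve descend along a
vertical segment and return with increasing height. After a small generic displacement it meets each
horizontal plane in at most two distinct points, and rotating and dilating the planes about one of
them takes the curve to an ellipse (`exists_unitCircle_of_heights`). Finally small perturbations make
the second curve immersed and perpendicular to the plane (`exists_perpendicular`).
-/

namespace GaussLinking
open Filter Topology MeasureTheory

/-! ### Vector algebra in three-space -/

lemma inner_eq (a b : E3) : inner ℝ a b = a 0 * b 0 + a 1 * b 1 + a 2 * b 2 := by
  rw [PiLp.inner_apply, Fin.sum_univ_three]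
  simp only [RCLike.inner_apply, conj_trivial]
  ring

lemma norm_sq_eq (a : E3) : ‖a‖ ^ 2 = a 0 ^ 2 + a 1 ^ 2 + a 2 ^ 2 := by
  rw [← real_inner_self_eq_norm_sq, inner_eq]; ring

lemma det3_eq (a b c : E3) : det3 a b c =
    a 0 * (b 1 * c 2 - b 2 * c 1) + a 1 * (b 2 * c 0 - b 0 * c 2)
      + a 2 * (b 0 * c 1 - b 1 * c 0) := by
  simp [det3, Matrix.det_fin_three]; ring

attribute [local irreducible] det3

/-- The cross product on `E3`. -/
noncomputable def cross (a b : E3) : E3 :=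
  !₂[a 1 * b 2 - a 2 * b 1, a 2 * b 0 - a 0 * b 2, a 0 * b 1 - a 1 * b 0]

lemma inner_cross (a b c : E3) : inner ℝ (cross a b) c = det3 a b c := by
  rw [inner_eq, det3_eq]; simp [cross]; ring

lemma contDiff_coord {n : WithTop ℕ∞} (i : Fin 3) : ContDiff ℝ n (fun x : E3 => x i) :=
  (contDiff_euclidean.1 contDiff_id) i

lemma hasDerivAt_coord {f : ℝ → E3} {f' : E3} {t : ℝ} (h : HasDerivAt f f' t) (i : Fin 3) :
    HasDerivAt (fun s => f s i) (f' i) t := by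
  have := (EuclideanSpace.proj (𝕜 := ℝ) i).hasFDerivAt.comp_hasDerivAt t h
  simpa [Function.comp_def] using this

lemma continuous_coord (i : Fin 3) : Continuous (fun x : E3 => x i) :=
  (contDiff_coord (n := 0) i).continuous

lemma continuous_cross : Continuous (fun p : E3 × E3 => cross p.1 p.2) := by
  have h0 := continuous_coord 0
  have h1 := continuous_coord 1
  have h2 := continuous_coord 2
  refine (PiLp.continuous_toLp 2 _).comp (continuous_pi fun i => ?_)
  fin_cases i <;> simp <;> fun_prop

lemma continuous_det3 {X : Type*} [TopologicalSpace X] {a b c : X → E3}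
    (ha : Continuous a) (hb : Continuous b) (hc : Continuous c) :
    Continuous (fun x => det3 (a x) (b x) (c x)) := by
  simp only [det3_eq]
  have A := fun i => (continuous_coord i).comp ha
  have B := fun i => (continuous_coord i).comp hb
  have C := fun i => (continuous_coord i).comp hc
  simp only [Function.comp_def] at A B C
  exact (((A 0).mul (((B 1).mul (C 2)).sub ((B 2).mul (C 1)))).add
    ((A 1).mul (((B 2).mul (C 0)).sub ((B 0).mul (C 2))))).add
    ((A 2).mul (((B 0).mul (C 1)).sub ((B 1).mul (C 0))))

lemma continuousOn_det3 {X : Type*} [TopologicalSpace X] {a b c : X → E3} {s : Set X}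
    (ha : ContinuousOn a s) (hb : ContinuousOn b s) (hc : ContinuousOn c s) :
    ContinuousOn (fun x => det3 (a x) (b x) (c x)) s := by
  have h : Continuous fun p : E3 × E3 × E3 => det3 p.1 p.2.1 p.2.2 :=
    continuous_det3 continuous_fst (continuous_fst.comp continuous_snd)
      (continuous_snd.comp continuous_snd)
  exact h.comp_continuousOn (ha.prodMk (hb.prodMk hc))

lemma hasDerivAt_det3 {a b c : ℝ → E3} {a' b' c' : E3} {t : ℝ}
    (ha : HasDerivAt a a' t) (hb : HasDerivAt b b' t) (hc : HasDerivAt c c' t) :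
    HasDerivAt (fun s => det3 (a s) (b s) (c s))
      (det3 a' (b t) (c t) + det3 (a t) b' (c t) + det3 (a t) (b t) c') t := by
  simp only [det3_eq]
  have A := hasDerivAt_coord ha
  have B := hasDerivAt_coord hb
  have C := hasDerivAt_coord hc
  refine HasDerivAt.congr_deriv ((((A 0).mul (((B 1).mul (C 2)).sub ((B 2).mul (C 1)))).add
    ((A 1).mul (((B 2).mul (C 0)).sub ((B 0).mul (C 2))))).add
    ((A 2).mul (((B 0).mul (C 1)).sub ((B 1).mul (C 0))))) ?_
  simp only [Pi.sub_apply, Pi.mul_apply]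
  ring

lemma hasDerivAt_norm {r : ℝ → E3} {r' : E3} {t : ℝ} (h : HasDerivAt r r' t) (h0 : r t ≠ 0) :
    HasDerivAt (fun s => ‖r s‖) (inner ℝ (r t) r' / ‖r t‖) t := by
  have h1 := (h.norm_sq).sqrt (by positivity)
  have h2 : ‖r t‖ ≠ 0 := by positivity
  simp only [Real.sqrt_sq (norm_nonneg _)] at h1
  convert h1 using 1
  field_simp

/-! ### Integrals depending on a parameter -/

theorem hasFDerivAt_integral_of_continuousOn {H : Type*} [NormedAddCommGroup H] [NormedSpace ℝ H]
    [ProperSpace H] {U : Set H} (hU : IsOpen U) {F : H → ℝ → ℝ} {F' : H → ℝ → H →L[ℝ] ℝ}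
    (hF : ∀ x ∈ U, Continuous (F x))
    (hd : ∀ x ∈ U, ∀ s, HasFDerivAt (fun y => F y s) (F' x s) x)
    (hc : ContinuousOn (Function.uncurry F') (U ×ˢ univ)) {x₀ : H} (hx₀ : x₀ ∈ U) (a b : ℝ) :
    HasFDerivAt (fun x => ∫ s in a..b, F x s) (∫ s in a..b, F' x₀ s) x₀ := by
  obtain ⟨ε, hε, hεU⟩ := Metric.nhds_basis_closedBall.mem_iff.1 (hU.mem_nhds hx₀)
  have hK : IsCompact (Metric.closedBall x₀ ε ×ˢ uIcc a b) :=
    (isCompact_closedBall x₀ ε).prod isCompact_uIcc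
  obtain ⟨M, hM⟩ := hK.exists_bound_of_continuousOn
    (hc.mono (prod_mono hεU (subset_univ _)))
  have hc0 : Continuous (F' x₀) := by
    rw [← continuousOn_univ]
    exact hc.comp (by fun_prop : ContinuousOn (fun s : ℝ => (x₀, s)) univ)
      (fun s _ => ⟨hx₀, mem_univ _⟩)
  refine intervalIntegral.hasFDerivAt_integral_of_dominated_of_fderiv_le (bound := fun _ => M)
    (Metric.closedBall_mem_nhds x₀ hε) ?_ ((hF x₀ hx₀).intervalIntegrable _ _)
    hc0.aestronglyMeasurable ?_ (by simp) ?_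
  · filter_upwards [hU.mem_nhds hx₀] with x hx
    exact (hF x hx).aestronglyMeasurable
  · refine ae_of_all _ fun t ht x hx => hM (x, t) ⟨hx, uIoc_subset_uIcc ht⟩
  · exact ae_of_all _ fun t _ x hx => hd x (hεU hx) t

theorem hasDerivAt_integral_of_continuous {F F' : ℝ → ℝ → ℝ}
    (hF : ∀ x, Continuous (F x)) (hd : ∀ x s, HasDerivAt (fun y => F y s) (F' x s) x)
    (hc : Continuous (Function.uncurry F')) (a b x₀ : ℝ) :
    HasDerivAt (fun x => ∫ s in a..b, F x s) (∫ s in a..b, F' x₀ s) x₀ := by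
  have hc' : Continuous (Function.uncurry fun x s =>
      ContinuousLinearMap.toSpanSingleton ℝ (F' x s)) := by
    have : (Function.uncurry fun x s => ContinuousLinearMap.toSpanSingleton ℝ (F' x s)) =
      fun p => ContinuousLinearMap.toSpanSingletonCLE (𝕜 := ℝ) (E := ℝ) (Function.uncurry F' p) := by
      ext p; simp [Function.uncurry]
    rw [this]
    exact (ContinuousLinearEquiv.continuous _).comp hc
  have h := (hasFDerivAt_integral_of_continuousOn isOpen_univ (F := F)
    (fun x _ => hF x) (fun x _ s => (hd x s).hasFDerivAt) hc'.continuousOn (mem_univ x₀) a b)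
  have hi : IntervalIntegrable (fun s => ContinuousLinearMap.toSpanSingleton ℝ (F' x₀ s))
      volume a b :=
    (hc'.comp (by fun_prop : Continuous fun s : ℝ => (x₀, s))).intervalIntegrable _ _
  refine h.hasDerivAt.congr_deriv ?_
  rw [ContinuousLinearMap.intervalIntegral_apply hi]
  simp

lemma integral_swap_of_continuous {F : ℝ → ℝ → ℝ} (hF : Continuous (Function.uncurry F))
    (a b c d : ℝ) :
    ∫ x in a..b, ∫ y in c..d, F x y = ∫ y in c..d, ∫ x in a..b, F x y :=
  intervalIntegral_intervalIntegral_swap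
    ((hF.continuousOn.integrableOn_compact (isCompact_uIcc.prod isCompact_uIcc)).mono_set
      (prod_mono uIoc_subset_uIcc uIoc_subset_uIcc))

/-! ### The solid angle form and its homotopy invariance -/

/-- The solid angle form `det (r, v, w) / ‖r‖³` on `ℝ³ ∖ {0}`. -/
noncomputable def angleForm (r v w : E3) : ℝ := det3 r v w / ‖r‖ ^ 3

/-- The derivative of the solid angle form at `r` in the direction `u`. -/
noncomputable def angleFormDeriv (r u v w : E3) : ℝ :=
  det3 u v w / ‖r‖ ^ 3 - 3 * inner ℝ r u * det3 r v w / ‖r‖ ^ 5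

lemma hasDerivAt_angleForm {r v w : ℝ → E3} {r' v' w' : E3} {t : ℝ} (hr : HasDerivAt r r' t)
    (hv : HasDerivAt v v' t) (hw : HasDerivAt w w' t) (h0 : r t ≠ 0) :
    HasDerivAt (fun s => angleForm (r s) (v s) (w s))
      (angleFormDeriv (r t) r' (v t) (w t) + angleForm (r t) v' (w t)
        + angleForm (r t) (v t) w') t := by
  have hn : ‖r t‖ ≠ 0 := by positivity
  have h := (hasDerivAt_det3 hr hv hw).div ((hasDerivAt_norm hr h0).pow 3) (pow_ne_zero 3 hn)
  refine h.congr_deriv ?_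
  simp only [angleForm, angleFormDeriv, Pi.pow_apply]
  field_simp
  push_cast
  ring

/-- The solid angle form is closed. -/
lemma angleForm_closed {r : E3} (h0 : r ≠ 0) (a b c : E3) :
    angleFormDeriv r a b c + angleFormDeriv r b c a + angleFormDeriv r c a b = 0 := by
  have hn : ‖r‖ ≠ 0 := by positivity
  have key : inner ℝ r a * det3 r b c + inner ℝ r b * det3 r c a + inner ℝ r c * det3 r a b
      = ‖r‖ ^ 2 * det3 a b c := by
    rw [norm_sq_eq]; simp only [inner_eq, det3_eq]; ring
  have c1 : det3 b c a = det3 a b c := by simp only [det3_eq]; ring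
  have c2 : det3 c a b = det3 a b c := by simp only [det3_eq]; ring
  simp only [angleFormDeriv, c1, c2]
  field_simp
  linear_combination (-3) * key

lemma angleForm_zero_left (r w : E3) : angleForm r 0 w = 0 := by simp [angleForm, det3_eq]
lemma angleForm_zero_right (r v : E3) : angleForm r v 0 = 0 := by simp [angleForm, det3_eq]
lemma angleForm_swap (r v w : E3) : angleForm r v w = -angleForm r w v := by
  simp only [angleForm, det3_eq]; ring
lemma angleForm_neg_left (r v w : E3) : angleForm r (-v) w = -angleForm r v w := by
  simp only [angleForm, det3_eq, PiLp.neg_apply]; ring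
lemma continuous_angleForm {X : Type*} [TopologicalSpace X] {a b c : X → E3}
    (ha : Continuous a) (hb : Continuous b) (hc : Continuous c) (h0 : ∀ x, a x ≠ 0) :
    Continuous (fun x => angleForm (a x) (b x) (c x)) :=
  (continuous_det3 ha hb hc).div₀ (ha.norm.pow 3) fun x => pow_ne_zero _ (norm_ne_zero_iff.2 (h0 x))

lemma continuous_angleFormDeriv {X : Type*} [TopologicalSpace X] {a b c d : X → E3}
    (ha : Continuous a) (hb : Continuous b) (hc : Continuous c) (hd : Continuous d)
    (h0 : ∀ x, a x ≠ 0) :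
    Continuous (fun x => angleFormDeriv (a x) (b x) (c x) (d x)) :=
  ((continuous_det3 hb hc hd).div₀ (ha.norm.pow 3) fun x => pow_ne_zero _ (norm_ne_zero_iff.2 (h0 x))).sub
    ((((continuous_const.mul (ha.inner hb)).mul (continuous_det3 ha hc hd))).div₀ (ha.norm.pow 5)
      fun x => pow_ne_zero _ (norm_ne_zero_iff.2 (h0 x)))

/-! ### Homotopy invariance of the Gauss integral -/

lemma exists_partials {H : ℝ → ℝ → E3} (hH : ContDiff ℝ ∞ (fun x : ℝ × ℝ => H x.1 x.2)) :
    ∃ D₁ D₂ M : ℝ → ℝ → E3, Continuous (Function.uncurry D₁) ∧ Continuous (Function.uncurry D₂) ∧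
      Continuous (Function.uncurry M) ∧
      (∀ τ s, HasDerivAt (fun τ => H τ s) (D₁ τ s) τ) ∧
      (∀ τ s, HasDerivAt (fun s => H τ s) (D₂ τ s) s) ∧
      (∀ τ s, HasDerivAt (fun τ => D₂ τ s) (M τ s) τ) ∧
      (∀ τ s, HasDerivAt (fun s => D₁ τ s) (M τ s) s) := by
  set g : ℝ × ℝ → E3 := fun x => H x.1 x.2
  have h1 : ContDiff ℝ ∞ (fderiv ℝ g) := hH.fderiv_right (by simp)
  have h2 : ContDiff ℝ ∞ (fderiv ℝ (fderiv ℝ g)) := h1.fderiv_right (by simp)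
  have d1 : ∀ p, HasFDerivAt g (fderiv ℝ g p) p := fun p =>
    (hH.differentiable (by simp) p).hasFDerivAt
  have d2 : ∀ p, HasFDerivAt (fderiv ℝ g) (fderiv ℝ (fderiv ℝ g) p) p := fun p =>
    (h1.differentiable (by simp) p).hasFDerivAt
  have l1 : ∀ τ s : ℝ, HasDerivAt (fun τ : ℝ => (τ, s)) ((1 : ℝ), (0 : ℝ)) τ := fun τ s =>
    (hasDerivAt_id τ).prodMk (hasDerivAt_const τ s)
  have l2 : ∀ τ s : ℝ, HasDerivAt (fun s : ℝ => (τ, s)) ((0 : ℝ), (1 : ℝ)) s := fun τ s =>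
    (hasDerivAt_const s τ).prodMk (hasDerivAt_id s)
  refine ⟨fun τ s => fderiv ℝ g (τ, s) (1, 0), fun τ s => fderiv ℝ g (τ, s) (0, 1),
    fun τ s => fderiv ℝ (fderiv ℝ g) (τ, s) (1, 0) (0, 1), ?_, ?_, ?_, ?_, ?_, ?_, ?_⟩
  · exact h1.continuous.clm_apply continuous_const
  · exact h1.continuous.clm_apply continuous_const
  · exact (h2.continuous.clm_apply continuous_const).clm_apply continuous_const
  · intro τ s
    exact HasFDerivAt.comp_hasDerivAt (l := g) τ (d1 (τ, s)) (l1 τ s)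
  · intro τ s
    exact HasFDerivAt.comp_hasDerivAt (l := g) s (d1 (τ, s)) (l2 τ s)
  · intro τ s
    have h := HasFDerivAt.comp_hasDerivAt (l := fderiv ℝ g) τ (d2 (τ, s)) (l1 τ s)
    exact (ContinuousLinearMap.apply ℝ E3 ((0 : ℝ), (1 : ℝ))).hasFDerivAt.comp_hasDerivAt τ h
  · intro τ s
    have hs : IsSymmSndFDerivAt ℝ g (τ, s) :=
      hH.contDiffAt.isSymmSndFDerivAt
        (by rw [minSmoothness_of_isRCLikeNormedField]; exact WithTop.coe_le_coe.2 le_top)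
    have h := HasFDerivAt.comp_hasDerivAt (l := fderiv ℝ g) s (d2 (τ, s)) (l2 τ s)
    refine HasDerivAt.congr_deriv ?_ (hs.eq (0, 1) (1, 0))
    exact (ContinuousLinearMap.apply ℝ E3 ((1 : ℝ), (0 : ℝ))).hasFDerivAt.comp_hasDerivAt s h

/-- Reparametrising time, a disjoint homotopy can be taken to be defined and disjoint for all
times, and to be stationary before time `0` and after time `1`. -/
lemma DisjointlyHomotopic.exists_global {γ₁ γ₂ η₁ η₂ : ℝ → E3}
    (h : DisjointlyHomotopic γ₁ γ₂ η₁ η₂) :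
    ∃ H₁ H₂ : ℝ → ℝ → E3,
      ContDiff ℝ ∞ (fun x : ℝ × ℝ => H₁ x.1 x.2) ∧ ContDiff ℝ ∞ (fun x : ℝ × ℝ => H₂ x.1 x.2) ∧
      (∀ τ, Function.Periodic (H₁ τ) 1 ∧ Function.Periodic (H₂ τ) 1) ∧
      (∀ τ s t, H₁ τ s ≠ H₂ τ t) ∧
      (∀ τ ≤ 0, H₁ τ = γ₁ ∧ H₂ τ = γ₂) ∧ (∀ τ ≥ 1, H₁ τ = η₁ ∧ H₂ τ = η₂) := by
  obtain ⟨H₁, H₂, c₁, c₂, hp, hd, a₁, a₂, b₁, b₂⟩ := h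
  have hmem : ∀ τ, Real.smoothTransition τ ∈ Icc (0 : ℝ) 1 := fun τ =>
    ⟨Real.smoothTransition.nonneg τ, Real.smoothTransition.le_one τ⟩
  have hs : ContDiff ℝ ∞ (fun x : ℝ × ℝ => (Real.smoothTransition x.1, x.2)) :=
    (Real.smoothTransition.contDiff.comp contDiff_fst).prodMk contDiff_snd
  refine ⟨fun τ => H₁ (Real.smoothTransition τ), fun τ => H₂ (Real.smoothTransition τ),
    c₁.comp hs, c₂.comp hs, fun τ => hp _ (hmem τ), fun τ => hd _ (hmem τ), ?_, ?_⟩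
  · intro τ hτ
    simp only [Real.smoothTransition.zero_of_nonpos hτ]
    exact ⟨a₁, a₂⟩
  · intro τ hτ
    simp only [Real.smoothTransition.one_of_one_le hτ]
    exact ⟨b₁, b₂⟩

lemma periodic_of_hasDerivAt {f f' : ℝ → E3} (hf : Function.Periodic f 1)
    (h : ∀ s, HasDerivAt f (f' s) s) : Function.Periodic f' 1 := by
  intro s
  have h1 : HasDerivAt (fun s => f (s + 1)) (f' (s + 1)) s := (h (s + 1)).comp_add_const s 1
  rw [show (fun s => f (s + 1)) = f from funext hf] at h1
  exact h1.unique (h s)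

lemma integral_deriv_periodic {f f' : ℝ → ℝ} (hf : f 1 = f 0)
    (h : ∀ s, HasDerivAt f (f' s) s) (hc : Continuous f') : ∫ s in (0 : ℝ)..1, f' s = 0 := by
  rw [intervalIntegral.integral_eq_sub_of_hasDerivAt (fun s _ => h s)
    (hc.intervalIntegrable _ _), hf, sub_self]

/-- If the `τ`-derivative of `g` is the sum of an `s`-derivative and a `t`-derivative of functions
that take the same values at both ends, then the double integral of `g` is constant in `τ`. -/
lemma double_integral_const {g X Y X' Y' : ℝ → ℝ → ℝ → ℝ}
    (cg : Continuous fun p : (ℝ × ℝ) × ℝ => g p.1.1 p.1.2 p.2)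
    (cX : Continuous fun p : (ℝ × ℝ) × ℝ => X' p.1.1 p.1.2 p.2)
    (cY : Continuous fun p : (ℝ × ℝ) × ℝ => Y' p.1.1 p.1.2 p.2)
    (hX : ∀ τ s t, HasDerivAt (fun s => X τ s t) (X' τ s t) s)
    (hY : ∀ τ s t, HasDerivAt (fun t => Y τ s t) (Y' τ s t) t)
    (hg : ∀ τ s t, HasDerivAt (fun τ => g τ s t) (Y' τ s t - X' τ s t) τ)
    (pX : ∀ τ t, X τ 1 t = X τ 0 t) (pY : ∀ τ s, Y τ s 1 = Y τ s 0) (τ₀ τ₁ : ℝ) :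
    ∫ s in (0 : ℝ)..1, ∫ t in (0 : ℝ)..1, g τ₀ s t
      = ∫ s in (0 : ℝ)..1, ∫ t in (0 : ℝ)..1, g τ₁ s t := by
  have cI : Continuous fun p : ℝ × ℝ => ∫ t in (0 : ℝ)..1, g p.1 p.2 t :=
    intervalIntegral.continuous_parametric_intervalIntegral_of_continuous' (by exact cg) 0 1
  have cI' : Continuous fun p : ℝ × ℝ => ∫ t in (0 : ℝ)..1, (Y' p.1 p.2 t - X' p.1 p.2 t) :=
    intervalIntegral.continuous_parametric_intervalIntegral_of_continuous'
      (by exact cY.sub cX) 0 1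
  have hI : ∀ τ s, HasDerivAt (fun τ => ∫ t in (0 : ℝ)..1, g τ s t)
      (∫ t in (0 : ℝ)..1, (Y' τ s t - X' τ s t)) τ := fun τ s =>
    hasDerivAt_integral_of_continuous (F := fun τ t => g τ s t)
      (F' := fun τ t => Y' τ s t - X' τ s t)
      (fun τ => cg.comp (by fun_prop : Continuous fun t : ℝ => ((τ, s), t)))
      (fun τ t => hg τ s t)
      ((cY.sub cX).comp (by fun_prop : Continuous fun p : ℝ × ℝ => ((p.1, s), p.2))) 0 1 τ
  have hJ : ∀ τ, HasDerivAt (fun τ => ∫ s in (0 : ℝ)..1, ∫ t in (0 : ℝ)..1, g τ s t) 0 τ := by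
    intro τ
    refine (hasDerivAt_integral_of_continuous (F := fun τ s => ∫ t in (0 : ℝ)..1, g τ s t)
      (fun τ => cI.comp (by fun_prop : Continuous fun s : ℝ => (τ, s)))
      hI cI' 0 1 τ).congr_deriv ?_
    have cXτ : Continuous fun p : ℝ × ℝ => X' τ p.1 p.2 :=
      cX.comp (by fun_prop : Continuous fun p : ℝ × ℝ => ((τ, p.1), p.2))
    have cYτ : Continuous fun p : ℝ × ℝ => Y' τ p.1 p.2 :=
      cY.comp (by fun_prop : Continuous fun p : ℝ × ℝ => ((τ, p.1), p.2))
    have e1 : ∀ s, ∫ t in (0 : ℝ)..1, (Y' τ s t - X' τ s t) = -∫ t in (0 : ℝ)..1, X' τ s t := by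
      intro s
      have cx : Continuous fun t => X' τ s t :=
        cXτ.comp (by fun_prop : Continuous fun t : ℝ => (s, t))
      have cy : Continuous fun t => Y' τ s t :=
        cYτ.comp (by fun_prop : Continuous fun t : ℝ => (s, t))
      rw [intervalIntegral.integral_sub (cy.intervalIntegrable _ _) (cx.intervalIntegrable _ _),
        integral_deriv_periodic (pY τ s) (hY τ s) cy, zero_sub]
    simp only [e1]
    rw [intervalIntegral.integral_neg, integral_swap_of_continuous (by exact cXτ), neg_eq_zero]
    refine intervalIntegral.integral_zero_ae (ae_of_all _ fun t _ => ?_)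
    exact integral_deriv_periodic (pX τ t) (fun s => hX τ s t)
      (cXτ.comp (by fun_prop : Continuous fun s : ℝ => (s, t)))
  exact is_const_of_deriv_eq_zero (fun τ => (hJ τ).differentiableAt) (fun τ => (hJ τ).deriv) τ₀ τ₁

lemma partial_periodic {H D : ℝ → ℝ → E3} (hp : ∀ τ, Function.Periodic (H τ) 1)
    (hD : ∀ τ s, HasDerivAt (fun τ => H τ s) (D τ s) τ) (τ : ℝ) : D τ 1 = D τ 0 := by
  have h := hD τ (0 + 1)
  rw [show (fun τ => H τ (0 + 1)) = fun τ => H τ 0 from funext fun τ => hp τ 0, zero_add] at h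
  exact h.unique (hD τ 0)

/-- The Gauss integral does not change under disjoint homotopies. -/
theorem gaussLinkingIntegral_eq_of_homotopic {γ₁ γ₂ η₁ η₂ : ℝ → E3}
    (h : DisjointlyHomotopic γ₁ γ₂ η₁ η₂) :
    gaussLinkingIntegral γ₁ γ₂ = gaussLinkingIntegral η₁ η₂ := by
  obtain ⟨H₁, H₂, c₁, c₂, hp, hd, h0, h1⟩ := DisjointlyHomotopic.exists_global h
  obtain ⟨T₁, A, M₁, cT₁, cA, cM₁, hT₁, hA, hA', hT₁'⟩ := exists_partials c₁
  obtain ⟨T₂, C, M₂, cT₂, cC, cM₂, hT₂, hC, hC', hT₂'⟩ := exists_partials c₂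
  have k₁ : Continuous (Function.uncurry H₁) := c₁.continuous
  have k₂ : Continuous (Function.uncurry H₂) := c₂.continuous
  have hR : ∀ τ s t, H₂ τ t - H₁ τ s ≠ 0 := fun τ s t => sub_ne_zero.2 (hd τ s t).symm
  have q₁ : Continuous fun p : (ℝ × ℝ) × ℝ => (p.1.1, p.1.2) := by fun_prop
  have q₂ : Continuous fun p : (ℝ × ℝ) × ℝ => (p.1.1, p.2) := by fun_prop
  have r0 : Continuous fun p : (ℝ × ℝ) × ℝ => H₂ p.1.1 p.2 - H₁ p.1.1 p.1.2 :=
    (k₂.comp q₂).sub (k₁.comp q₁)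
  have rA : Continuous fun p : (ℝ × ℝ) × ℝ => A p.1.1 p.1.2 := cA.comp q₁
  have rC : Continuous fun p : (ℝ × ℝ) × ℝ => C p.1.1 p.2 := cC.comp q₂
  have rT : Continuous fun p : (ℝ × ℝ) × ℝ => T₂ p.1.1 p.2 - T₁ p.1.1 p.1.2 :=
    (cT₂.comp q₂).sub (cT₁.comp q₁)
  have rM₁ : Continuous fun p : (ℝ × ℝ) × ℝ => 0 - M₁ p.1.1 p.1.2 :=
    continuous_const.sub (cM₁.comp q₁)
  have rM₂ : Continuous fun p : (ℝ × ℝ) × ℝ => M₂ p.1.1 p.2 - 0 :=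
    (cM₂.comp q₂).sub continuous_const
  have r00 : ∀ p : (ℝ × ℝ) × ℝ, H₂ p.1.1 p.2 - H₁ p.1.1 p.1.2 ≠ 0 := fun p => hR _ _ _
  have hconst := double_integral_const (τ₀ := 0) (τ₁ := 1)
    (g := fun τ s t => angleForm (H₂ τ t - H₁ τ s) (A τ s) (C τ t))
    (X := fun τ s t => angleForm (H₂ τ t - H₁ τ s) (T₂ τ t - T₁ τ s) (C τ t))
    (Y := fun τ s t => angleForm (H₂ τ t - H₁ τ s) (A τ s) (T₂ τ t - T₁ τ s))
    (continuous_angleForm r0 rA rC r00)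
    (((continuous_angleFormDeriv r0 (continuous_const.sub rA) rT rC r00).add
      (continuous_angleForm r0 rM₁ rC r00)).add (continuous_angleForm r0 rT continuous_const r00))
    (((continuous_angleFormDeriv r0 (rC.sub continuous_const) rA rT r00).add
      (continuous_angleForm r0 continuous_const rT r00)).add (continuous_angleForm r0 rA rM₂ r00))
    (fun τ s t => hasDerivAt_angleForm ((hasDerivAt_const s (H₂ τ t)).sub (hA τ s))
      ((hasDerivAt_const s (T₂ τ t)).sub (hT₁' τ s)) (hasDerivAt_const s _) (hR τ s t))
    (fun τ s t => hasDerivAt_angleForm ((hC τ t).sub (hasDerivAt_const t (H₁ τ s)))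
      (hasDerivAt_const t _) ((hT₂' τ t).sub (hasDerivAt_const t (T₁ τ s))) (hR τ s t))
    (fun τ s t => by
      refine (hasDerivAt_angleForm ((hT₂ τ t).sub (hT₁ τ s)) (hA' τ s) (hC' τ t)
        (hR τ s t)).congr_deriv ?_
      have hcl := angleForm_closed (hR τ s t) (T₂ τ t - T₁ τ s) (A τ s) (C τ t)
      simp only [angleForm_zero_left, angleForm_zero_right, zero_sub, sub_zero,
        angleForm_neg_left, Pi.sub_apply]
      have e1 : angleFormDeriv (H₂ τ t - H₁ τ s) (-A τ s) (T₂ τ t - T₁ τ s) (C τ t)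
          = angleFormDeriv (H₂ τ t - H₁ τ s) (A τ s) (C τ t) (T₂ τ t - T₁ τ s) := by
        simp only [angleFormDeriv, det3_eq, PiLp.neg_apply, inner_neg_right]; ring
      have e2 : angleFormDeriv (H₂ τ t - H₁ τ s) (C τ t) (A τ s) (T₂ τ t - T₁ τ s)
          = -angleFormDeriv (H₂ τ t - H₁ τ s) (C τ t) (T₂ τ t - T₁ τ s) (A τ s) := by
        simp only [angleFormDeriv, det3_eq]; ring
      rw [e1, e2]
      linear_combination hcl)
    (fun τ t => by
      have p1 := (hp τ).1 0
      rw [zero_add] at p1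
      simp only [p1, partial_periodic (fun τ => (hp τ).1) hT₁])
    (fun τ s => by
      have p1 := (hp τ).2 0
      rw [zero_add] at p1
      simp only [p1, partial_periodic (fun τ => (hp τ).2) hT₂])
  have e : ∀ τ, gaussLinkingIntegral (H₁ τ) (H₂ τ) = (4 * Real.pi)⁻¹ *
      ∫ s in (0 : ℝ)..1, ∫ t in (0 : ℝ)..1,
        angleForm (H₂ τ t - H₁ τ s) (A τ s) (C τ t) := by
    intro τ
    simp only [gaussLinkingIntegral, angleForm, fun s => (hA τ s).deriv, fun t => (hC τ t).deriv]
  have e0 := e 0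
  have e1 := e 1
  rw [(h0 0 le_rfl).1, (h0 0 le_rfl).2] at e0
  rw [(h1 1 le_rfl).1, (h1 1 le_rfl).2] at e1
  simp only [(h0 0 le_rfl).1, (h0 0 le_rfl).2, (h1 1 le_rfl).1, (h1 1 le_rfl).2] at hconst
  rw [e0, e1, hconst]

/-! ### The linking form of a closed curve and its local primitives -/

/-- The Biot–Savart field of a closed curve, with the orientation convention of the Gauss
integral. -/
noncomputable def biotSavart (σ : ℝ → E3) (x : E3) : E3 :=
  ∫ s in (0 : ℝ)..1, (‖x - σ s‖ ^ 3)⁻¹ • cross (x - σ s) (deriv σ s)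

/-- The closed one-form on the complement of a closed curve whose integral along a second closed
curve is the Gauss linking integral. -/
noncomputable def linkingForm (σ : ℝ → E3) (x : E3) : E3 →L[ℝ] ℝ :=
  (4 * Real.pi)⁻¹ • innerSL ℝ (biotSavart σ x)

/-- `b` is a primitive of the linking form of `σ` near `x`. -/
def IsPrimitiveNear (σ : ℝ → E3) (b : E3 → ℝ) (x : E3) : Prop :=
  ∀ᶠ y in 𝓝 x, HasFDerivAt b (linkingForm σ y) y

/-- The vector potential `det (e, r, w) / (‖r‖ (‖r‖ + ⟨e, r⟩))` of the solid angle form. It is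
singular on the ray spanned by `-e`, and `e` is taken to be a unit vector. -/
noncomputable def potential (e r w : E3) : ℝ := det3 e r w / (‖r‖ * (‖r‖ + inner ℝ e r))

/-- The gradient of `r ↦ potential e r w`. -/
noncomputable def potentialGrad (e r w : E3) : E3 :=
  (‖r‖ * (‖r‖ + inner ℝ e r))⁻¹ • cross w e -
    (det3 e r w / (‖r‖ * (‖r‖ + inner ℝ e r)) ^ 2) •
      ((2 + inner ℝ e r / ‖r‖) • r + ‖r‖ • e)

lemma ne_zero_of_add_pos {e r : E3} (h : 0 < ‖r‖ + inner ℝ e r) : r ≠ 0 := by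
  rintro rfl; simp at h

lemma hasFDerivAt_norm' {r : E3} (h : r ≠ 0) :
    HasFDerivAt (fun x : E3 => ‖x‖) (innerSL ℝ (‖r‖⁻¹ • r)) r := by
  have hn : ‖r‖ ≠ 0 := by positivity
  have h1 := (hasStrictFDerivAt_norm_sq r).hasFDerivAt.sqrt (by positivity)
  simp only [Real.sqrt_sq (norm_nonneg _)] at h1
  refine h1.congr_fderiv ?_
  ext v
  simp
  field_simp

lemma hasFDerivAt_potential {e r : E3} (w : E3) (h : 0 < ‖r‖ + inner ℝ e r) :
    HasFDerivAt (fun x => potential e x w) (innerSL ℝ (potentialGrad e r w)) r := by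
  have h0 := ne_zero_of_add_pos h
  have hn : ‖r‖ ≠ 0 := by positivity
  have h1 : HasFDerivAt (fun x : E3 => inner ℝ e x) (innerSL ℝ e) r := (innerSL ℝ e).hasFDerivAt
  have h2 : HasFDerivAt (fun x : E3 => det3 e x w) (innerSL ℝ (cross w e)) r := by
    have : (fun x : E3 => det3 e x w) = fun x => innerSL ℝ (cross w e) x := by
      funext x; rw [innerSL_apply_apply, inner_cross]; simp only [det3_eq]; ring
    rw [this]; exact (innerSL ℝ (cross w e)).hasFDerivAt
  have hN := hasFDerivAt_norm' h0
  have h3 : HasFDerivAt (fun x : E3 => ‖x‖ * (‖x‖ + inner ℝ e x)) _ r := hN.mul (hN.add h1)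
  have h4 : HasFDerivAt (fun x : E3 => (‖x‖ * (‖x‖ + inner ℝ e x))⁻¹) _ r :=
    (hasDerivAt_inv (mul_ne_zero hn h.ne')).comp_hasFDerivAt r h3
  have h5 : HasFDerivAt (fun x : E3 => det3 e x w * (‖x‖ * (‖x‖ + inner ℝ e x))⁻¹) _ r := h2.mul h4
  simp only [potential, div_eq_mul_inv]
  refine h5.congr_fderiv ?_
  ext v
  simp only [potentialGrad, add_apply, smul_apply,
    innerSL_apply_apply, smul_eq_mul, inner_sub_left, inner_add_left, real_inner_smul_left]
  field_simp
  ring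

lemma hasFDerivAt_comp_sub {f : E3 → ℝ} {L : E3 →L[ℝ] ℝ} {a y : E3}
    (h : HasFDerivAt f L (y - a)) : HasFDerivAt (fun z => f (z - a)) L y := by
  have h1 : HasFDerivAt (fun z : E3 => z - a) (ContinuousLinearMap.id ℝ E3) y :=
    (hasFDerivAt_id y).sub_const a
  exact h.comp y h1

/-- The exterior derivative of the vector potential is the solid angle form. -/
lemma inner_potentialGrad {e r : E3} (he : ‖e‖ = 1) (h : 0 < ‖r‖ + inner ℝ e r) (v w : E3) :
    inner ℝ (potentialGrad e r w) v = inner ℝ (potentialGrad e r v) w + angleForm r v w := by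
  have h0 := ne_zero_of_add_pos h
  have hn : ‖r‖ ≠ 0 := by positivity
  have hM := h.ne'
  have hN2 : ‖r‖ ^ 2 = inner ℝ r r := (real_inner_self_eq_norm_sq r).symm
  have he2 : inner ℝ e e = 1 := by rw [real_inner_self_eq_norm_sq, he, one_pow]
  have X : inner ℝ r v * det3 e r w - inner ℝ r w * det3 e r v
      = det3 e v w * ‖r‖ ^ 2 - det3 r v w * inner ℝ e r := by
    rw [hN2]; simp only [inner_eq, det3_eq]; ring
  have Y : inner ℝ e v * det3 e r w - inner ℝ e w * det3 e r v
      = det3 e v w * inner ℝ e r - det3 r v w := by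
    rw [← mul_one (det3 r v w), ← he2]; simp only [inner_eq, det3_eq]; ring
  have cw : inner ℝ (cross w e) v = det3 e v w := by
    rw [inner_cross]; simp only [det3_eq]; ring
  have cv : inner ℝ (cross v e) w = -det3 e v w := by
    rw [inner_cross]; simp only [det3_eq]; ring
  simp only [potentialGrad, angleForm, inner_sub_left, inner_add_left, real_inner_smul_left, cw, cv]
  set N := ‖r‖
  set c := inner ℝ e r
  field_simp
  linear_combination (-(2 * N + c)) * X - N ^ 2 * Y

lemma continuousOn_potentialGrad {X : Type*} [TopologicalSpace X] {e : E3} {r w : X → E3}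
    {s : Set X} (hr : ContinuousOn r s) (hw : ContinuousOn w s)
    (h : ∀ x ∈ s, 0 < ‖r x‖ + inner ℝ e (r x)) :
    ContinuousOn (fun x => potentialGrad e (r x) (w x)) s := by
  have h1 : ContinuousOn (fun x => cross (w x) e) s :=
    continuous_cross.comp_continuousOn (hw.prodMk continuousOn_const)
  have h2 : ContinuousOn (fun x => det3 e (r x) (w x)) s := continuousOn_det3 continuousOn_const hr hw
  have hi : ContinuousOn (fun x => inner ℝ e (r x)) s := ContinuousOn.inner continuousOn_const hr
  have h3 : ContinuousOn (fun x => ‖r x‖ * (‖r x‖ + inner ℝ e (r x))) s :=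
    hr.norm.mul (hr.norm.add hi)
  have hn : ∀ x ∈ s, ‖r x‖ ≠ 0 := fun x hx => norm_ne_zero_iff.2 (ne_zero_of_add_pos (h x hx))
  have h4 : ∀ x ∈ s, ‖r x‖ * (‖r x‖ + inner ℝ e (r x)) ≠ 0 := fun x hx =>
    mul_ne_zero (hn x hx) (h x hx).ne'
  exact ((h3.inv₀ h4).smul h1).sub ((h2.div (h3.pow 2) fun x hx => pow_ne_zero 2 (h4 x hx)).smul
    (((continuousOn_const.add (hi.div hr.norm hn)).smul hr).add (hr.norm.smul continuousOn_const)))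

attribute [local irreducible] potentialGrad

/-- The integral of the vector potential along a closed curve: up to sign, the solid angle under
which the curve is seen from `x`. -/
noncomputable def solidAngle (e : E3) (σ : ℝ → E3) (x : E3) : ℝ :=
  ∫ s in (0 : ℝ)..1, potential e (x - σ s) (deriv σ s)

section ClosedCurve
variable {σ : ℝ → E3}

lemma _root_.IsClosedCurve.continuous (hσ : IsClosedCurve σ) : Continuous σ := hσ.smooth.continuous

lemma _root_.IsClosedCurve.hasDerivAt (hσ : IsClosedCurve σ) (s : ℝ) :
    HasDerivAt σ (deriv σ s) s :=
  (hσ.smooth.differentiable (by simp) s).hasDerivAt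

lemma _root_.IsClosedCurve.continuous_deriv (hσ : IsClosedCurve σ) : Continuous (deriv σ) :=
  hσ.smooth.continuous_deriv (by simp)

lemma _root_.IsClosedCurve.deriv_periodic (hσ : IsClosedCurve σ) :
    Function.Periodic (deriv σ) 1 := periodic_of_hasDerivAt hσ.periodic hσ.hasDerivAt

lemma _root_.IsClosedCurve.one_eq_zero (hσ : IsClosedCurve σ) : σ 1 = σ 0 := by
  simpa using hσ.periodic 0

lemma range_eq_image (hσ : IsClosedCurve σ) : range σ = σ '' Icc 0 1 := by
  have := hσ.periodic.image_Icc one_pos 0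
  rw [zero_add] at this
  exact this.symm

lemma isCompact_range (hσ : IsClosedCurve σ) : IsCompact (range σ) := by
  rw [range_eq_image hσ]
  exact isCompact_Icc.image hσ.continuous

lemma isOpen_add_pos (hσ : IsClosedCurve σ) (e : E3) :
    IsOpen {x : E3 | ∀ s, 0 < ‖x - σ s‖ + inner ℝ e (x - σ s)} := by
  have h : {x : E3 | ∀ s, 0 < ‖x - σ s‖ + inner ℝ e (x - σ s)}
      = {x : E3 | ∀ p ∈ range σ, 0 < ‖x - p‖ + inner ℝ e (x - p)} := by
    ext x; simp
  rw [h, isOpen_iff_mem_nhds]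
  intro x hx
  have hc : Continuous fun z : E3 × E3 => ‖z.1 - z.2‖ + inner ℝ e (z.1 - z.2) := by fun_prop
  refine (isCompact_range hσ).eventually_forall_of_forall_eventually fun p hp => ?_
  exact hc.continuousAt.eventually (lt_mem_nhds (hx p hp))

lemma inner_biotSavart (hσ : IsClosedCurve σ) {x : E3} (hx : ∀ s, x ≠ σ s) (v : E3) :
    inner ℝ (biotSavart σ x) v = ∫ s in (0 : ℝ)..1, angleForm (x - σ s) (deriv σ s) v := by
  have hc : Continuous fun s => (‖x - σ s‖ ^ 3)⁻¹ • cross (x - σ s) (deriv σ s) := by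
    have h1 : Continuous fun s => x - σ s := continuous_const.sub hσ.continuous
    exact ((h1.norm.pow 3).inv₀ fun s => pow_ne_zero 3 (norm_ne_zero_iff.2
      (sub_ne_zero.2 (hx s)))).smul (continuous_cross.comp (h1.prodMk hσ.continuous_deriv))
  have := (innerSL ℝ v).intervalIntegral_comp_comm (hc.intervalIntegrable (μ := volume) 0 1)
  rw [real_inner_comm, biotSavart]
  refine Eq.trans (by simpa using this.symm) ?_
  refine intervalIntegral.integral_congr fun s _ => ?_
  simp only [angleForm, ← inner_cross]
  rw [real_inner_comm]
  field_simp

theorem hasFDerivAt_solidAngle (hσ : IsClosedCurve σ) {e : E3} (he : ‖e‖ = 1) {x : E3}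
    (hx : ∀ s, 0 < ‖x - σ s‖ + inner ℝ e (x - σ s)) :
    HasFDerivAt (solidAngle e σ) (-innerSL ℝ (biotSavart σ x)) x := by
  set U := {x : E3 | ∀ s, 0 < ‖x - σ s‖ + inner ℝ e (x - σ s)} with hU
  have cont : ContinuousOn (fun p : E3 × ℝ => potentialGrad e (p.1 - σ p.2) (deriv σ p.2))
      (U ×ˢ univ) :=
    continuousOn_potentialGrad
      (continuous_fst.sub (hσ.continuous.comp continuous_snd)).continuousOn
      (hσ.continuous_deriv.comp continuous_snd).continuousOn (fun p hp => hp.1 p.2)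
  have hd : ∀ y ∈ U, ∀ s, HasFDerivAt (fun z => potential e (z - σ s) (deriv σ s))
      (innerSL ℝ (potentialGrad e (y - σ s) (deriv σ s))) y := by
    intro y hy s
    exact hasFDerivAt_comp_sub (hasFDerivAt_potential (deriv σ s) (hy s))
  have hF : ∀ y ∈ U, Continuous fun s => potential e (y - σ s) (deriv σ s) := by
    intro y hy
    have h1 : Continuous fun s => y - σ s := continuous_const.sub hσ.continuous
    exact (continuous_det3 continuous_const h1 hσ.continuous_deriv).div₀
      (h1.norm.mul (h1.norm.add (continuous_const.inner h1)))
      fun s => mul_ne_zero (norm_ne_zero_iff.2 (ne_zero_of_add_pos (hy s))) (hy s).ne'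
  have hcF : ContinuousOn (Function.uncurry fun y s =>
      innerSL ℝ (potentialGrad e (y - σ s) (deriv σ s))) (U ×ˢ univ) :=
    (innerSL ℝ (E := E3)).continuous.comp_continuousOn cont
  refine (hasFDerivAt_integral_of_continuousOn (isOpen_add_pos hσ e) hF hd hcF hx 0 1).congr_fderiv
    ?_
  ext v
  have hs : Continuous fun s => x - σ s := continuous_const.sub hσ.continuous
  have c0 : Continuous fun s => potentialGrad e (x - σ s) (deriv σ s) := by
    rw [← continuousOn_univ]
    exact continuousOn_potentialGrad hs.continuousOn hσ.continuous_deriv.continuousOn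
      (fun s _ => hx s)
  have c1 : Continuous fun s => innerSL ℝ (potentialGrad e (x - σ s) (deriv σ s)) :=
    (innerSL ℝ (E := E3)).continuous.comp c0
  have c2 : Continuous fun s => inner ℝ (potentialGrad e (x - σ s) v) (deriv σ s) := by
    rw [← continuousOn_univ]
    have h1 : ContinuousOn (fun s => potentialGrad e (x - σ s) v) univ :=
      continuousOn_potentialGrad hs.continuousOn continuousOn_const (fun s _ => hx s)
    exact h1.inner hσ.continuous_deriv.continuousOn
  have c3 : Continuous fun s => angleForm (x - σ s) v (deriv σ s) :=
    continuous_angleForm hs continuous_const hσ.continuous_deriv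
      fun s => ne_zero_of_add_pos (hx s)
  rw [ContinuousLinearMap.intervalIntegral_apply (c1.intervalIntegrable _ _)]
  simp only [innerSL_apply_apply, neg_apply]
  rw [inner_biotSavart hσ fun s => sub_ne_zero.1 (ne_zero_of_add_pos (hx s))]
  simp_rw [fun s => inner_potentialGrad he (hx s) v (deriv σ s)]
  rw [intervalIntegral.integral_add (c2.intervalIntegrable _ _) (c3.intervalIntegrable _ _),
    ← intervalIntegral.integral_neg]
  have hz : ∫ s in (0 : ℝ)..1, inner ℝ (potentialGrad e (x - σ s) v) (deriv σ s) = 0 := by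
    refine integral_deriv_periodic (f := fun s => -potential e (x - σ s) v)
      (by simp only [hσ.one_eq_zero]) (fun s => ?_) c2
    have := ((hasFDerivAt_potential v (hx s)).comp_hasDerivAt s
      ((hσ.hasDerivAt s).const_sub x)).neg
    exact this.congr_deriv (by simp)
  rw [hz, zero_add]
  exact intervalIntegral.integral_congr fun s _ => angleForm_swap _ _ _

/-- Off the half-cylinder swept out by `σ` in the direction `-e`, minus the solid angle over `4π`
is a primitive of the linking form. -/
lemma isPrimitiveNear_solidAngle (hσ : IsClosedCurve σ) {e : E3} (he : ‖e‖ = 1) {x : E3}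
    (hx : ∀ s, 0 < ‖x - σ s‖ + inner ℝ e (x - σ s)) :
    IsPrimitiveNear σ (fun y => -((4 * Real.pi)⁻¹ * solidAngle e σ y)) x := by
  filter_upwards [(isOpen_add_pos hσ e).mem_nhds hx] with y hy
  refine ((hasFDerivAt_solidAngle hσ he hy).const_mul _).neg.congr_fderiv ?_
  simp [linkingForm]

/-- The complement of a smooth image of the plane in three-space is dense. -/
lemma dense_compl_range_of_plane {f : ℝ × ℝ → E3} (hf : ContDiff ℝ 1 f) : Dense (range f)ᶜ :=
  hf.dense_compl_range_of_finrank_lt_finrank (by simp)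

lemma add_inner_pos {e r : E3} (he : ‖e‖ = 1) (h : ∀ c : ℝ, r ≠ c • e) :
    0 < ‖r‖ + inner ℝ e r := by
  have h1 : -(‖e‖ * ‖r‖) ≤ inner ℝ e r := neg_le_of_abs_le (abs_real_inner_le_norm e r)
  rw [he, one_mul] at h1
  refine lt_of_le_of_ne (by linarith) fun h2 => ?_
  have h3 : inner ℝ (-e) r = ‖-e‖ * ‖r‖ := by rw [inner_neg_left, norm_neg, he]; linarith
  rw [inner_eq_norm_mul_iff_real, norm_neg, he, one_smul] at h3
  exact h (-‖r‖) (by rw [neg_smul, ← smul_neg, h3])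

/-- The linking form has a primitive near each point off the curve. -/
theorem exists_isPrimitiveNear (hσ : IsClosedCurve σ) {x : E3} (hx : x ∉ range σ) :
    ∃ b, IsPrimitiveNear σ b x := by
  -- a direction that is not the direction from `x` to a point of `σ`
  have hf : ContDiff ℝ 1 fun p : ℝ × ℝ => p.1 • (x - σ p.2) :=
    contDiff_fst.smul (contDiff_const.sub ((hσ.smooth.of_le (by simp)).comp contDiff_snd))
  obtain ⟨d, hd⟩ := (dense_compl_range_of_plane hf).nonempty
  have hd0 : d ≠ 0 := by
    rintro rfl
    exact hd ⟨(0, 0), by simp⟩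
  have hn : ‖d‖ ≠ 0 := by positivity
  have he : ‖‖d‖⁻¹ • d‖ = 1 := by rw [norm_smul, norm_inv, norm_norm, inv_mul_cancel₀ hn]
  refine ⟨_, isPrimitiveNear_solidAngle hσ he fun s => add_inner_pos he fun c hc => ?_⟩
  have hr : x - σ s ≠ 0 := sub_ne_zero.2 fun h => hx ⟨s, h.symm⟩
  have hc0 : c ≠ 0 := by
    rintro rfl
    exact hr (by rw [hc, zero_smul])
  refine hd ⟨(c⁻¹ * ‖d‖, s), ?_⟩
  simp only
  rw [hc, smul_smul, smul_smul]
  have : c⁻¹ * ‖d‖ * c * ‖d‖⁻¹ = 1 := by field_simp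
  rw [this, one_smul]

end ClosedCurve

/-- The Gauss integral is the integral of the linking form of the first curve along the second. -/
theorem gaussLinkingIntegral_eq_integral_linkingForm {γ₁ γ₂ : ℝ → E3} (h₁ : IsClosedCurve γ₁)
    (h₂ : IsClosedCurve γ₂) (hd : ∀ s t, γ₁ s ≠ γ₂ t) :
    gaussLinkingIntegral γ₁ γ₂ = ∫ t in (0 : ℝ)..1, linkingForm γ₁ (γ₂ t) (deriv γ₂ t) := by
  have hc : Continuous (Function.uncurry fun s t =>
      angleForm (γ₂ t - γ₁ s) (deriv γ₁ s) (deriv γ₂ t)) :=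
    continuous_angleForm ((h₂.continuous.comp continuous_snd).sub
      (h₁.continuous.comp continuous_fst)) (h₁.continuous_deriv.comp continuous_fst)
      (h₂.continuous_deriv.comp continuous_snd) fun p => sub_ne_zero.2 (hd _ _).symm
  have h := integral_swap_of_continuous hc 0 1 0 1
  rw [gaussLinkingIntegral]
  simp only [linkingForm, smul_apply, innerSL_apply_apply, smul_eq_mul,
    fun t => inner_biotSavart h₁ (fun s => (hd s t).symm) (deriv γ₂ t)]
  rw [intervalIntegral.integral_const_mul]
  exact congrArg _ h

lemma continuous_linkingForm_along {γ₁ γ₂ : ℝ → E3} (h₁ : IsClosedCurve γ₁)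
    (h₂ : IsClosedCurve γ₂) (hd : ∀ s t, γ₁ s ≠ γ₂ t) :
    Continuous fun t => linkingForm γ₁ (γ₂ t) (deriv γ₂ t) := by
  have hc : Continuous (Function.uncurry fun t s =>
      angleForm (γ₂ t - γ₁ s) (deriv γ₁ s) (deriv γ₂ t)) :=
    continuous_angleForm ((h₂.continuous.comp continuous_fst).sub
      (h₁.continuous.comp continuous_snd)) (h₁.continuous_deriv.comp continuous_snd)
      (h₂.continuous_deriv.comp continuous_fst) fun p => sub_ne_zero.2 (hd _ _).symm
  simp only [linkingForm, smul_apply, innerSL_apply_apply, smul_eq_mul,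
    fun t => inner_biotSavart h₁ (fun s => (hd s t).symm) (deriv γ₂ t)]
  exact continuous_const.mul
    (intervalIntegral.continuous_parametric_intervalIntegral_of_continuous' hc 0 1)

/-! ### Integrals of derivatives of functions with jumps -/

lemma finite_of_isolated {T : Set ℝ} (hT : ∀ t, ∀ᶠ t' in 𝓝[≠] t, t' ∉ T) :
    {t | t ∈ Ico (0 : ℝ) 1 ∧ t ∈ T}.Finite := by
  by_contra h
  obtain ⟨x, -, hx⟩ := Set.Infinite.exists_accPt_of_subset_isCompact h (isCompact_Icc (a := 0)
    (b := (1 : ℝ))) fun t ht => Ico_subset_Icc_self ht.1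
  rw [accPt_iff_frequently_nhdsNE] at hx
  exact hx ((hT x).mono fun t ht h => ht h.2)

/-- A periodic function that has derivative `b` off a discrete set `T`, and whose value jumps by
`J t` at each `t ∈ T`: the integral of `b` over a period is minus the sum of the jumps. -/
theorem integral_eq_neg_sum_jumps {b Ω J : ℝ → ℝ} {T : Set ℝ} (hb : Continuous b)
    (hT : ∀ t, ∀ᶠ t' in 𝓝[≠] t, t' ∉ T) (hTp : (1 : ℝ) ∈ T ↔ (0 : ℝ) ∈ T)
    (hΩp : Function.Periodic Ω 1) (hΩ : ∀ t ∉ T, HasDerivAt Ω (b t) t)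
    (hJ : ∀ t ∈ T, ∃ L, Tendsto Ω (𝓝[<] t) (𝓝 L) ∧ Tendsto Ω (𝓝[>] t) (𝓝 (L + J t))) :
    ∫ t in (0 : ℝ)..1, b t = -∑ᶠ t ∈ {t | t ∈ Ico (0 : ℝ) 1 ∧ t ∈ T}, J t := by
  classical
  have hfin := finite_of_isolated hT
  choose! L hL using hJ
  set F := hfin.toFinset with hF
  have hFm : ∀ i, i ∈ F ↔ i ∈ Ico (0 : ℝ) 1 ∧ i ∈ T := fun i => by simp [hF]
  -- the left-continuous version of `Ω`, with the jumps removed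
  set Ω' : ℝ → ℝ := fun t => if t ∈ T then L t else Ω t with hΩ'
  set St : ℝ → ℝ := fun t => ∑ i ∈ F, if i < t then J i else 0 with hSt
  have hΩeq : ∀ t, Ω' =ᶠ[𝓝[≠] t] Ω := fun t => (hT t).mono fun t' ht' => by simp [hΩ', ht']
  have hleft : ∀ t, ContinuousWithinAt Ω' (Iio t) t := by
    intro t
    by_cases ht : t ∈ T
    · have : Ω' t = L t := by simp [hΩ', ht]
      rw [ContinuousWithinAt, this]
      exact (hL t ht).1.congr' ((hΩeq t).filter_mono
        (nhdsWithin_mono t fun x hx => ne_of_lt hx)).symm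
    · have : Ω' t = Ω t := by simp [hΩ', ht]
      rw [ContinuousWithinAt, this]
      exact ((hΩ t ht).continuousAt.tendsto.mono_left nhdsWithin_le_nhds).congr'
        ((hΩeq t).filter_mono (nhdsWithin_mono t fun x hx => ne_of_lt hx)).symm
  have hSleft : ∀ t, ContinuousWithinAt St (Iio t) t := by
    intro t
    have h1 : ∀ᶠ t' in 𝓝[<] t, ∀ i ∈ F, (i < t' ↔ i < t) := by
      rw [Filter.eventually_all_finset]
      intro i _
      by_cases hi : i < t
      · filter_upwards [nhdsWithin_le_nhds (lt_mem_nhds hi)] with t' ht'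
        exact ⟨fun _ => hi, fun _ => ht'⟩
      · filter_upwards [self_mem_nhdsWithin] with t' ht'
        exact ⟨fun h => absurd (h.trans ht') hi, fun h => absurd h hi⟩
    refine tendsto_const_nhds.congr' (h1.mono fun t' ht' => ?_)
    simp only [hSt]
    exact Finset.sum_congr rfl fun i hi => by simp only [ht' i hi]
  have hSright : ∀ t, ∀ᶠ t' in 𝓝[>] t, St t' = St t + ∑ i ∈ F, if i = t then J i else 0 := by
    intro t
    have h1 : ∀ᶠ t' in 𝓝[>] t, ∀ i ∈ F, (i < t' ↔ i ≤ t) := by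
      rw [Filter.eventually_all_finset]
      intro i _
      by_cases hi : i ≤ t
      · filter_upwards [self_mem_nhdsWithin] with t' ht'
        exact ⟨fun _ => hi, fun _ => hi.trans_lt ht'⟩
      · filter_upwards [nhdsWithin_le_nhds (gt_mem_nhds (not_le.1 hi))] with t' ht'
        exact ⟨fun h => absurd (h.trans ht') (lt_irrefl i), fun h => absurd h hi⟩
    filter_upwards [h1] with t' ht'
    simp only [hSt, ← Finset.sum_add_distrib]
    refine Finset.sum_congr rfl fun i hi => ?_
    simp only [ht' i hi]
    rcases lt_trichotomy i t with h | h | h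
    · simp [h, h.le, h.ne]
    · simp [h]
    · simp [h.not_ge, h.not_gt, h.ne']
  have hright : ∀ t ∈ Ico (0 : ℝ) 1, ContinuousWithinAt (fun t => Ω' t - St t) (Ioi t) t := by
    intro t ht01
    have hev : Ω' =ᶠ[𝓝[>] t] Ω :=
      (hΩeq t).filter_mono (nhdsWithin_mono t fun x hx => ne_of_gt hx)
    by_cases ht : t ∈ T
    · have h1 : Ω' t = L t := by simp [hΩ', ht]
      have h2 : (∑ i ∈ F, if i = t then J i else 0) = J t := by
        rw [Finset.sum_ite_eq' F t J, if_pos ((hFm t).2 ⟨ht01, ht⟩)]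
      have h3 : Tendsto (fun t' => Ω t' - (St t + J t)) (𝓝[>] t) (𝓝 (L t + J t - (St t + J t))) :=
        (hL t ht).2.sub tendsto_const_nhds
      rw [ContinuousWithinAt, h1]
      rw [show L t + J t - (St t + J t) = L t - St t by ring] at h3
      refine h3.congr' ?_
      filter_upwards [hev, hSright t] with t' h4 h5
      rw [h4, h5, h2]
    · have h1 : Ω' t = Ω t := by simp [hΩ', ht]
      have h2 : (∑ i ∈ F, if i = t then J i else 0) = 0 := by
        rw [Finset.sum_ite_eq' F t J, if_neg fun h => ht ((hFm t).1 h).2]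
      have h3 : Tendsto (fun t' => Ω t' - St t) (𝓝[>] t) (𝓝 (Ω t - St t)) :=
        ((hΩ t ht).continuousAt.tendsto.mono_left nhdsWithin_le_nhds).sub tendsto_const_nhds
      rw [ContinuousWithinAt, h1]
      refine h3.congr' ?_
      filter_upwards [hev, hSright t] with t' h4 h5
      rw [h4, h5, h2, add_zero]
  have hcont : ContinuousOn (fun t => Ω' t - St t) (Icc 0 1) := by
    intro t ht
    rcases eq_or_lt_of_le ht.2 with rfl | h1
    · refine ContinuousWithinAt.mono (t := Iic 1) ?_ fun x hx => hx.2
      rw [← Iio_insert, continuousWithinAt_insert_self]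
      exact (hleft 1).sub (hSleft 1)
    · exact (continuousAt_iff_continuous_left'_right'.2 ⟨(hleft t).sub (hSleft t),
        hright t ⟨ht.1, h1⟩⟩).continuousWithinAt
  have hder : ∀ t ∈ Ioo (0 : ℝ) 1 \ (F : Set ℝ), HasDerivAt (fun t => Ω' t - St t) (b t) t := by
    intro t ht
    have htT : t ∉ T := fun h => ht.2 ((hFm t).2 ⟨⟨ht.1.1.le, ht.1.2⟩, h⟩)
    have h1 : ∀ᶠ t' in 𝓝 t, Ω' t' - St t' = Ω t' - St t := by
      have h2 : ∀ᶠ t' in 𝓝 t, t' ∉ T := by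
        have := hT t
        rw [eventually_nhdsWithin_iff] at this
        filter_upwards [this] with t' h3
        by_cases h : t' = t
        · rwa [h]
        · exact h3 h
      have h3 : ∀ᶠ t' in 𝓝 t, ∀ i ∈ F, (i < t' ↔ i < t) := by
        rw [Filter.eventually_all_finset]
        intro i hi
        have hne : i ≠ t := fun h => htT (h ▸ ((hFm i).1 hi).2)
        rcases lt_or_gt_of_ne hne with h | h
        · filter_upwards [lt_mem_nhds h] with t' ht'
          exact ⟨fun _ => h, fun _ => ht'⟩
        · filter_upwards [gt_mem_nhds h] with t' ht'
          exact ⟨fun h' => absurd (h'.trans ht') (lt_irrefl i), fun h' => absurd (h'.trans h)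
            (lt_irrefl i)⟩
      filter_upwards [h2, h3] with t' h4 h5
      have : St t' = St t := Finset.sum_congr rfl fun i hi => by simp only [h5 i hi]
      simp [hΩ', h4, this]
    exact ((hΩ t htT).sub_const (St t)).congr_of_eventuallyEq h1
  rw [integral_eq_of_hasDerivAt_off_countable_of_le _ b zero_le_one F.countable_toSet hcont hder
    (hb.intervalIntegrable _ _)]
  have hΩ01 : Ω' 1 = Ω' 0 := by
    by_cases h : (0 : ℝ) ∈ T
    · simp only [hΩ', h, hTp.2 h, if_true]
      have h1 : Tendsto (fun x : ℝ => x + 1) (𝓝[<] 0) (𝓝[<] 1) := by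
        refine tendsto_nhdsWithin_iff.2
          ⟨((by fun_prop : Continuous fun x : ℝ => x + 1).tendsto' 0 1 (by norm_num)).mono_left
            nhdsWithin_le_nhds, ?_⟩
        filter_upwards [self_mem_nhdsWithin] with x hx
        simp only [mem_Iio] at hx ⊢
        linarith
      have h2 := (hL 1 (hTp.2 h)).1.comp h1
      rw [show Ω ∘ (fun x : ℝ => x + 1) = Ω from funext hΩp] at h2
      exact tendsto_nhds_unique h2 (hL 0 h).1
    · simp only [hΩ', h, mt hTp.1 h, if_false]
      simpa using hΩp 0
  have hS1 : St 1 = ∑ i ∈ F, J i :=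
    Finset.sum_congr rfl fun i hi => if_pos ((hFm i).1 hi).1.2
  have hS0 : St 0 = 0 :=
    Finset.sum_eq_zero fun i hi => if_neg (not_lt.2 ((hFm i).1 hi).1.1)
  rw [finsum_mem_eq_finite_toFinset_sum _ hfin, hΩ01, hS1, hS0]
  ring

/-! ### Logarithms of curves in the punctured plane and winding numbers -/

/-- A `C¹` curve in `ℂ ∖ {0}` has a `C¹` logarithm. -/
theorem exists_log {D D' : ℝ → ℂ} (hD : ∀ t, HasDerivAt D (D' t) t) (hc : Continuous D')
    (h0 : ∀ t, D t ≠ 0) :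
    ∃ l : ℝ → ℂ, (∀ t, HasDerivAt l (D' t / D t) t) ∧ ∀ t, Complex.exp (l t) = D t := by
  have hDc : Continuous D := continuous_iff_continuousAt.2 fun t => (hD t).continuousAt
  have hq : Continuous fun t => D' t / D t := hc.div₀ hDc h0
  set l : ℝ → ℂ := fun t => Complex.log (D 0) + ∫ u in (0 : ℝ)..t, D' u / D u with hl
  have hld : ∀ t, HasDerivAt l (D' t / D t) t := fun t =>
    (intervalIntegral.integral_hasDerivAt_right (hq.intervalIntegrable _ _)
      hq.stronglyMeasurable.stronglyMeasurableAtFilter hq.continuousAt).const_add _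
  refine ⟨l, hld, fun t => ?_⟩
  have hprod : ∀ t, HasDerivAt (fun t => D t * Complex.exp (-l t)) 0 t := fun t =>
    ((hD t).mul (hld t).neg.cexp).congr_deriv (by
      have := h0 t
      simp only [Pi.neg_apply]
      field_simp
      ring)
  have := is_const_of_deriv_eq_zero (fun t => (hprod t).differentiableAt)
    (fun t => (hprod t).deriv) t 0
  simp only [hl, intervalIntegral.integral_same, add_zero] at this
  rw [Complex.exp_neg (Complex.log (D 0)), Complex.exp_log (h0 0), mul_inv_cancel₀ (h0 0),
    Complex.exp_neg] at this
  field_simp at this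
  exact this.symm

/-- The winding number integral of a curve that avoids the vertical line through `p` is the number
of times the curve winds around `p`. -/
theorem exists_windsAround {c : ℝ → E3} (hc : IsClosedCurve c) {p : E3}
    (hp : ∀ s, (c s 0 - p 0) ^ 2 + (c s 1 - p 1) ^ 2 ≠ 0) :
    ∃ k : ℤ, WindsAround c p k ∧ windingNumber c p = k := by
  set D : ℝ → ℂ := fun s => ⟨c s 0 - p 0, c s 1 - p 1⟩ with hDdef
  set D' : ℝ → ℂ := fun s => ⟨deriv c s 0, deriv c s 1⟩ with hD'def
  have e : ∀ a b : ℝ, (⟨a, b⟩ : ℂ) = a + b * Complex.I := fun a b => by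
    apply Complex.ext <;> simp
  have hd := fun s => hasDerivAt_coord (hc.hasDerivAt s)
  have hD : ∀ t, HasDerivAt D (D' t) t := fun t => by
    simp only [hDdef, hD'def, e]
    exact ((hd t 0).sub_const _).ofReal_comp.add
      (((hd t 1).sub_const _).ofReal_comp.mul_const Complex.I)
  have hD'c : Continuous D' := by
    simp only [hD'def, e]
    have h0 := (continuous_coord 0).comp hc.continuous_deriv
    have h1 := (continuous_coord 1).comp hc.continuous_deriv
    exact (Complex.continuous_ofReal.comp h0).add
      ((Complex.continuous_ofReal.comp h1).mul continuous_const)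
  have hn : ∀ t, Complex.normSq (D t) = (c t 0 - p 0) ^ 2 + (c t 1 - p 1) ^ 2 := fun t => by
    simp only [hDdef, Complex.normSq_mk]; ring
  have hD0 : ∀ t, D t ≠ 0 := fun t h => hp t (by rw [← hn, h, map_zero])
  obtain ⟨l, hl, hexp⟩ := exists_log hD hD'c hD0
  have hlc : Continuous l := continuous_iff_continuousAt.2 fun t => (hl t).continuousAt
  have hper : Complex.exp (l 1) = Complex.exp (l 0) := by
    rw [hexp, hexp]; simp only [hDdef, hc.one_eq_zero]
  obtain ⟨k, hk⟩ := Complex.exp_eq_exp_iff_exists_int.1 hper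
  have him : (l 1).im - (l 0).im = 2 * Real.pi * k := by
    rw [hk]; simp; ring
  refine ⟨k, ⟨fun s => Real.exp (l s).re, fun s => (l s).im, by fun_prop, by fun_prop,
    fun s => Real.exp_pos _, fun s => ?_, him⟩, ?_⟩
  · have h1 : (D s).re = Real.exp (l s).re * Real.cos (l s).im := by rw [← hexp, Complex.exp_re]
    have h2 : (D s).im = Real.exp (l s).re * Real.sin (l s).im := by rw [← hexp, Complex.exp_im]
    simp only [hDdef] at h1 h2
    exact ⟨by linarith, by linarith⟩
  · have hi : ∀ s, HasDerivAt (fun s => (l s).im) (((c s 0 - p 0) * deriv c s 1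
        - (c s 1 - p 1) * deriv c s 0) / ((c s 0 - p 0) ^ 2 + (c s 1 - p 1) ^ 2)) s := by
      intro s
      have h1 := Complex.imCLM.hasFDerivAt.comp_hasDerivAt s (hl s)
      refine HasDerivAt.congr_deriv (f := fun s => (l s).im) h1 ?_
      simp only [Complex.imCLM_apply, Complex.div_im, hn]
      simp only [hDdef, hD'def]
      ring
    have hci : Continuous fun s => ((c s 0 - p 0) * deriv c s 1
        - (c s 1 - p 1) * deriv c s 0) / ((c s 0 - p 0) ^ 2 + (c s 1 - p 1) ^ 2) := by
      have a0 := (continuous_coord 0).comp hc.continuous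
      have a1 := (continuous_coord 1).comp hc.continuous
      have b0 := (continuous_coord 0).comp hc.continuous_deriv
      have b1 := (continuous_coord 1).comp hc.continuous_deriv
      have a0' := a0.sub (continuous_const (y := p 0))
      have a1' := a1.sub (continuous_const (y := p 1))
      exact ((a0'.mul b1).sub (a1'.mul b0)).div₀ ((a0'.pow 2).add (a1'.pow 2)) hp
    rw [windingNumber, intervalIntegral.integral_eq_sub_of_hasDerivAt (fun s _ => hi s)
      (hci.intervalIntegrable _ _), him]
    field_simp

/-! ### The Gauss integral in planar position -/

/-- The unit vector `e₃`. -/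
noncomputable def e3 : E3 := EuclideanSpace.single 2 1

lemma norm_e3 : ‖e3‖ = 1 := by simp [e3]
lemma inner_e3 (r : E3) : inner ℝ e3 r = r 2 := by simp [e3, inner_eq]

lemma solidAngle_neg_e3_eq {c : ℝ → E3} {p : E3} (hc : ∀ s, c s 2 = 0) (hp : p 2 = 0) :
    solidAngle (-e3) c p = 2 * Real.pi * windingNumber c p := by
  rw [windingNumber, ← mul_assoc, mul_inv_cancel₀ (by positivity), one_mul, solidAngle]
  refine intervalIntegral.integral_congr fun s _ => ?_
  simp only [potential, inner_neg_left, inner_e3, PiLp.sub_apply, hc s, hp, sub_zero, neg_zero,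
    add_zero]
  rw [← sq, norm_sq_eq]
  simp only [det3_eq, e3, PiLp.sub_apply, hc s, hp, PiLp.neg_apply, PiLp.single_apply]
  congr 1
  · simp; ring
  · ring

lemma solidAngle_e3_eq {c : ℝ → E3} {p : E3} (hc : ∀ s, c s 2 = 0) (hp : p 2 = 0) :
    solidAngle e3 c p = -(2 * Real.pi * windingNumber c p) := by
  rw [← solidAngle_neg_e3_eq hc hp, solidAngle, solidAngle, ← intervalIntegral.integral_neg]
  refine intervalIntegral.integral_congr fun s _ => ?_
  simp only [potential, inner_neg_left, inner_e3, PiLp.sub_apply, hc s, hp, sub_zero, neg_zero,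
    add_zero]
  simp only [det3_eq, PiLp.neg_apply]
  ring

lemma eventually_left_right_of_pos {f : ℝ → ℝ} {f' t : ℝ} (h : HasDerivAt f f' t) (h0 : f t = 0)
    (hf' : 0 < f') : (∀ᶠ t' in 𝓝[<] t, f t' < 0) ∧ ∀ᶠ t' in 𝓝[>] t, 0 < f t' := by
  have hs := hasDerivAt_iff_tendsto_slope.1 h
  have hpos := hs.eventually (lt_mem_nhds hf')
  constructor
  · filter_upwards [hpos.filter_mono (nhdsWithin_mono t fun x (hx : x < t) => ne_of_lt hx),
      self_mem_nhdsWithin] with t' h1 h2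
    rw [slope_def_field, h0, sub_zero] at h1
    have h3 : t' - t < 0 := sub_neg.2 h2
    by_contra h4
    exact absurd h1 (not_lt.2 (div_nonpos_of_nonneg_of_nonpos (not_lt.1 h4) h3.le))
  · filter_upwards [hpos.filter_mono (nhdsWithin_mono t fun x (hx : t < x) => ne_of_gt hx),
      self_mem_nhdsWithin] with t' h1 h2
    rw [slope_def_field, h0, sub_zero] at h1
    have h3 : 0 < t' - t := sub_pos.2 h2
    by_contra h4
    exact absurd h1 (not_lt.2 (div_nonpos_of_nonpos_of_nonneg (not_lt.1 h4) h3.le))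

lemma eventually_left_right_of_neg {f : ℝ → ℝ} {f' t : ℝ} (h : HasDerivAt f f' t) (h0 : f t = 0)
    (hf' : f' < 0) : (∀ᶠ t' in 𝓝[<] t, 0 < f t') ∧ ∀ᶠ t' in 𝓝[>] t, f t' < 0 := by
  have := eventually_left_right_of_pos h.neg (by simp [h0]) (neg_pos.2 hf')
  simpa using this

section Planar
variable {η₁ η₂ : ℝ → E3}

lemma planar_isolated (h₂ : IsClosedCurve η₂) (hp : IsPlanarPosition η₁ η₂) (t : ℝ) :
    ∀ᶠ t' in 𝓝[≠] t, t' ∉ {t | η₂ t 2 = 0} := by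
  have hd := hasDerivAt_coord (h₂.hasDerivAt t) 2
  by_cases ht : η₂ t 2 = 0
  · exact hd.eventually_ne (hp.perpendicular t ht).2.2
  · exact (hd.continuousAt.eventually_ne ht).filter_mono nhdsWithin_le_nhds

theorem gaussLinkingIntegral_planar (h₁ : IsClosedCurve η₁) (h₂ : IsClosedCurve η₂)
    (hd : ∀ s t, η₁ s ≠ η₂ t) (hp : IsPlanarPosition η₁ η₂) :
    gaussLinkingIntegral η₁ η₂ =
      -∑ᶠ t ∈ planeCrossings η₂, planeCrossingSign η₂ t * windingNumber η₁ (η₂ t) := by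
  classical
  have hr : ∀ t s, η₂ t - η₁ s ≠ 0 := fun t s => sub_ne_zero.2 (hd s t).symm
  have hup : ∀ t, 0 ≤ η₂ t 2 → ∀ s, 0 < ‖η₂ t - η₁ s‖ + inner ℝ e3 (η₂ t - η₁ s) := by
    intro t ht s
    rw [inner_e3, PiLp.sub_apply, hp.planar s, sub_zero]
    have := norm_pos_iff.2 (hr t s)
    linarith
  have hdn : ∀ t, η₂ t 2 ≤ 0 → ∀ s, 0 < ‖η₂ t - η₁ s‖ + inner ℝ (-e3) (η₂ t - η₁ s) := by
    intro t ht s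
    rw [inner_neg_left, inner_e3, PiLp.sub_apply, hp.planar s, sub_zero]
    have := norm_pos_iff.2 (hr t s)
    linarith
  have hne3 : ‖-e3‖ = 1 := by rw [norm_neg, norm_e3]
  have der : ∀ t b, IsPrimitiveNear η₁ b (η₂ t) →
      HasDerivAt (fun t => b (η₂ t)) (linkingForm η₁ (η₂ t) (deriv η₂ t)) t :=
    fun t b hb => hb.self_of_nhds.comp_hasDerivAt t (h₂.hasDerivAt t)
  set up : E3 → ℝ := fun y => -((4 * Real.pi)⁻¹ * solidAngle e3 η₁ y) with hupdef
  set dn : E3 → ℝ := fun y => -((4 * Real.pi)⁻¹ * solidAngle (-e3) η₁ y) with hdndef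
  have dup : ∀ t, 0 ≤ η₂ t 2 → _ := fun t ht =>
    der t up (isPrimitiveNear_solidAngle h₁ norm_e3 (hup t ht))
  have ddn : ∀ t, η₂ t 2 ≤ 0 → _ := fun t ht =>
    der t dn (isPrimitiveNear_solidAngle h₁ hne3 (hdn t ht))
  have hz : Continuous fun t => η₂ t 2 := (continuous_coord 2).comp h₂.continuous
  rw [gaussLinkingIntegral_eq_integral_linkingForm h₁ h₂ hd]
  have hjump : ∀ t, η₂ t 2 = 0 → up (η₂ t) = dn (η₂ t) + windingNumber η₁ (η₂ t) := by
    intro t ht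
    simp only [hupdef, hdndef, solidAngle_e3_eq hp.planar ht, solidAngle_neg_e3_eq hp.planar ht]
    have := Real.pi_ne_zero
    field_simp
    ring
  refine integral_eq_neg_sum_jumps (T := {t | η₂ t 2 = 0})
    (Ω := fun t => if 0 < η₂ t 2 then up (η₂ t) else dn (η₂ t))
    (J := fun t => planeCrossingSign η₂ t * windingNumber η₁ (η₂ t))
    (continuous_linkingForm_along h₁ h₂ hd) (planar_isolated h₂ hp)
    (by simp only [mem_ofPred_eq, h₂.one_eq_zero])
    (fun t => by simp only [h₂.periodic t]) ?_ ?_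
  · intro t ht
    rcases lt_or_gt_of_ne (ht : η₂ t 2 ≠ 0) with h | h
    · refine (ddn t h.le).congr_of_eventuallyEq ?_
      filter_upwards [hz.continuousAt.eventually (gt_mem_nhds h)] with t' ht'
      exact if_neg ht'.not_gt
    · refine (dup t h.le).congr_of_eventuallyEq ?_
      filter_upwards [hz.continuousAt.eventually (lt_mem_nhds h)] with t' ht'
      exact if_pos ht'
  · intro t ht
    have cup : ∀ s, Tendsto (fun t => up (η₂ t)) (𝓝[s] t) (𝓝 (up (η₂ t))) := fun s =>
      (dup t (le_of_eq ht.symm)).continuousAt.tendsto.mono_left nhdsWithin_le_nhds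
    have cdn : ∀ s, Tendsto (fun t => dn (η₂ t)) (𝓝[s] t) (𝓝 (dn (η₂ t))) := fun s =>
      (ddn t (le_of_eq ht)).continuousAt.tendsto.mono_left nhdsWithin_le_nhds
    have hdz := hasDerivAt_coord (h₂.hasDerivAt t) 2
    rcases lt_or_gt_of_ne (hp.perpendicular t ht).2.2 with h | h
    · obtain ⟨hl, hr⟩ := eventually_left_right_of_neg hdz ht h
      refine ⟨up (η₂ t), (cup _).congr' (hl.mono fun t' ht' => (if_pos ht').symm), ?_⟩
      simp only [planeCrossingSign, Real.sign_of_neg h, hjump t ht]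
      rw [show dn (η₂ t) + windingNumber η₁ (η₂ t) + -1 * windingNumber η₁ (η₂ t)
        = dn (η₂ t) by ring]
      exact (cdn _).congr' (hr.mono fun t' ht' => (if_neg ht'.not_gt).symm)
    · obtain ⟨hl, hr⟩ := eventually_left_right_of_pos hdz ht h
      refine ⟨dn (η₂ t), (cdn _).congr' (hl.mono fun t' ht' => (if_neg ht'.not_gt).symm), ?_⟩
      simp only [planeCrossingSign, Real.sign_of_pos h]
      rw [one_mul, ← hjump t ht]
      exact (cup _).congr' (hr.mono fun t' ht' => (if_pos ht').symm)

lemma planar_windsAround (h₁ : IsClosedCurve η₁) (hd : ∀ s t, η₁ s ≠ η₂ t)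
    (hp : IsPlanarPosition η₁ η₂) {t : ℝ} (ht : t ∈ planeCrossings η₂) :
    ∃ k : ℤ, WindsAround η₁ (η₂ t) k ∧ windingNumber η₁ (η₂ t) = k := by
  refine exists_windsAround h₁ fun s h => hd s t ?_
  obtain ⟨h0, h1⟩ := (add_eq_zero_iff_of_nonneg (sq_nonneg _) (sq_nonneg _)).1 h
  rw [sq_eq_zero_iff] at h0 h1
  ext i
  fin_cases i
  · exact sub_eq_zero.1 h0
  · exact sub_eq_zero.1 h1
  · exact (hp.planar s).trans ht.2.symm

end Planar

lemma DisjointlyHomotopic.target {γ₁ γ₂ η₁ η₂ : ℝ → E3} (h : DisjointlyHomotopic γ₁ γ₂ η₁ η₂) :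
    IsClosedCurve η₁ ∧ IsClosedCurve η₂ ∧ ∀ s t, η₁ s ≠ η₂ t := by
  obtain ⟨H₁, H₂, c₁, c₂, hp, hd, a₁, a₂, rfl, rfl⟩ := h
  have h1 : (1 : ℝ) ∈ Icc (0 : ℝ) 1 := ⟨zero_le_one, le_rfl⟩
  have l : ContDiff ℝ ∞ fun s : ℝ => ((1 : ℝ), s) := contDiff_const.prodMk contDiff_id
  exact ⟨⟨c₁.comp l, (hp 1 h1).1⟩, ⟨c₂.comp l, (hp 1 h1).2⟩, hd 1 h1⟩

/-! ### Gluing functions defined up to constants -/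

/-- A class of germs of functions on three-space, closed under adding constants, in which any two
germs at the same point differ by a constant. `R x u` says that the germ of `u` at `x` belongs to
the class. -/
structure IsGermClass (R : E3 → (E3 → ℝ) → Prop) : Prop where
  congr : ∀ {x u u'}, R x u → u' =ᶠ[𝓝 x] u → R x u'
  add_const : ∀ {x u}, R x u → ∀ c : ℝ, R x (fun y => u y + c)
  diff : ∀ {x u u'}, R x u → R x u' → ∃ c : ℝ, u =ᶠ[𝓝 x] fun y => u' y + c

/-- Some function has its germs in the class `R` at all points of `C` outside `N`. -/
def HasSection (R : E3 → (E3 → ℝ) → Prop) (N C : Set E3) : Prop :=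
  ∃ u : E3 → ℝ, ∀ x ∈ C, x ∉ N → R x u

section Glue
variable {R : E3 → (E3 → ℝ) → Prop} {N : Set E3}

lemma HasSection.mono {C C' : Set E3} (h : HasSection R N C) (hC : C' ⊆ C) : HasSection R N C' :=
  h.imp fun _ hu x hx => hu x (hC hx)

lemma sub_eq_of_sections (hR : IsGermClass R) {P : Set E3} (hP : IsPreconnected P) {u u' : E3 → ℝ}
    (hu : ∀ x ∈ P, R x u) (hu' : ∀ x ∈ P, R x u') {x y : E3} (hx : x ∈ P) (hy : y ∈ P) :
    u x - u' x = u y - u' y := by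
  have hloc : IsLocallyConstant fun z : P => u z - u' z := by
    rw [IsLocallyConstant.iff_eventually_eq]
    intro z
    obtain ⟨c, hc⟩ := hR.diff (hu z z.2) (hu' z z.2)
    have h1 := continuous_subtype_val.continuousAt.eventually hc
    have h2 := hc.self_of_nhds
    filter_upwards [h1] with w hw
    simp only at hw h2
    rw [hw, h2]
    ring
  have : PreconnectedSpace P := isPreconnected_iff_preconnectedSpace.1 hP
  exact hloc.apply_eq_of_preconnectedSpace ⟨x, hx⟩ ⟨y, hy⟩

lemma HasSection.union (hR : IsGermClass R) (hN : IsClosed N) {C₁ C₂ : Set E3} (h₁ : IsOpen C₁)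
    (h₂ : IsOpen C₂) (hpre : IsPreconnected ((C₁ ∩ C₂) \ N)) (s₁ : HasSection R N C₁)
    (s₂ : HasSection R N C₂) : HasSection R N (C₁ ∪ C₂) := by
  classical
  obtain ⟨u₁, hu₁⟩ := s₁
  obtain ⟨u₂, hu₂⟩ := s₂
  obtain ⟨c, hc⟩ : ∃ c, ∀ x ∈ (C₁ ∩ C₂) \ N, u₁ x - u₂ x = c := by
    rcases ((C₁ ∩ C₂) \ N).eq_empty_or_nonempty with h | ⟨z, hz⟩
    · exact ⟨0, fun x hx => by simp [h] at hx⟩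
    · exact ⟨u₁ z - u₂ z, fun x hx => sub_eq_of_sections hR hpre (fun y hy => hu₁ y hy.1.1 hy.2)
        (fun y hy => hu₂ y hy.1.2 hy.2) hx hz⟩
  refine ⟨fun x => if x ∈ C₁ then u₁ x else u₂ x + c, fun x hx hxN => ?_⟩
  by_cases hx1 : x ∈ C₁
  · refine hR.congr (hu₁ x hx1 hxN) ?_
    filter_upwards [h₁.mem_nhds hx1] with y hy
    simp [hy]
  · have hx2 : x ∈ C₂ := hx.resolve_left hx1
    refine hR.congr (hR.add_const (hu₂ x hx2 hxN) c) ?_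
    filter_upwards [h₂.mem_nhds hx2, hN.isOpen_compl.mem_nhds hxN] with y hy hyN
    by_cases hy1 : y ∈ C₁
    · have := hc y ⟨⟨hy1, hy⟩, hyN⟩
      simp only [hy1, if_true]
      linarith
    · simp [hy1]

lemma convex_coord (i : Fin 3) {s : Set ℝ} (hs : Convex ℝ s) : Convex ℝ {x : E3 | x i ∈ s} :=
  hs.linear_preimage (EuclideanSpace.proj (𝕜 := ℝ) i : E3 →L[ℝ] ℝ).toLinearMap

lemma isOpen_coord (i : Fin 3) {s : Set ℝ} (hs : IsOpen s) : IsOpen {x : E3 | x i ∈ s} :=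
  hs.preimage (continuous_coord i)

/-- A convex set has a section if each of its thin slabs orthogonal to a coordinate axis has. -/
lemma HasSection.of_slabs (hR : IsGermClass R) (hN : IsClosed N)
    (hconv : ∀ C : Set E3, Convex ℝ C → IsOpen C → IsPreconnected (C \ N)) (i : Fin 3)
    {C : Set E3} (hC : Convex ℝ C) (hCo : IsOpen C) {α β δ : ℝ} (hδ : 0 < δ)
    (hb : ∀ x ∈ C, α < x i ∧ x i < β)
    (h : ∀ a : ℝ, HasSection R N (C ∩ {x : E3 | x i ∈ Ioo a (a + 2 * δ)})) :
    HasSection R N C := by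
  have step : ∀ n : ℕ, HasSection R N (C ∩ {x : E3 | x i ∈ Iio (α + (n + 1) * δ)}) := by
    intro n
    induction n with
    | zero =>
      refine (h (α - δ)).mono fun x hx => ⟨hx.1, ?_, ?_⟩
      · have := hb x hx.1; simp only; linarith
      · have : x i < α + ((0 : ℕ) + 1) * δ := hx.2
        push_cast at this; linarith
    | succ n ih =>
      have := HasSection.union hR hN (hCo.inter (isOpen_coord i isOpen_Iio))
        (hCo.inter (isOpen_coord i isOpen_Ioo)) ?_ ih (h (α + n * δ))
      · refine this.mono fun x hx => ?_
        have h1 : x i < α + ((n + 1 : ℕ) + 1) * δ := hx.2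
        push_cast at h1
        by_cases h2 : x i < α + (n + 1) * δ
        · exact Or.inl ⟨hx.1, h2⟩
        · refine Or.inr ⟨hx.1, ?_, ?_⟩ <;> nlinarith
      · exact hconv _ ((hC.inter (convex_coord i (convex_Iio _))).inter
          (hC.inter (convex_coord i (convex_Ioo _ _))))
          ((hCo.inter (isOpen_coord i isOpen_Iio)).inter (hCo.inter (isOpen_coord i isOpen_Ioo)))
  obtain ⟨n, hn⟩ := exists_nat_gt ((β - α) / δ)
  refine (step n).mono fun x hx => ⟨hx, ?_⟩
  have h1 := (hb x hx).2
  rw [div_lt_iff₀ hδ] at hn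
  simp only [mem_ofPred_eq, mem_Iio]
  nlinarith

lemma norm_lt_of_coord_lt {v : E3} {δ : ℝ} (h : ∀ i, |v i| < δ) : ‖v‖ < 2 * δ := by
  have hδ : 0 < δ := (abs_nonneg _).trans_lt (h 0)
  have hs : ∀ i, v i ^ 2 ≤ δ ^ 2 := fun i => by
    rw [← sq_abs]; exact pow_le_pow_left₀ (abs_nonneg _) (h i).le 2
  refine lt_of_pow_lt_pow_left₀ 2 (by positivity) ?_
  rw [norm_sq_eq]
  nlinarith [hs 0, hs 1, hs 2, sq_pos_of_pos hδ]

/-- Local sections over a neighbourhood of the closure of a bounded convex open set can be glued,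
provided that `N` does not disconnect convex open sets. -/
theorem HasSection.of_local (hR : IsGermClass R) (hN : IsClosed N)
    (hconv : ∀ C : Set E3, Convex ℝ C → IsOpen C → IsPreconnected (C \ N)) {W : Set E3}
    (hW : Convex ℝ W) (hWo : IsOpen W) (hWb : Bornology.IsBounded W)
    (hloc : ∀ x ∈ closure W, ∃ V, IsOpen V ∧ x ∈ V ∧ HasSection R N V) : HasSection R N W := by
  choose! V hVo hxV hV using hloc
  obtain ⟨δ, hδ, hleb⟩ := lebesgue_number_lemma_of_metric (s := closure W)
    (c := fun x : closure W => V x) hWb.isCompact_closure (fun x => hVo x x.2)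
    fun x hx => mem_iUnion.2 ⟨⟨x, hx⟩, hxV x hx⟩
  obtain ⟨r, hr⟩ := hWb.subset_ball 0
  have hb : ∀ i : Fin 3, ∀ x ∈ W, -r < x i ∧ x i < r := by
    intro i x hx
    have h1 : ‖x‖ < r := by simpa using hr hx
    exact abs_lt.1 ((PiLp.norm_apply_le x i).trans_lt h1)
  set I : ℝ → Set ℝ := fun a => Ioo a (a + 2 * (δ / 4)) with hI
  have cell : ∀ a₀ a₁ a₂ : ℝ, HasSection R N (((W ∩ {x : E3 | x 0 ∈ I a₀}) ∩ {x : E3 | x 1 ∈ I a₁})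
      ∩ {x : E3 | x 2 ∈ I a₂}) := by
    intro a₀ a₁ a₂
    rcases (((W ∩ {x : E3 | x 0 ∈ I a₀}) ∩ {x : E3 | x 1 ∈ I a₁})
      ∩ {x : E3 | x 2 ∈ I a₂}).eq_empty_or_nonempty with h | ⟨z, ⟨⟨hz, h0⟩, h1⟩, h2⟩
    · rw [h]; exact ⟨0, fun x hx => hx.elim⟩
    · obtain ⟨w, hw⟩ := hleb z (subset_closure hz)
      refine (hV w w.2).mono fun y hy => hw ?_
      obtain ⟨⟨⟨-, k0⟩, k1⟩, k2⟩ := hy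
      rw [mem_ball_iff_norm]
      have : ‖y - z‖ < 2 * (2 * (δ / 4)) := by
        refine norm_lt_of_coord_lt fun i => ?_
        simp only [hI, mem_ofPred_eq, mem_Ioo] at h0 h1 h2 k0 k1 k2
        fin_cases i <;> simp only [PiLp.sub_apply, abs_lt] <;> constructor <;> simp <;> linarith
      linarith
  have h4 : 0 < δ / 4 := by positivity
  have c0 : ∀ a, Convex ℝ (W ∩ {x : E3 | x 0 ∈ I a}) := fun a =>
    hW.inter (convex_coord 0 (convex_Ioo _ _))
  have o0 : ∀ a, IsOpen (W ∩ {x : E3 | x 0 ∈ I a}) := fun a =>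
    hWo.inter (isOpen_coord 0 isOpen_Ioo)
  refine HasSection.of_slabs hR hN hconv 0 hW hWo h4 (hb 0) fun a₀ => ?_
  refine HasSection.of_slabs hR hN hconv 1 (c0 a₀) (o0 a₀) h4
    (fun x hx => hb 1 x hx.1) fun a₁ => ?_
  exact HasSection.of_slabs hR hN hconv 2 ((c0 a₀).inter (convex_coord 1 (convex_Ioo _ _)))
    ((o0 a₀).inter (isOpen_coord 1 isOpen_Ioo)) h4 (fun x hx => hb 2 x hx.1.1) fun a₂ => cell a₀ a₁ a₂

/-- Sections over an increasing sequence of connected open sets can be chosen compatibly. -/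
theorem HasSection.iUnion (hR : IsGermClass R) {W : ℕ → Set E3} (hm : Monotone W)
    (ho : ∀ n, IsOpen (W n)) (hp : ∀ n, IsPreconnected (W n)) {z : E3} (hz : z ∈ W 0)
    (h : ∀ n, HasSection R ∅ (W n)) : HasSection R ∅ (⋃ n, W n) := by
  classical
  choose u hu using h
  have hu' : ∀ n, ∀ x ∈ W n, R x (u n) := fun n x hx => hu n x hx (notMem_empty x)
  have key : ∀ m n, m ≤ n → ∀ x ∈ W m, u m x - u m z = u n x - u n z := by
    intro m n hmn x hx
    have := sub_eq_of_sections hR (hp m) (hu' m) (fun y hy => hu' n y (hm hmn hy)) hx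
      (hm (Nat.zero_le m) hz)
    linarith
  refine ⟨fun x => if hx : ∃ n, x ∈ W n then u (Nat.find hx) x - u (Nat.find hx) z else 0,
    fun x hx _ => ?_⟩
  obtain ⟨n, hn⟩ := mem_iUnion.1 hx
  refine hR.congr (hR.add_const (hu' n x hn) (-u n z)) ?_
  filter_upwards [(ho n).mem_nhds hn] with y hy
  have hex : ∃ n, y ∈ W n := ⟨n, hy⟩
  simp only [hex, dif_pos]
  rw [key _ n (Nat.find_min' hex hy) y (Nat.find_spec hex)]
  ring

end Glue

/-! ### A smooth curve does not disconnect convex open sets -/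

lemma dense_compl_union_of_plane {f g : ℝ × ℝ → E3} (hf : ContDiff ℝ 1 f) (hg : ContDiff ℝ 1 g) :
    Dense (range f ∪ range g)ᶜ := by
  refine dense_compl_of_dimH_lt_finrank ?_
  rw [dimH_union]
  have h1 := hf.dimH_range_le
  have h2 := hg.dimH_range_le
  refine (max_le h1 h2).trans_lt ?_
  simp
  norm_num

theorem isPreconnected_diff_range {σ : ℝ → E3} (hσ : IsClosedCurve σ) {C : Set E3}
    (hC : Convex ℝ C) (hCo : IsOpen C) : IsPreconnected (C \ range σ) := by
  refine isPreconnected_of_forall_pair fun a ha b hb => ?_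
  -- a point `m` such that the segments from `m` to `a` and to `b` avoid `σ`
  have hf : ∀ a : E3, ContDiff ℝ 1 fun q : ℝ × ℝ => a + q.1 • (σ q.2 - a) := fun a =>
    contDiff_const.add (contDiff_fst.smul (((hσ.smooth.of_le (by simp)).comp contDiff_snd).sub
      contDiff_const))
  obtain ⟨m, hmC, hm⟩ := (dense_compl_union_of_plane (hf a) (hf b)).inter_open_nonempty C hCo
    ⟨a, ha.1⟩
  have hseg : ∀ a ∈ C \ range σ, (m ∉ range fun q : ℝ × ℝ => a + q.1 • (σ q.2 - a)) →
      segment ℝ a m ⊆ C \ range σ := by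
    intro a ha hma x hx
    refine ⟨hC.segment_subset ha.1 hmC hx, ?_⟩
    rintro ⟨s, rfl⟩
    rw [segment_eq_image'] at hx
    obtain ⟨t, -, ht⟩ := hx
    have ht' : a + t • (m - a) = σ s := ht
    rcases eq_or_ne t 0 with h0 | h0
    · exact ha.2 ⟨s, by rw [← ht', h0, zero_smul, add_zero]⟩
    · refine hma ⟨(t⁻¹, s), ?_⟩
      simp only [← ht', add_sub_cancel_left, smul_smul, inv_mul_cancel₀ h0, one_smul,
        add_sub_cancel]
  refine ⟨segment ℝ a m ∪ segment ℝ b m, union_subset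
    (hseg a ha fun h => hm (Or.inl h)) (hseg b hb fun h => hm (Or.inr h)),
    Or.inl (left_mem_segment ℝ a m), Or.inr (left_mem_segment ℝ b m), ?_⟩
  exact IsPreconnected.union m (right_mem_segment ℝ a m) (right_mem_segment ℝ b m)
    (convex_segment a m).isPreconnected (convex_segment b m).isPreconnected

/-! ### The two sides of a surface -/

/-- The surface `S` with unit normal field `n` is the regular level set `f = 0` near `x`, with `f`
increasing in the direction of `n`. -/
def IsSideChart (S : Set E3) (n : E3 → E3) (x : E3) (f : E3 → ℝ) : Prop :=
  ∃ U : Set E3, IsOpen U ∧ x ∈ U ∧ ContDiffOn ℝ ∞ f U ∧ (∀ q ∈ U, q ∈ S ↔ f q = 0) ∧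
    ∀ q ∈ U ∩ S, ∇ f q ≠ 0 ∧ n q = ‖∇ f q‖⁻¹ • ∇ f q

lemma inner_gradient (f : E3 → ℝ) (x v : E3) : inner ℝ (∇ f x) v = fderiv ℝ f x v := by
  rw [gradient, InnerProductSpace.toDual_symm_apply]

lemma exists_pos_ball {S : Set E3} {n : E3 → E3} {x : E3} {f : E3 → ℝ} (hx : x ∈ S)
    (hf : IsSideChart S n x f) :
    ∃ r > 0, (∀ q ∈ Metric.ball x r, q ∈ S ↔ f q = 0) ∧
      ∀ q ∈ Metric.ball x r, DifferentiableAt ℝ f q ∧ 0 < fderiv ℝ f q (n x) := by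
  obtain ⟨U, hU, hxU, hfU, hS, hn⟩ := hf
  have h1 : ContinuousOn (fun q => fderiv ℝ f q (n x)) U :=
    (hfU.continuousOn_fderiv_of_isOpen hU (by simp)).clm_apply continuousOn_const
  have h2 : 0 < fderiv ℝ f x (n x) := by
    obtain ⟨h3, h4⟩ := hn x ⟨hxU, hx⟩
    have h5 : ‖∇ f x‖ ≠ 0 := by positivity
    rw [← inner_gradient, h4, real_inner_smul_right, real_inner_self_eq_norm_sq]
    positivity
  have h6 : ∀ᶠ q in 𝓝 x, q ∈ U ∧ 0 < fderiv ℝ f q (n x) :=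
    (hU.eventually_mem hxU).and
      ((h1.continuousAt (hU.mem_nhds hxU)).eventually (lt_mem_nhds h2))
  obtain ⟨r, hr, h7⟩ := Metric.eventually_nhds_iff_ball.1 h6
  exact ⟨r, hr, fun q hq => hS q (h7 q hq).1, fun q hq => ⟨(hfU.contDiffAt
    (hU.mem_nhds (h7 q hq).1)).differentiableAt (by simp), (h7 q hq).2⟩⟩

/-- Two charts of a surface have the same sign near a point of the surface: moving in the
direction of the normal, both are increasing, and they vanish at the same point. -/
lemma IsSideChart.sign_eq {S : Set E3} {n : E3 → E3} {x : E3} {f f' : E3 → ℝ} (hx : x ∈ S)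
    (hf : IsSideChart S n x f) (hf' : IsSideChart S n x f') :
    ∀ᶠ y in 𝓝 x, (0 < f y ↔ 0 < f' y) := by
  obtain ⟨r₁, hr₁, hS₁, hd₁⟩ := exists_pos_ball hx hf
  obtain ⟨r₂, hr₂, hS₂, hd₂⟩ := exists_pos_ball hx hf'
  set v := n x with hv
  obtain ⟨k, hk, hkv⟩ : ∃ k > 0, k * ‖v‖ < min r₁ r₂ / 2 := by
    refine ⟨min r₁ r₂ / (4 * (‖v‖ + 1)), by positivity, ?_⟩
    rw [div_mul_eq_mul_div, div_lt_div_iff₀ (by positivity) (by norm_num)]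
    have := lt_min hr₁ hr₂
    nlinarith [norm_nonneg v]
  have hball : ∀ y ∈ Metric.ball x (min r₁ r₂ / 2), ∀ s ∈ Icc (-k) k,
      y + s • v ∈ Metric.ball x r₁ ∧ y + s • v ∈ Metric.ball x r₂ := by
    intro y hy s hs
    have h1 : ‖y + s • v - x‖ < min r₁ r₂ := by
      have h2 : ‖y - x‖ < min r₁ r₂ / 2 := by simpa [dist_eq_norm] using hy
      have h3 : ‖s • v‖ ≤ k * ‖v‖ := by
        rw [norm_smul]; exact mul_le_mul_of_nonneg_right (abs_le.2 hs) (norm_nonneg v)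
      calc ‖y + s • v - x‖ = ‖(y - x) + s • v‖ := by congr 1; abel
        _ ≤ ‖y - x‖ + ‖s • v‖ := norm_add_le _ _
        _ < min r₁ r₂ := by linarith
    exact ⟨by simpa [dist_eq_norm] using h1.trans_le (min_le_left _ _),
      by simpa [dist_eq_norm] using h1.trans_le (min_le_right _ _)⟩
  have mono : ∀ (g : E3 → ℝ) (ρ : ℝ), (∀ q ∈ Metric.ball x ρ, DifferentiableAt ℝ g q ∧
      0 < fderiv ℝ g q v) → ∀ y, (∀ s ∈ Icc (-k) k, y + s • v ∈ Metric.ball x ρ) →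
      StrictMonoOn (fun s : ℝ => g (y + s • v)) (Icc (-k) k) ∧
        ContinuousOn (fun s : ℝ => g (y + s • v)) (Icc (-k) k) := by
    intro g ρ hg y hy
    have hder : ∀ s ∈ Icc (-k) k, HasDerivAt (fun s : ℝ => g (y + s • v))
        (fderiv ℝ g (y + s • v) v) s := by
      intro s hs
      have h1 : HasDerivAt (fun s : ℝ => y + s • v) v s := by
        simpa using ((hasDerivAt_id s).smul_const v).const_add y
      exact (hg _ (hy s hs)).1.hasFDerivAt.comp_hasDerivAt s h1
    have hcont : ContinuousOn (fun s : ℝ => g (y + s • v)) (Icc (-k) k) := fun s hs =>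
      (hder s hs).continuousAt.continuousWithinAt
    refine ⟨strictMonoOn_of_deriv_pos (convex_Icc _ _) hcont fun s hs => ?_, hcont⟩
    have hs' := interior_subset hs
    rw [(hder s hs').deriv]
    exact (hg _ (hy s hs')).2
  have hk0 : (0 : ℝ) ∈ Icc (-k) k := ⟨by linarith, hk.le⟩
  have hkk : k ∈ Icc (-k) k := ⟨by linarith, le_rfl⟩
  have hkm : -k ∈ Icc (-k) k := ⟨le_rfl, by linarith⟩
  have hxb : x ∈ Metric.ball x (min r₁ r₂ / 2) := Metric.mem_ball_self (by positivity)
  have hx0 : f x = 0 := (hS₁ x (Metric.mem_ball_self hr₁)).1 hx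
  have m0 := (mono f r₁ hd₁ x fun s hs => (hball x hxb s hs).1).1
  have hpos : 0 < f (x + k • v) := by
    have := m0 hk0 hkk hk
    simpa [hx0] using this
  have hneg : f (x + (-k) • v) < 0 := by
    have := m0 hkm hk0 (neg_lt_zero.2 hk)
    simpa [hx0] using this
  have cf : ∀ s ∈ Icc (-k) k, ContinuousAt (fun y => f (y + s • v)) x := fun s hs =>
    ContinuousAt.comp (g := f) (f := fun y => y + s • v)
      (hd₁ _ (hball x hxb s hs).1).1.continuousAt (by fun_prop)
  filter_upwards [Metric.isOpen_ball.mem_nhds hxb, (cf k hkk).eventually (lt_mem_nhds hpos),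
    (cf (-k) hkm).eventually (gt_mem_nhds hneg)] with y hy hyp hyn
  obtain ⟨m1, c1⟩ := mono f r₁ hd₁ y fun s hs => (hball y hy s hs).1
  obtain ⟨m2, -⟩ := mono f' r₂ hd₂ y fun s hs => (hball y hy s hs).2
  obtain ⟨s, hs, hs0⟩ := intermediate_value_Icc (by linarith) c1
    (show (0 : ℝ) ∈ Icc _ _ from ⟨hyn.le, hyp.le⟩)
  have hs0' : f' (y + s • v) = 0 := (hS₂ _ (hball y hy s hs).2).1
    ((hS₁ _ (hball y hy s hs).1).2 hs0)
  have e1 := m1.lt_iff_lt hs hk0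
  have e2 := m2.lt_iff_lt hs hk0
  simp only [zero_smul, add_zero] at e1 e2 hs0
  rw [hs0] at e1
  rw [hs0'] at e2
  rw [e1, e2]

/-! ### Primitives of the linking form that jump across a surface -/

lemma IsPrimitiveNear.add_const {σ : ℝ → E3} {b : E3 → ℝ} {x : E3} (h : IsPrimitiveNear σ b x)
    (c : ℝ) : IsPrimitiveNear σ (fun y => b y + c) x :=
  h.mono fun _ hy => hy.add_const c

lemma IsPrimitiveNear.diff {σ : ℝ → E3} {b b' : E3 → ℝ} {x : E3} (h : IsPrimitiveNear σ b x)
    (h' : IsPrimitiveNear σ b' x) : ∃ c : ℝ, b =ᶠ[𝓝 x] fun y => b' y + c := by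
  obtain ⟨r, hr, hb⟩ := Metric.eventually_nhds_iff_ball.1 (h.and h')
  have hd : ∀ y ∈ Metric.ball x r, HasFDerivAt (fun y => b y - b' y) (0 : E3 →L[ℝ] ℝ) y :=
    fun y hy => ((hb y hy).1.sub (hb y hy).2).congr_fderiv (sub_self _)
  refine ⟨b x - b' x, ?_⟩
  filter_upwards [Metric.ball_mem_nhds x hr] with y hy
  have := Metric.isOpen_ball.is_const_of_fderiv_eq_zero (𝕜 := ℝ) (f := fun y => b y - b' y)
    (convex_ball x r).isPreconnected
    (fun z hz => (hd z hz).differentiableAt.differentiableWithinAt) (fun z hz => (hd z hz).fderiv)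
    hy (Metric.mem_ball_self hr)
  linarith

/-- The indicator function of the positive side of a surface near `x`, for a choice `F` of charts:
zero if `x` is not on the surface. -/
noncomputable def side (S : Set E3) (F : E3 → E3 → ℝ) (x y : E3) : ℝ :=
  open Classical in if x ∈ S ∧ 0 < F x y then 1 else 0

/-- Near `x`, the function `u` is a primitive of the linking form of `σ` that jumps by `1` across
the surface `S`, in the direction of its normal. -/
def IsJumpPrimitive (σ : ℝ → E3) (S : Set E3) (F : E3 → E3 → ℝ) (x : E3) (u : E3 → ℝ) : Prop :=
  ∃ b, IsPrimitiveNear σ b x ∧ u =ᶠ[𝓝 x] fun y => b y + side S F x y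

lemma isGermClass_isJumpPrimitive (σ : ℝ → E3) (S : Set E3) (F : E3 → E3 → ℝ) :
    IsGermClass (IsJumpPrimitive σ S F) where
  congr := fun ⟨b, hb, h⟩ h' => ⟨b, hb, h'.trans h⟩
  add_const := fun ⟨b, hb, h⟩ c => ⟨_, hb.add_const c, h.mono fun y hy => by dsimp only at hy ⊢; rw [hy]; ring⟩
  diff := by
    rintro x u u' ⟨b, hb, h⟩ ⟨b', hb', h'⟩
    obtain ⟨c, hc⟩ := hb.diff hb'
    refine ⟨c, ?_⟩
    filter_upwards [h, h', hc] with y h1 h2 h3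
    rw [h1, h2, h3]; ring

section Jump
variable {σ : ℝ → E3} {S : Set E3} {n : E3 → E3} {F : E3 → E3 → ℝ}

lemma isJumpPrimitive_of_notMem {x : E3} (hx : x ∉ S) {b u : E3 → ℝ} (hb : IsPrimitiveNear σ b x)
    (hu : u =ᶠ[𝓝 x] b) : IsJumpPrimitive σ S F x u :=
  ⟨b, hb, hu.mono fun y hy => by simp [side, hx, hy]⟩

open Classical in
lemma isJumpPrimitive_of_mem {x : E3} (hx : x ∈ S) (hF : IsSideChart S n x (F x)) {f : E3 → ℝ}
    (hf : IsSideChart S n x f) {b u : E3 → ℝ} (hb : IsPrimitiveNear σ b x)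
    (hu : u =ᶠ[𝓝 x] fun y => b y + if 0 < f y then 1 else 0) : IsJumpPrimitive σ S F x u := by
  refine ⟨b, hb, ?_⟩
  filter_upwards [hu, hf.sign_eq hx hF] with y h1 h2
  simp only [h1, side, hx, true_and, h2]

/-- Away from the boundary curve, primitives that jump across the surface exist locally. -/
lemma exists_section_of_notMem_range (hσ : IsClosedCurve σ) (hSc : IsClosed S)
    (hF : ∀ x ∈ S \ range σ, IsSideChart S n x (F x)) {x : E3} (hx : x ∉ range σ) :
    ∃ V, IsOpen V ∧ x ∈ V ∧ HasSection (IsJumpPrimitive σ S F) (range σ) V := by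
  classical
  obtain ⟨b, hb⟩ := exists_isPrimitiveNear hσ hx
  obtain ⟨V, hV, hVo, hxV⟩ := eventually_nhds_iff.1 hb.eventually_nhds
  by_cases hxS : x ∈ S
  · obtain ⟨U, hU, hxU, hfU, hSU, hn⟩ := hF x ⟨hxS, hx⟩
    refine ⟨V ∩ U, hVo.inter hU, ⟨hxV, hxU⟩, fun y => b y + if 0 < F x y then 1 else 0,
      fun y hy hyσ => ?_⟩
    by_cases hyS : y ∈ S
    · exact isJumpPrimitive_of_mem hyS (hF y ⟨hyS, hyσ⟩)
        ⟨U, hU, hy.2, hfU, hSU, hn⟩ (hV y hy.1) (Eventually.of_forall fun z => rfl)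
    · have h0 : F x y ≠ 0 := fun h => hyS ((hSU y hy.2).2 h)
      have hc : ContinuousAt (F x) y := hfU.continuousOn.continuousAt (hU.mem_nhds hy.2)
      refine isJumpPrimitive_of_notMem hyS
        (IsPrimitiveNear.add_const (hV y hy.1) (if 0 < F x y then 1 else 0)) ?_
      rcases lt_or_gt_of_ne h0 with h | h
      · filter_upwards [hc.eventually (gt_mem_nhds h)] with z hz
        simp [hz.not_gt, h.not_gt]
      · filter_upwards [hc.eventually (lt_mem_nhds h)] with z hz
        simp [hz, h]
  · refine ⟨V ∩ Sᶜ, hVo.inter hSc.isOpen_compl, ⟨hxV, hxS⟩, b, fun y hy _ => ?_⟩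
    exact isJumpPrimitive_of_notMem hy.2 (hV y hy.1) (EventuallyEq.refl _ _)

end Jump

/-- Pulled back along `Q`, near `ζ ∈ W`, the function `P` is a primitive of the linking form. -/
def IsPulledPrimitive (σ : ℝ → E3) (Q : E3 → E3) (W : Set E3) (ζ : E3) (P : E3 → ℝ) : Prop :=
  ζ ∈ W ∧ ∃ b, IsPrimitiveNear σ b (Q ζ) ∧ P =ᶠ[𝓝 ζ] fun ξ => b (Q ξ)

lemma isGermClass_isPulledPrimitive (σ : ℝ → E3) {Q : E3 → E3} {W : Set E3} (hW : IsOpen W)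
    (hQ : ContinuousOn Q W) : IsGermClass (IsPulledPrimitive σ Q W) where
  congr := fun ⟨hζ, b, hb, h⟩ h' => ⟨hζ, b, hb, h'.trans h⟩
  add_const := fun ⟨hζ, b, hb, h⟩ c =>
    ⟨hζ, _, hb.add_const c, h.mono fun y hy => by dsimp only at hy ⊢; rw [hy]⟩
  diff := by
    rintro x u u' ⟨hζ, b, hb, h⟩ ⟨-, b', hb', h'⟩
    obtain ⟨c, hc⟩ := hb.diff hb'
    refine ⟨c, ?_⟩
    filter_upwards [h, h', (hQ.continuousAt (hW.mem_nhds hζ)).eventually hc] with y h1 h2 h3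
    rw [h1, h2, h3]

/-- The half-infinite slab `{ζ | ζ₁ < L, |ζ₃| < r}`: the domain of logarithmic coordinates around
a curve. -/
def slab (L r : ℝ) : Set E3 := {ζ : E3 | ζ 0 ∈ Iio L} ∩ {ζ : E3 | ζ 2 ∈ Ioo (-r) r}

lemma isOpen_slab (L r : ℝ) : IsOpen (slab L r) :=
  (isOpen_coord 0 isOpen_Iio).inter (isOpen_coord 2 isOpen_Ioo)

lemma convex_slab (L r : ℝ) : Convex ℝ (slab L r) :=
  (convex_coord 0 (convex_Iio _)).inter (convex_coord 2 (convex_Ioo _ _))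

/-- A continuous map from a slab to the complement of `σ` pulls the linking form back to an exact
form, on a smaller slab. -/
theorem exists_pulledPrimitive {σ : ℝ → E3} (hσ : IsClosedCurve σ) {L r : ℝ} (hr : 0 < r)
    {Q : E3 → E3} (hQ : ContinuousOn Q (slab L r)) (hQσ : ∀ ζ ∈ slab L r, Q ζ ∉ range σ) :
    ∃ P : E3 → ℝ, ∀ ζ ∈ slab (L - 1) (r / 2), IsPulledPrimitive σ Q (slab L r) ζ P := by
  have hR := isGermClass_isPulledPrimitive σ (isOpen_slab L r) hQ
  set W : ℕ → Set E3 := fun n => ({ζ : E3 | ζ 0 ∈ Ioo (L - 3 - n) (L - 1)} ∩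
    {ζ : E3 | ζ 1 ∈ Ioo (-(n + 1 : ℝ)) (n + 1)}) ∩ {ζ : E3 | ζ 2 ∈ Ioo (-(r / 2)) (r / 2)} with hW
  have hWo : ∀ n, IsOpen (W n) := fun n => ((isOpen_coord 0 isOpen_Ioo).inter
    (isOpen_coord 1 isOpen_Ioo)).inter (isOpen_coord 2 isOpen_Ioo)
  have hWc : ∀ n, Convex ℝ (W n) := fun n => ((convex_coord 0 (convex_Ioo _ _)).inter
    (convex_coord 1 (convex_Ioo _ _))).inter (convex_coord 2 (convex_Ioo _ _))
  have hcl : ∀ n, closure (W n) ⊆ slab L r := by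
    intro n
    have h1 : closure (W n) ⊆ {ζ : E3 | ζ 0 ∈ Iic (L - 1)} ∩ {ζ : E3 | ζ 2 ∈ Icc (-(r / 2)) (r / 2)} :=
      closure_minimal (fun ζ hζ => ⟨hζ.1.1.2.le, hζ.2.1.le, hζ.2.2.le⟩)
        ((isClosed_Iic.preimage (continuous_coord 0)).inter
          (isClosed_Icc.preimage (continuous_coord 2)))
    refine h1.trans fun ζ hζ => ?_
    obtain ⟨h2, h3, h4⟩ := hζ
    simp only [mem_ofPred_eq, mem_Iic] at h2
    refine ⟨?_, ?_, ?_⟩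
    · simp only [mem_ofPred_eq, mem_Iio]; linarith
    · simp only at h3 ⊢; linarith
    · simp only at h4 ⊢; linarith
  have hb : ∀ n, Bornology.IsBounded (W n) := by
    intro n
    refine Metric.isBounded_iff_subset_ball 0 |>.2
      ⟨2 * (|L| + n + r + 3), fun ζ hζ => mem_ball_zero_iff.2 (norm_lt_of_coord_lt fun i => ?_)⟩
    obtain ⟨⟨⟨a1, a2⟩, a3, a4⟩, a5, a6⟩ := hζ
    simp only at a1 a2 a3 a4 a5 a6
    have hn : (0 : ℝ) ≤ n := n.cast_nonneg
    have hL := abs_nonneg L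
    have hL1 := le_abs_self L
    have hL2 := neg_abs_le L
    fin_cases i <;> rw [abs_lt] <;> constructor <;> simp <;> linarith
  have hloc : ∀ n, HasSection (IsPulledPrimitive σ Q (slab L r)) ∅ (W n) := by
    intro n
    refine HasSection.of_local hR isClosed_empty
      (fun C hC _ => by simpa using hC.isPreconnected) (hWc n) (hWo n) (hb n) fun ζ hζ => ?_
    have hζ' := hcl n hζ
    obtain ⟨b, hb⟩ := exists_isPrimitiveNear hσ (hQσ ζ hζ')
    have h1 := (hQ.continuousAt ((isOpen_slab L r).mem_nhds hζ')).eventually hb.eventually_nhds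
    obtain ⟨V, hV, hVo, hxV⟩ := eventually_nhds_iff.1
      (h1.and ((isOpen_slab L r).eventually_mem hζ'))
    exact ⟨V, hVo, hxV, fun ξ => b (Q ξ), fun ξ hξ _ =>
      ⟨(hV ξ hξ).2, b, (hV ξ hξ).1, EventuallyEq.refl _ _⟩⟩
  have hmono : Monotone W := by
    intro m n hmn ζ hζ
    obtain ⟨⟨⟨a1, a2⟩, a3, a4⟩, a5, a6⟩ := hζ
    have : (m : ℝ) ≤ n := by exact_mod_cast hmn
    exact ⟨⟨⟨by linarith, a2⟩, by linarith, by linarith⟩, a5, a6⟩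
  obtain ⟨P, hP⟩ := HasSection.iUnion hR hmono hWo (fun n => (hWc n).isPreconnected)
    (z := !₂[L - 2, 0, 0]) (by simp [hW]; constructor <;> linarith) hloc
  refine ⟨P, fun ζ hζ => hP ζ ?_ (notMem_empty ζ)⟩
  obtain ⟨h0, h1, h2⟩ := hζ
  simp only [mem_ofPred_eq, mem_Iio] at h0
  obtain ⟨m, hm⟩ := exists_nat_gt (max (|ζ 1|) (L - 3 - ζ 0))
  have hm1 := (le_max_left _ _).trans_lt hm
  have hm2 := (le_max_right _ _).trans_lt hm
  have := abs_lt.1 hm1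
  exact mem_iUnion.2 ⟨m, ⟨⟨by linarith, h0⟩, by linarith, by linarith⟩, h1, h2⟩

/-! ### The Gauss integral of a curve with a small meridian circle -/

lemma norm_cross_le (a b : E3) : ‖cross a b‖ ≤ ‖a‖ * ‖b‖ := by
  refine le_of_sq_le_sq ?_ (by positivity)
  rw [mul_pow, norm_sq_eq, norm_sq_eq, norm_sq_eq]
  simp only [cross, PiLp.toLp_apply, Matrix.cons_val_zero, Matrix.cons_val_one, Matrix.cons_val]
  nlinarith [sq_nonneg (a 0 * b 0 + a 1 * b 1 + a 2 * b 2)]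

lemma abs_det3_le (a b c : E3) : |det3 a b c| ≤ ‖a‖ * ‖b‖ * ‖c‖ := by
  rw [← inner_cross]
  exact (abs_real_inner_le_norm _ _).trans
    (mul_le_mul_of_nonneg_right (norm_cross_le a b) (norm_nonneg c))

lemma abs_angleForm_le {r v w : E3} {d : ℝ} (hd : 0 < d) (hr : d ≤ ‖r‖) :
    |angleForm r v w| ≤ ‖v‖ * ‖w‖ / d ^ 2 := by
  have h0 : 0 < ‖r‖ := hd.trans_le hr
  rw [angleForm, abs_div, abs_of_pos (pow_pos h0 3), div_le_div_iff₀ (by positivity) (by positivity)]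
  have h1 := abs_det3_le r v w
  have h2 : d ^ 2 ≤ ‖r‖ ^ 2 := pow_le_pow_left₀ hd.le hr 2
  calc |det3 r v w| * d ^ 2 ≤ (‖r‖ * ‖v‖ * ‖w‖) * ‖r‖ ^ 2 := by gcongr
    _ = ‖v‖ * ‖w‖ * ‖r‖ ^ 3 := by ring

lemma abs_potential_le {e r w : E3} {d : ℝ} (he : ‖e‖ = 1) (hd : 0 < d) (hr : d ≤ ‖r‖)
    (her : 0 ≤ inner ℝ e r) : |potential e r w| ≤ ‖w‖ / d := by
  have h0 : 0 < ‖r‖ := hd.trans_le hr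
  rw [potential, abs_div, abs_of_pos (by positivity : 0 < ‖r‖ * (‖r‖ + inner ℝ e r)),
    div_le_div_iff₀ (by positivity) hd]
  have h1 := abs_det3_le e r w
  rw [he, one_mul] at h1
  calc |det3 e r w| * d ≤ (‖r‖ * ‖w‖) * (‖r‖ + inner ℝ e r) := by
        gcongr
        linarith
    _ = ‖w‖ * (‖r‖ * (‖r‖ + inner ℝ e r)) := by ring

lemma gaussLinkingIntegral_symm {γ₁ γ₂ : ℝ → E3} (h₁ : IsClosedCurve γ₁) (h₂ : IsClosedCurve γ₂)
    (hd : ∀ s t, γ₁ s ≠ γ₂ t) : gaussLinkingIntegral γ₁ γ₂ = gaussLinkingIntegral γ₂ γ₁ := by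
  have hc : Continuous (Function.uncurry fun s t =>
      angleForm (γ₂ t - γ₁ s) (deriv γ₁ s) (deriv γ₂ t)) :=
    continuous_angleForm ((h₂.continuous.comp continuous_snd).sub
      (h₁.continuous.comp continuous_fst)) (h₁.continuous_deriv.comp continuous_fst)
      (h₂.continuous_deriv.comp continuous_snd) fun p => sub_ne_zero.2 (hd _ _).symm
  have h := integral_swap_of_continuous hc 0 1 0 1
  rw [gaussLinkingIntegral, gaussLinkingIntegral]
  refine congrArg _ (h.trans ?_)
  refine intervalIntegral.integral_congr fun t _ => intervalIntegral.integral_congr fun s _ => ?_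
  simp only [angleForm]
  rw [← norm_neg, neg_sub]
  congr 1
  simp only [det3_eq, PiLp.sub_apply]
  ring

lemma exists_int_of_eq {σ : ℝ → E3} (hσ : IsEmbeddedClosedCurve σ) {s t : ℝ} (h : σ s = σ t) :
    ∃ k : ℤ, s - t = k := by
  have hf : ∀ x, σ (Int.fract x) = σ x := fun x => by
    have := hσ.periodic.sub_int_mul_eq (x := x) ⌊x⌋
    rwa [mul_one] at this
  have hm : ∀ x : ℝ, Int.fract x ∈ Ico (0 : ℝ) 1 := fun x => ⟨Int.fract_nonneg x, Int.fract_lt_one x⟩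
  exact Int.fract_eq_fract.1 (hσ.injective (hm s) (hm t) (by rw [hf, hf, h]))

/-- The circle of radius `ρ` about `p` in the plane spanned by `G` and `N`. -/
noncomputable def circle (p G N : E3) (ρ t : ℝ) : E3 :=
  p + (ρ * Real.cos (2 * Real.pi * t)) • G + (ρ * Real.sin (2 * Real.pi * t)) • N

lemma hasDerivAt_circle (p G N : E3) (ρ t : ℝ) :
    HasDerivAt (circle p G N ρ) ((ρ * (-Real.sin (2 * Real.pi * t) * (2 * Real.pi))) • G
      + (ρ * (Real.cos (2 * Real.pi * t) * (2 * Real.pi))) • N) t := by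
  have h : HasDerivAt (fun t : ℝ => 2 * Real.pi * t) (2 * Real.pi) t := by
    simpa using (hasDerivAt_id t).const_mul (2 * Real.pi)
  exact (((h.cos.const_mul ρ).smul_const G).const_add p).add ((h.sin.const_mul ρ).smul_const N)

lemma isClosedCurve_circle (p G N : E3) (ρ : ℝ) : IsClosedCurve (circle p G N ρ) where
  smooth := by
    have h : ContDiff ℝ ∞ fun t : ℝ => 2 * Real.pi * t := contDiff_const.mul contDiff_id
    exact (contDiff_const.add ((contDiff_const.mul h.cos).smul contDiff_const)).add
      ((contDiff_const.mul h.sin).smul contDiff_const)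
  periodic := fun t => by
    simp only [circle, mul_add, mul_one, Real.cos_add_two_pi, Real.sin_add_two_pi]

/-- A positively oriented orthonormal frame. -/
structure IsFrame (G N T : E3) : Prop where
  GG : inner ℝ G G = 1
  NN : inner ℝ N N = 1
  TT : inner ℝ T T = 1
  GN : inner ℝ G N = 0
  GT : inner ℝ G T = 0
  NT : inner ℝ N T = 0
  det : det3 G N T = 1

section Frame
variable {G N T : E3} (hF : IsFrame G N T)
include hF

lemma IsFrame.norm_comb (a b : ℝ) : ‖a • G + b • N‖ ^ 2 = a ^ 2 + b ^ 2 := by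
  rw [← real_inner_self_eq_norm_sq]
  simp only [inner_add_left, inner_add_right, real_inner_smul_left, real_inner_smul_right, hF.GG,
    hF.NN, hF.GN, real_inner_comm G N]
  ring

lemma IsFrame.norm_circle_sub {ρ : ℝ} (hρ : 0 < ρ) (p : E3) (t : ℝ) :
    ‖circle p G N ρ t - p‖ = ρ := by
  have h : circle p G N ρ t - p = (ρ * Real.cos (2 * Real.pi * t)) • G
      + (ρ * Real.sin (2 * Real.pi * t)) • N := by simp only [circle]; abel
  rw [h, ← sq_eq_sq₀ (norm_nonneg _) hρ.le, hF.norm_comb]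
  nlinarith [Real.sin_sq_add_cos_sq (2 * Real.pi * t)]

lemma IsFrame.norm_deriv_circle {ρ : ℝ} (hρ : 0 < ρ) (p : E3) (t : ℝ) :
    ‖deriv (circle p G N ρ) t‖ = 2 * Real.pi * ρ := by
  rw [(hasDerivAt_circle p G N ρ t).deriv, ← sq_eq_sq₀ (norm_nonneg _) (by positivity),
    hF.norm_comb]
  linear_combination (4 * Real.pi ^ 2 * ρ ^ 2) * Real.sin_sq_add_cos_sq (2 * Real.pi * t)

lemma IsFrame.inner_circle (p : E3) (ρ t : ℝ) : inner ℝ T (circle p G N ρ t - p) = 0 := by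
  have h : circle p G N ρ t - p = (ρ * Real.cos (2 * Real.pi * t)) • G
      + (ρ * Real.sin (2 * Real.pi * t)) • N := by simp only [circle]; abel
  rw [h, inner_add_right, real_inner_smul_right, real_inner_smul_right, real_inner_comm G T,
    real_inner_comm N T, hF.GT, hF.NT]
  ring

lemma IsFrame.norm_T : ‖T‖ = 1 := by
  have := real_inner_self_eq_norm_sq T
  rw [hF.TT] at this
  nlinarith [norm_nonneg T]

/-- A circle is seen from its centre under half of the full solid angle. -/
lemma IsFrame.solidAngle_center {ρ : ℝ} (hρ : 0 < ρ) (p : E3) :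
    solidAngle T (circle p G N ρ) p = -(2 * Real.pi) ∧
      solidAngle (-T) (circle p G N ρ) p = 2 * Real.pi := by
  have h1 : ∀ t, potential T (p - circle p G N ρ t) (deriv (circle p G N ρ) t)
      = -(2 * Real.pi) := by
    intro t
    have hn : ‖p - circle p G N ρ t‖ = ρ := by rw [← norm_neg, neg_sub, hF.norm_circle_sub hρ]
    have hi : inner ℝ T (p - circle p G N ρ t) = 0 := by
      rw [← neg_sub, inner_neg_right, hF.inner_circle, neg_zero]
    rw [potential, hn, hi, add_zero, (hasDerivAt_circle p G N ρ t).deriv]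
    have hdet : det3 T (p - circle p G N ρ t) ((ρ * (-Real.sin (2 * Real.pi * t) * (2 * Real.pi))) • G
        + (ρ * (Real.cos (2 * Real.pi * t) * (2 * Real.pi))) • N)
        = -(2 * Real.pi * ρ ^ 2) * (Real.sin (2 * Real.pi * t) ^ 2 + Real.cos (2 * Real.pi * t) ^ 2)
          * det3 G N T := by
      simp only [circle, det3_eq, PiLp.sub_apply, PiLp.add_apply, PiLp.smul_apply, smul_eq_mul]
      ring
    rw [hdet, hF.det, Real.sin_sq_add_cos_sq]
    field_simp
  have h2 : ∀ t, potential (-T) (p - circle p G N ρ t) (deriv (circle p G N ρ) t)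
      = 2 * Real.pi := by
    intro t
    have hi : inner ℝ T (p - circle p G N ρ t) = 0 := by
      rw [← neg_sub, inner_neg_right, hF.inner_circle, neg_zero]
    have := h1 t
    simp only [potential, inner_neg_left, hi, neg_zero, add_zero] at this ⊢
    rw [← neg_neg (2 * Real.pi), ← this, ← neg_div]
    congr 1
    simp only [det3_eq, PiLp.neg_apply]
    ring
  constructor
  · rw [solidAngle, intervalIntegral.integral_congr fun t _ => h1 t]; simp
  · rw [solidAngle, intervalIntegral.integral_congr fun t _ => h2 t]; simp

end Frame

/-- The Gauss integral of a curve with a small meridian circle is close to `-1`: only the short arc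
through the disk bounded by the circle contributes. -/
theorem gaussLinkingIntegral_circle {σ : ℝ → E3} (hσ : IsEmbeddedClosedCurve σ) {s₀ l : ℝ}
    {G N T : E3} (hF : IsFrame G N T) (hl : 0 < l) (hv : deriv σ s₀ = l • T) :
    ∃ C : ℝ, ∀ᶠ ρ in 𝓝[>] (0 : ℝ), (∀ s t, σ s ≠ circle (σ s₀) G N ρ t) ∧
      |gaussLinkingIntegral σ (circle (σ s₀) G N ρ) + 1| ≤ C * ρ := by
  have hσc : IsClosedCurve σ := hσ.toIsClosedCurve
  set p := σ s₀ with hp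
  -- the arc through the disk
  have hder : HasDerivAt (fun s => inner ℝ T (σ s - p)) l s₀ := by
    have h1 := (innerSL ℝ T).hasFDerivAt.comp_hasDerivAt s₀ ((hσc.hasDerivAt s₀).sub_const p)
    refine HasDerivAt.congr_deriv (f := fun s => inner ℝ T (σ s - p)) h1 ?_
    rw [hv, innerSL_apply_apply, real_inner_smul_right, hF.TT, mul_one]
  obtain ⟨hleft, hright⟩ := eventually_left_right_of_pos hder (by simp [hp]) hl
  obtain ⟨a, ha, hleft⟩ := mem_nhdsLT_iff_exists_Ioo_subset.1 hleft
  obtain ⟨b, hb, hright⟩ := mem_nhdsGT_iff_exists_Ioo_subset.1 hright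
  simp only [mem_Iio] at ha
  simp only [mem_Ioi] at hb
  obtain ⟨δ, hδ, hδ1⟩ := exists_between (show 0 < min (min (s₀ - a) (b - s₀)) (1 / 2) from
    lt_min (lt_min (by linarith) (by linarith)) (by norm_num))
  obtain ⟨⟨hδa, hδb⟩, hδ2⟩ : (δ < s₀ - a ∧ δ < b - s₀) ∧ δ < 1 / 2 := by
    simpa [lt_min_iff] using hδ1
  have hneg : ∀ s, s₀ - δ ≤ s → s < s₀ → inner ℝ T (σ s - p) < 0 := fun s h1 h2 =>
    hleft ⟨by linarith, h2⟩
  have hpos : ∀ s, s₀ < s → s ≤ s₀ + δ → 0 < inner ℝ T (σ s - p) := fun s h1 h2 =>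
    hright ⟨h1, by linarith⟩
  -- the remaining arc
  have hfar : ∀ s ∈ Icc (s₀ + δ) (s₀ + 1 - δ), σ s ≠ p := by
    intro s hs h
    obtain ⟨k, hk⟩ := exists_int_of_eq hσ h
    have h1 : (0 : ℝ) < k := by rw [← hk]; linarith [hs.1]
    have h2 : (k : ℝ) < 1 := by rw [← hk]; linarith [hs.2]
    have h3 : (0 : ℤ) < k := by exact_mod_cast h1
    have h4 : k < (1 : ℤ) := by exact_mod_cast h2
    omega
  obtain ⟨d, hd, hdK⟩ : ∃ d > 0, ∀ s ∈ Icc (s₀ + δ) (s₀ + 1 - δ), d ≤ ‖σ s - p‖ := by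
    obtain ⟨s, hs, hmin⟩ := (isCompact_Icc (a := s₀ + δ) (b := s₀ + 1 - δ)).exists_isMinOn
      ⟨s₀ + δ, left_mem_Icc.2 (by linarith)⟩ ((hσc.continuous.sub continuous_const).norm.continuousOn
        (f := fun s => ‖σ s - p‖))
    exact ⟨_, norm_pos_iff.2 (sub_ne_zero.2 (hfar s hs)), fun t ht => hmin ht⟩
  obtain ⟨M, hM⟩ := (isCompact_Icc (a := s₀ + δ) (b := s₀ + 1 - δ)).exists_bound_of_continuousOn
    hσc.continuous_deriv.continuousOn
  have hper : σ (s₀ - δ) = σ (s₀ + 1 - δ) := by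
    rw [← hσ.periodic (s₀ - δ)]; congr 1; ring
  have hM0 : 0 ≤ M := (norm_nonneg _).trans (hM (s₀ + δ) (left_mem_Icc.2 (by linarith)))
  refine ⟨(4 * Real.pi)⁻¹ * (2 * Real.pi / (d / 2)) + (4 * Real.pi)⁻¹ * (2 * Real.pi / (d / 2))
    + (4 * Real.pi)⁻¹ * (2 * Real.pi * M / (d / 2) ^ 2), ?_⟩
  have hρd : ∀ᶠ ρ in 𝓝[>] (0 : ℝ), ρ < d / 2 := nhdsWithin_le_nhds (gt_mem_nhds (by positivity))
  filter_upwards [self_mem_nhdsWithin, hρd] with ρ hρ hρd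
  simp only [mem_Ioi] at hρ
  set m := circle p G N ρ with hm
  have hmc : IsClosedCurve m := isClosedCurve_circle p G N ρ
  have hmp : ∀ t, ‖m t - p‖ = ρ := hF.norm_circle_sub hρ p
  have hsep : ∀ s ∈ Icc (s₀ + δ) (s₀ + 1 - δ), ∀ t, d / 2 ≤ ‖σ s - m t‖ := by
    intro s hs t
    have h1 := hdK s hs
    have h2 : ‖σ s - p‖ ≤ ‖σ s - m t‖ + ‖m t - p‖ := norm_sub_le_norm_sub_add_norm_sub _ _ _
    rw [hmp] at h2
    linarith
  have hinn : ∀ s t, inner ℝ T (σ s - m t) = inner ℝ T (σ s - p) := by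
    intro s t
    have : σ s - m t = (σ s - p) - (m t - p) := by abel
    rw [this, inner_sub_right, hF.inner_circle, sub_zero]
  have hdisj : ∀ s t, σ s ≠ m t := by
    -- reduce to one period starting at `s₀ - δ`
    have key : ∀ s ∈ Icc (s₀ - δ) (s₀ + 1 - δ), ∀ t, σ s ≠ m t := by
      intro s hs t h
      have h0 : inner ℝ T (σ s - p) = 0 := by rw [← hinn s t, h, sub_self, inner_zero_right]
      rcases lt_trichotomy s s₀ with h1 | h1 | h1
      · exact (hneg s hs.1 h1).ne h0
      · have := hmp t
        rw [← h, h1, ← hp, sub_self, norm_zero] at this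
        exact hρ.ne this
      · rcases le_total s (s₀ + δ) with h2 | h2
        · exact (hpos s h1 h2).ne' h0
        · have := hsep s ⟨h2, hs.2⟩ t
          rw [h, sub_self, norm_zero] at this
          linarith
    intro s t
    obtain ⟨s', hs', hss'⟩ := hσ.periodic.exists_mem_Ico one_pos s (s₀ - δ)
    rw [hss']
    exact key s' ⟨hs'.1, by linarith [hs'.2]⟩ t
  refine ⟨hdisj, ?_⟩
  rw [gaussLinkingIntegral_symm hσc hmc hdisj, gaussLinkingIntegral_eq_integral_linkingForm hmc hσc
    fun s t => (hdisj t s).symm]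
  set w : ℝ → ℝ := fun s => linkingForm m (σ s) (deriv σ s) with hw
  have hwc : Continuous w := continuous_linkingForm_along hmc hσc fun s t => (hdisj t s).symm
  have hwp : Function.Periodic w 1 := fun s => by
    simp only [hw, hσ.periodic s, hσc.deriv_periodic s]
  have hint : ∀ a b, IntervalIntegrable w volume a b := fun a b => hwc.intervalIntegrable a b
  have hsplit : ∫ s in (0 : ℝ)..1, w s = (∫ s in (s₀ - δ)..s₀, w s) + (∫ s in s₀..(s₀ + δ), w s)
      + ∫ s in (s₀ + δ)..(s₀ + 1 - δ), w s := by
    rw [intervalIntegral.integral_add_adjacent_intervals (hint _ _) (hint _ _),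
      intervalIntegral.integral_add_adjacent_intervals (hint _ _) (hint _ _)]
    have := hwp.intervalIntegral_add_eq 0 (s₀ - δ)
    rw [zero_add] at this
    rw [this]
    congr 1; ring
  have hnT : ‖-T‖ = 1 := by rw [norm_neg, hF.norm_T]
  have hposn : ∀ s t, 0 < ‖σ s - m t‖ := fun s t => norm_pos_iff.2 (sub_ne_zero.2 (hdisj s t))
  have hup : ∀ s ∈ Icc s₀ (s₀ + δ), ∀ t, 0 < ‖σ s - m t‖ + inner ℝ T (σ s - m t) := by
    intro s hs t
    rw [hinn]
    rcases eq_or_lt_of_le hs.1 with h | h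
    · rw [← h, ← hp, sub_self, inner_zero_right, add_zero, hp]; exact hposn _ _
    · linarith [hpos s h hs.2, hposn s t]
  have hdn : ∀ s ∈ Icc (s₀ - δ) s₀, ∀ t, 0 < ‖σ s - m t‖ + inner ℝ (-T) (σ s - m t) := by
    intro s hs t
    rw [inner_neg_left, hinn]
    rcases eq_or_lt_of_le hs.2 with h | h
    · rw [h, ← hp, sub_self, inner_zero_right, neg_zero, add_zero, hp]; exact hposn _ _
    · linarith [hneg s hs.1 h, hposn s t]
  have I1 : ∫ s in s₀..(s₀ + δ), w s = -((4 * Real.pi)⁻¹ * solidAngle T m (σ (s₀ + δ)))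
      - -((4 * Real.pi)⁻¹ * solidAngle T m (σ s₀)) := by
    refine intervalIntegral.integral_eq_sub_of_hasDerivAt (f := fun s =>
      -((4 * Real.pi)⁻¹ * solidAngle T m (σ s))) (fun s hs => ?_) (hint _ _)
    rw [uIcc_of_le (by linarith)] at hs
    exact (isPrimitiveNear_solidAngle hmc hF.norm_T (hup s hs)).self_of_nhds.comp_hasDerivAt s
      (hσc.hasDerivAt s)
  have I2 : ∫ s in (s₀ - δ)..s₀, w s = -((4 * Real.pi)⁻¹ * solidAngle (-T) m (σ s₀))
      - -((4 * Real.pi)⁻¹ * solidAngle (-T) m (σ (s₀ - δ))) := by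
    refine intervalIntegral.integral_eq_sub_of_hasDerivAt (f := fun s =>
      -((4 * Real.pi)⁻¹ * solidAngle (-T) m (σ s))) (fun s hs => ?_) (hint _ _)
    rw [uIcc_of_le (by linarith)] at hs
    exact (isPrimitiveNear_solidAngle hmc hnT (hdn s hs)).self_of_nhds.comp_hasDerivAt s
      (hσc.hasDerivAt s)
  obtain ⟨hc1, hc2⟩ := hF.solidAngle_center hρ p
  have hm' : ∀ t, ‖deriv m t‖ = 2 * Real.pi * ρ := hF.norm_deriv_circle hρ p
  have bnd : ∀ e x, ‖e‖ = 1 → (∀ t, d / 2 ≤ ‖x - m t‖) → (∀ t, 0 ≤ inner ℝ e (x - m t)) →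
      |solidAngle e m x| ≤ 2 * Real.pi / (d / 2) * ρ := by
    intro e x he h1 h2
    have := intervalIntegral.norm_integral_le_of_norm_le_const (a := 0) (b := 1)
      (f := fun t => potential e (x - m t) (deriv m t)) (C := 2 * Real.pi * ρ / (d / 2))
      fun t _ => by
        have := abs_potential_le (w := deriv m t) he (half_pos hd) (h1 t) (h2 t)
        rwa [hm'] at this
    rw [sub_zero, abs_one, mul_one, Real.norm_eq_abs] at this
    rw [solidAngle]
    refine this.trans (le_of_eq (by ring))
  have B1 := bnd T (σ (s₀ + δ)) hF.norm_T (hsep _ (left_mem_Icc.2 (by linarith)))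
    fun t => by rw [hinn]; exact (hpos _ (by linarith) le_rfl).le
  have B2 := bnd (-T) (σ (s₀ - δ)) hnT
    (by rw [hper]; exact hsep _ (right_mem_Icc.2 (by linarith)))
    fun t => by
      rw [inner_neg_left, hinn]
      linarith [hneg (s₀ - δ) le_rfl (by linarith)]
  have B3 : |∫ s in (s₀ + δ)..(s₀ + 1 - δ), w s|
      ≤ (4 * Real.pi)⁻¹ * (2 * Real.pi * M / (d / 2) ^ 2) * ρ := by
    have hb : ∀ s ∈ Icc (s₀ + δ) (s₀ + 1 - δ),
        |w s| ≤ (4 * Real.pi)⁻¹ * (2 * Real.pi * M / (d / 2) ^ 2) * ρ := by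
      intro s hs
      simp only [hw, linkingForm, smul_apply, innerSL_apply_apply, smul_eq_mul]
      rw [inner_biotSavart hmc (fun t => hdisj s t), abs_mul, abs_of_pos (by positivity), mul_assoc]
      refine mul_le_mul_of_nonneg_left ?_ (by positivity)
      have := intervalIntegral.norm_integral_le_of_norm_le_const (a := 0) (b := 1)
        (f := fun t => angleForm (σ s - m t) (deriv m t) (deriv σ s))
        (C := 2 * Real.pi * ρ * M / (d / 2) ^ 2) fun t _ => by
          refine (abs_angleForm_le (half_pos hd) (hsep s hs t)).trans ?_
          rw [hm']
          have := hM s hs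
          gcongr
      rw [sub_zero, abs_one, mul_one, Real.norm_eq_abs] at this
      exact this.trans (le_of_eq (by ring))
    have := intervalIntegral.norm_integral_le_of_norm_le_const (a := s₀ + δ) (b := s₀ + 1 - δ)
      (f := w) (C := (4 * Real.pi)⁻¹ * (2 * Real.pi * M / (d / 2) ^ 2) * ρ) fun s hs => by
        rw [uIoc_of_le (by linarith)] at hs
        exact hb s ⟨hs.1.le, hs.2⟩
    rw [Real.norm_eq_abs] at this
    refine this.trans ?_
    rw [abs_of_nonneg (by linarith)]
    refine mul_le_of_le_one_right (by positivity) (by linarith)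
  rw [hsplit, I1, I2, ← hp, hc1, hc2]
  have hpi : (4 * Real.pi)⁻¹ * (2 * Real.pi) = 1 / 2 := by field_simp; norm_num
  have e : -((4 * Real.pi)⁻¹ * (2 * Real.pi)) - -((4 * Real.pi)⁻¹ * solidAngle (-T) m (σ (s₀ - δ)))
      + (-((4 * Real.pi)⁻¹ * solidAngle T m (σ (s₀ + δ))) - -((4 * Real.pi)⁻¹ * -(2 * Real.pi)))
      + (∫ s in (s₀ + δ)..(s₀ + 1 - δ), w s) + 1
      = (4 * Real.pi)⁻¹ * solidAngle (-T) m (σ (s₀ - δ))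
        - (4 * Real.pi)⁻¹ * solidAngle T m (σ (s₀ + δ))
        + ∫ s in (s₀ + δ)..(s₀ + 1 - δ), w s := by
    linear_combination (-2) * hpi
  rw [e]
  have hq : 0 < (4 * Real.pi)⁻¹ := by positivity
  calc _ ≤ |(4 * Real.pi)⁻¹ * solidAngle (-T) m (σ (s₀ - δ))|
        + |(4 * Real.pi)⁻¹ * solidAngle T m (σ (s₀ + δ))|
        + |∫ s in (s₀ + δ)..(s₀ + 1 - δ), w s| :=
        (abs_add_le _ _).trans (add_le_add (abs_sub _ _) le_rfl)
    _ ≤ _ := by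
        rw [abs_mul, abs_mul, abs_of_pos hq]
        have b1 := mul_le_mul_of_nonneg_left B1 hq.le
        have b2 := mul_le_mul_of_nonneg_left B2 hq.le
        linarith

/-! ### Charts of a Seifert surface at its boundary -/

lemma isFrame_of_det_pos {G N T : E3} (GG : inner ℝ G G = 1) (NN : inner ℝ N N = 1)
    (TT : inner ℝ T T = 1) (GN : inner ℝ G N = 0) (GT : inner ℝ G T = 0) (NT : inner ℝ N T = 0)
    (hdet : 0 < det3 G N T) : IsFrame G N T := by
  refine ⟨GG, NN, TT, GN, GT, NT, ?_⟩
  have h : det3 G N T ^ 2 = inner ℝ G G * inner ℝ N N * inner ℝ T T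
      + 2 * inner ℝ G N * inner ℝ N T * inner ℝ G T - inner ℝ G G * inner ℝ N T ^ 2
      - inner ℝ N N * inner ℝ G T ^ 2 - inner ℝ T T * inner ℝ G N ^ 2 := by
    simp only [inner_eq, det3_eq]; ring
  rw [GG, NN, TT, GN, GT, NT] at h
  nlinarith

/-- A pair of functions that straightens the surface `S` near a point `p` of its boundary `σ`:
near `p` the surface is `f = 0 ≤ g`, its boundary is `f = g = 0`, the gradients of `g` and `f` at
`p` form an orthonormal frame of the normal plane of `σ`, and `0 < f` is the side of the normal. -/
structure IsEdgeChart (S : Set E3) (n : E3 → E3) (σ : ℝ → E3) (p : E3) (U : Set E3)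
    (f g : E3 → ℝ) (G N : E3) : Prop where
  isOpen : IsOpen U
  mem : p ∈ U
  smooth_f : ContDiffOn ℝ ∞ f U
  smooth_g : ContDiffOn ℝ ∞ g U
  mem_surface : ∀ q ∈ U, q ∈ S ↔ f q = 0 ∧ 0 ≤ g q
  mem_curve : ∀ q ∈ U, q ∈ range σ ↔ f q = 0 ∧ g q = 0
  fderiv_f : HasFDerivAt f (innerSL ℝ N) p
  fderiv_g : HasFDerivAt g (innerSL ℝ G) p
  side : ∀ q ∈ U ∩ S, q ∉ range σ → ∃ f₀, IsSideChart S n q f₀ ∧ ∀ z, 0 < f₀ z ↔ 0 < f z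

lemma hasFDerivAt_gradient {f : E3 → ℝ} {p : E3} (h : DifferentiableAt ℝ f p) :
    HasFDerivAt f (innerSL ℝ (∇ f p)) p := by
  refine h.hasFDerivAt.congr_fderiv ?_
  ext v
  rw [innerSL_apply_apply, inner_gradient]

lemma inner_eq_zero_of_vanish {σ : ℝ → E3} (hσ : IsClosedCurve σ) {s₀ : ℝ} {f : E3 → ℝ} {A : E3}
    (hf : HasFDerivAt f (innerSL ℝ A) (σ s₀)) (h0 : ∀ᶠ s in 𝓝 s₀, f (σ s) = 0) :
    inner ℝ A (deriv σ s₀) = 0 := by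
  have h1 := hf.comp_hasDerivAt s₀ (hσ.hasDerivAt s₀)
  have h2 : HasDerivAt (f ∘ σ) 0 s₀ :=
    (hasDerivAt_const s₀ (0 : ℝ)).congr_of_eventuallyEq h0
  have := h1.unique h2
  rwa [innerSL_apply_apply] at this

theorem exists_edgeChart {S : Set E3} {n : E3 → E3} {σ : ℝ → E3} (hS : IsSeifertSurface S n σ)
    (s₀ : ℝ) : ∃ (U : Set E3) (f g : E3 → ℝ) (G N T : E3) (l : ℝ),
      IsEdgeChart S n σ (σ s₀) U f g G N ∧ IsFrame G N T ∧ 0 < l ∧ deriv σ s₀ = l • T := by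
  have hσ : IsClosedCurve σ := hS.embedded.toIsClosedCurve
  obtain ⟨U, f, g, hU, hpU, hf, hg, hUS, hUσ, hn, hpos⟩ := hS.boundary_chart (σ s₀) ⟨s₀, rfl⟩
  set p := σ s₀ with hp
  have hfg : f p = 0 ∧ g p = 0 := (hUσ p hpU).1 ⟨s₀, rfl⟩
  have hpS : p ∈ S := (hUS p hpU).2 ⟨hfg.1, hfg.2.ge⟩
  obtain ⟨hA0, hnp⟩ := hn p ⟨hpU, hpS⟩
  have hdet := hpos s₀ hpU
  rw [← hp] at hdet
  set A := ∇ f p with hA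
  set B := ∇ g p with hB
  set v := deriv σ s₀ with hv
  have fA : HasFDerivAt f (innerSL ℝ A) p :=
    hasFDerivAt_gradient ((hf.contDiffAt (hU.mem_nhds hpU)).differentiableAt (by simp))
  have gB : HasFDerivAt g (innerSL ℝ B) p :=
    hasFDerivAt_gradient ((hg.contDiffAt (hU.mem_nhds hpU)).differentiableAt (by simp))
  have hev : ∀ᶠ s in 𝓝 s₀, σ s ∈ U := hσ.continuous.continuousAt.eventually (hU.mem_nhds hpU)
  have hAv : inner ℝ A v = 0 :=
    inner_eq_zero_of_vanish hσ fA (hev.mono fun s hs => ((hUσ _ hs).1 ⟨s, rfl⟩).1)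
  have hBv : inner ℝ B v = 0 :=
    inner_eq_zero_of_vanish hσ gB (hev.mono fun s hs => ((hUσ _ hs).1 ⟨s, rfl⟩).2)
  have ha : 0 < ‖A‖ := norm_pos_iff.2 hA0
  have hv0 : v ≠ 0 := hS.embedded.immersed s₀
  have hl : 0 < ‖v‖ := norm_pos_iff.2 hv0
  set N := ‖A‖⁻¹ • A with hN
  set T := ‖v‖⁻¹ • v with hT
  have hvT : v = ‖v‖ • T := by rw [hT, smul_smul, mul_inv_cancel₀ hl.ne', one_smul]
  have NN : inner ℝ N N = 1 := by
    rw [hN, real_inner_smul_left, real_inner_smul_right, real_inner_self_eq_norm_sq]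
    field_simp
  have TT : inner ℝ T T = 1 := by
    rw [hT, real_inner_smul_left, real_inner_smul_right, real_inner_self_eq_norm_sq]
    field_simp
  have NT : inner ℝ N T = 0 := by
    rw [hN, hT, real_inner_smul_left, real_inner_smul_right, hAv]; ring
  set c := inner ℝ B N with hc
  set B' := B - c • N with hB'
  have hB'0 : B' ≠ 0 := by
    intro h
    have h1 : B = c • N := sub_eq_zero.1 h
    rw [hnp, h1] at hdet
    have : det3 (-(c • N)) v N = 0 := by
      simp only [det3_eq, PiLp.neg_apply, PiLp.smul_apply, smul_eq_mul]; ring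
    exact hdet.ne' this
  have hb : 0 < ‖B'‖ := norm_pos_iff.2 hB'0
  set G := ‖B'‖⁻¹ • B' with hG
  have GG : inner ℝ G G = 1 := by
    rw [hG, real_inner_smul_left, real_inner_smul_right, real_inner_self_eq_norm_sq]
    field_simp
  have GN : inner ℝ G N = 0 := by
    rw [hG, real_inner_smul_left, hB', inner_sub_left, real_inner_smul_left, NN, ← hc]; ring
  have GT : inner ℝ G T = 0 := by
    rw [hG, real_inner_smul_left, hB', inner_sub_left, real_inner_smul_left, NT, hT,
      real_inner_smul_right, hBv]; ring
  have hBG : B = ‖B'‖ • G + c • N := by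
    rw [hG, smul_smul, mul_inv_cancel₀ hb.ne', one_smul, hB']; abel
  have hdet' : 0 < det3 G N T := by
    rw [hnp, hBG, hvT] at hdet
    have : det3 (-(‖B'‖ • G + c • N)) (‖v‖ • T) N = (‖B'‖ * ‖v‖) * det3 G N T := by
      simp only [det3_eq, PiLp.neg_apply, PiLp.smul_apply, PiLp.add_apply, smul_eq_mul]; ring
    rw [this] at hdet
    exact pos_of_mul_pos_right hdet (by positivity)
  refine ⟨U, fun x => ‖A‖⁻¹ * f x, fun x => ‖B'‖⁻¹ * (g x - c * (‖A‖⁻¹ * f x)), G, N, T, ‖v‖, ?_,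
    isFrame_of_det_pos GG NN TT GN GT NT hdet', hl, hvT⟩
  have hz : ∀ q, ‖A‖⁻¹ * f q = 0 ↔ f q = 0 := fun q => by
    rw [mul_eq_zero, or_iff_right (inv_ne_zero ha.ne')]
  have fN : HasFDerivAt (fun x => ‖A‖⁻¹ * f x) (innerSL ℝ N) p := by
    refine (fA.const_mul ‖A‖⁻¹).congr_fderiv ?_
    rw [hN, map_smul]
  refine ⟨hU, hpU, contDiffOn_const.mul hf,
    contDiffOn_const.mul (hg.sub (contDiffOn_const.mul (contDiffOn_const.mul hf))), ?_, ?_, fN, ?_, ?_⟩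
  · intro q hq
    rw [hUS q hq, hz]
    refine and_congr_right fun h => ?_
    rw [h, mul_zero, mul_zero, sub_zero, mul_nonneg_iff_of_pos_left (by positivity)]
  · intro q hq
    rw [hUσ q hq, hz]
    refine and_congr_right fun h => ?_
    rw [h, mul_zero, mul_zero, sub_zero, mul_eq_zero, or_iff_right (by positivity)]
  · refine ((gB.sub (fN.const_mul c)).const_mul ‖B'‖⁻¹).congr_fderiv ?_
    ext w
    simp only [hG, hB', smul_apply, sub_apply, innerSL_apply_apply, real_inner_smul_left,
      inner_sub_left, smul_eq_mul]
  · intro q hq hqσ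
    have h1 := (hUS q hq.1).1 hq.2
    have h2 : 0 < g q := lt_of_le_of_ne h1.2 fun h => hqσ ((hUσ q hq.1).2 ⟨h1.1, h.symm⟩)
    refine ⟨f, ⟨U ∩ g ⁻¹' Ioi 0, hg.continuousOn.isOpen_inter_preimage hU isOpen_Ioi, ⟨hq.1, h2⟩,
      hf.mono inter_subset_left, fun z hz => ?_, fun z hz => hn z ⟨hz.1.1, hz.2⟩⟩, fun z => ?_⟩
    · rw [hUS z hz.1, and_iff_left (le_of_lt hz.2)]
    · rw [mul_pos_iff_of_pos_left (by positivity)]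

/-- Coordinates around a point `p` of a curve with tangent vector `T`. -/
noncomputable def edgeCoord (f g : E3 → ℝ) (T p x : E3) : E3 := !₂[g x, f x, inner ℝ T (x - p)]

lemma IsFrame.exists_equiv {G N T : E3} (hF : IsFrame G N T) :
    ∃ L : E3 ≃L[ℝ] E3, ∀ v, L v = !₂[inner ℝ G v, inner ℝ N v, inner ℝ T v] := by
  have NG : inner ℝ N G = 0 := by rw [real_inner_comm, hF.GN]
  have TG : inner ℝ T G = 0 := by rw [real_inner_comm, hF.GT]
  have TN : inner ℝ T N = 0 := by rw [real_inner_comm, hF.NT]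
  let J : E3 →ₗ[ℝ] E3 :=
    { toFun := fun ζ => ζ 0 • G + ζ 1 • N + ζ 2 • T
      map_add' := fun a b => by simp only [PiLp.add_apply, add_smul]; abel
      map_smul' := fun c a => by
        simp only [PiLp.smul_apply, smul_add, smul_smul, smul_eq_mul, RingHom.id_apply] }
  have hJ : ∀ ζ, !₂[inner ℝ G (J ζ), inner ℝ N (J ζ), inner ℝ T (J ζ)] = ζ := by
    intro ζ
    ext i
    have e : J ζ = ζ 0 • G + ζ 1 • N + ζ 2 • T := rfl
    rw [e]
    simp only [inner_add_right, real_inner_smul_right, hF.GG, hF.NN, hF.TT, hF.GN, hF.GT, hF.NT,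
      NG, TG, TN]
    fin_cases i <;> simp
  have hinj : Function.Injective J := fun a b h => by rw [← hJ a, ← hJ b, h]
  let JE := (LinearEquiv.ofInjectiveEndo J hinj).toContinuousLinearEquiv
  refine ⟨JE.symm, fun v => ?_⟩
  have h1 : JE (JE.symm v) = v := JE.apply_symm_apply v
  have h2 := hJ (JE.symm v)
  have h3 : J (JE.symm v) = v := h1
  rw [h3] at h2
  exact h2.symm

section Edge
variable {S : Set E3} {n : E3 → E3} {σ : ℝ → E3} {p : E3} {U : Set E3} {f g : E3 → ℝ}
  {G N T : E3}

lemma contDiffOn_edgeCoord (hE : IsEdgeChart S n σ p U f g G N) :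
    ContDiffOn ℝ ∞ (edgeCoord f g T p) U := by
  rw [contDiffOn_euclidean]
  intro i
  fin_cases i
  · exact hE.smooth_g
  · exact hE.smooth_f
  · exact (contDiff_const.inner ℝ (contDiff_id.sub contDiff_const)).contDiffOn

lemma exists_edgeHomeomorph (hE : IsEdgeChart S n σ p U f g G N) (hF : IsFrame G N T) :
    ∃ e : OpenPartialHomeomorph E3 E3, p ∈ e.source ∧ e.source ⊆ U ∧
      ∀ x, e x = edgeCoord f g T p x := by
  have hc : ContDiffAt ℝ ∞ (edgeCoord f g T p) p :=
    (contDiffOn_edgeCoord hE).contDiffAt (hE.isOpen.mem_nhds hE.mem)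
  obtain ⟨L, hL⟩ := hF.exists_equiv
  have hd : HasFDerivAt (edgeCoord f g T p) (L : E3 →L[ℝ] E3) p := by
    rw [← hasFDerivWithinAt_univ, hasFDerivWithinAt_euclidean]
    intro i
    rw [hasFDerivWithinAt_univ]
    fin_cases i
    · refine hE.fderiv_g.congr_fderiv ?_
      ext v
      simp [hL]
    · refine hE.fderiv_f.congr_fderiv ?_
      ext v
      simp [hL]
    · have h1 : HasFDerivAt (fun x => inner ℝ T (x - p)) (innerSL ℝ T) p :=
        (innerSL ℝ T).hasFDerivAt.comp p ((hasFDerivAt_id p).sub_const p)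
      refine h1.congr_fderiv ?_
      ext v
      simp [hL]
  refine ⟨(hc.toOpenPartialHomeomorph _ hd (by simp)).restrOpen U hE.isOpen,
    ⟨hc.mem_toOpenPartialHomeomorph_source hd (by simp), hE.mem⟩, fun x hx => hx.2, fun x => rfl⟩

end Edge

/-! ### Logarithmic coordinates around the boundary of a Seifert surface -/

/-- The covering map from logarithmic coordinates `(log r, θ, h)` to cylindrical ones. -/
noncomputable def expMap (ζ : E3) : E3 :=
  !₂[Real.exp (ζ 0) * Real.cos (ζ 1), Real.exp (ζ 0) * Real.sin (ζ 1), ζ 2]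

/-- The period `2π` in the direction of the angle. -/
noncomputable def turn : E3 := !₂[0, 2 * Real.pi, 0]

lemma expMap_add_turn (ζ : E3) : expMap (ζ + turn) = expMap ζ := by
  simp [expMap, turn, Real.cos_add_two_pi, Real.sin_add_two_pi]

lemma continuous_toE3 {X : Type*} [TopologicalSpace X] {a b c : X → ℝ} (ha : Continuous a)
    (hb : Continuous b) (hc : Continuous c) : Continuous fun x => (!₂[a x, b x, c x] : E3) := by
  refine (PiLp.continuous_toLp 2 _).comp (continuous_pi fun i => ?_)
  fin_cases i <;> assumption

lemma continuousAt_toE3 {X : Type*} [TopologicalSpace X] {a b c : X → ℝ} {x : X}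
    (ha : ContinuousAt a x) (hb : ContinuousAt b x) (hc : ContinuousAt c x) :
    ContinuousAt (fun x => (!₂[a x, b x, c x] : E3)) x := by
  refine (PiLp.continuous_toLp 2 _).continuousAt.comp (continuousAt_pi.2 fun i => ?_)
  fin_cases i <;> assumption

lemma continuous_expMap : Continuous expMap := by
  have h0 := continuous_coord 0
  have h1 := continuous_coord 1
  exact continuous_toE3 ((Real.continuous_exp.comp h0).mul (Real.continuous_cos.comp h1))
    ((Real.continuous_exp.comp h0).mul (Real.continuous_sin.comp h1)) (continuous_coord 2)

lemma norm_expMap_sq (ζ : E3) : ‖expMap ζ‖ ^ 2 = Real.exp (ζ 0) ^ 2 + ζ 2 ^ 2 := by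
  rw [norm_sq_eq]
  simp only [expMap, PiLp.toLp_apply, Matrix.cons_val_zero, Matrix.cons_val_one, Matrix.cons_val]
  linear_combination (Real.exp (ζ 0) ^ 2) * Real.sin_sq_add_cos_sq (ζ 1)

section Edge
variable {S : Set E3} {n : E3 → E3} {σ : ℝ → E3} {p : E3} {U : Set E3} {f g : E3 → ℝ}
  {G N T : E3}

/-- Logarithmic coordinates around the boundary curve: `Q` maps the slab to the complement of the
curve, and `V` is a neighbourhood of `p` all of whose points have coordinates well inside the
slab. -/
structure IsLogChart (σ : ℝ → E3) (p : E3) (f g : E3 → ℝ) (T : E3) (V : Set E3) (Q : E3 → E3)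
    (r : ℝ) : Prop where
  isOpen : IsOpen V
  mem : p ∈ V
  pos : 0 < r
  continuousOn : ContinuousOn Q (slab (Real.log r) r)
  notMem : ∀ ζ ∈ slab (Real.log r) r, Q ζ ∉ range σ
  add_turn : ∀ ζ, Q (ζ + turn) = Q ζ
  mem_slab : ∀ y ∈ V, ∀ ζ, expMap ζ = edgeCoord f g T p y → ζ ∈ slab (Real.log r - 1) (r / 2)
  apply : ∀ y ∈ V, ∀ ζ, expMap ζ = edgeCoord f g T p y → Q ζ = y

theorem exists_logChart (hE : IsEdgeChart S n σ p U f g G N) (hF : IsFrame G N T)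
    (hp : p ∈ range σ) : ∃ V Q r, V ⊆ U ∧ IsLogChart σ p f g T V Q r := by
  obtain ⟨e, hpe, heU, he⟩ := exists_edgeHomeomorph hE hF
  have hp0 : edgeCoord f g T p p = 0 := by
    have h1 := (hE.mem_curve p hE.mem).1 hp
    ext i
    fin_cases i <;> simp [edgeCoord, h1]
  have hmem : (0 : E3) ∈ e.target := by
    have := e.map_source hpe
    rwa [he, hp0] at this
  obtain ⟨R, hR, hball⟩ := Metric.isOpen_iff.1 e.open_target 0 hmem
  set r := R / 2 with hr
  have hr0 : 0 < r := by positivity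
  have htgt : ∀ ζ ∈ slab (Real.log r) r, expMap ζ ∈ e.target := by
    intro ζ hζ
    refine hball ?_
    rw [mem_ball_zero_iff]
    refine lt_of_pow_lt_pow_left₀ 2 hR.le ?_
    rw [norm_expMap_sq]
    have h1 : Real.exp (ζ 0) < r := by
      rw [← Real.lt_log_iff_exp_lt hr0]; exact hζ.1
    have h2 : |ζ 2| < r := abs_lt.2 hζ.2
    have h3 : ζ 2 ^ 2 < r ^ 2 := by rw [← sq_abs]; gcongr
    have h4 : Real.exp (ζ 0) ^ 2 < r ^ 2 := by gcongr
    have : R = 2 * r := by rw [hr]; ring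
    rw [this]
    nlinarith
  have hce : ContinuousOn (edgeCoord f g T p) e.source := by
    have := e.continuousOn
    exact this.congr fun x _ => (he x).symm
  refine ⟨e.source ∩ edgeCoord f g T p ⁻¹' Metric.ball 0 (r / 4), fun ζ => e.symm (expMap ζ), r,
    fun x hx => heU hx.1, hce.isOpen_inter_preimage e.open_source Metric.isOpen_ball,
    ⟨hpe, by rw [mem_preimage, hp0]; exact Metric.mem_ball_self (by positivity)⟩, hr0, ?_, ?_, ?_, ?_, ?_⟩
  · exact e.continuousOn_symm.comp continuous_expMap.continuousOn htgt
  · intro ζ hζ hσ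
    have h1 := e.right_inv (htgt ζ hζ)
    rw [he] at h1
    have h2 := (hE.mem_curve _ (heU (e.map_target (htgt ζ hζ)))).1 hσ
    have h3 : expMap ζ 0 = 0 := by rw [← h1]; exact h2.2
    have h4 : expMap ζ 1 = 0 := by rw [← h1]; exact h2.1
    simp only [expMap, PiLp.toLp_apply, Matrix.cons_val_zero, Matrix.cons_val_one] at h3 h4
    have h5 := Real.exp_pos (ζ 0)
    have h6 := Real.sin_sq_add_cos_sq (ζ 1)
    rw [mul_eq_zero, or_iff_right h5.ne'] at h3 h4
    rw [h3, h4] at h6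
    norm_num at h6
  · intro ζ
    simp only [expMap_add_turn]
  · intro y hy ζ hζ
    have h1 : ‖expMap ζ‖ < r / 4 := by rw [hζ]; simpa using hy.2
    have h2 : ‖expMap ζ‖ ^ 2 < (r / 4) ^ 2 := by gcongr
    rw [norm_expMap_sq] at h2
    have h3 : Real.exp (ζ 0) < r / 4 :=
      lt_of_pow_lt_pow_left₀ 2 (by positivity) (by nlinarith [sq_nonneg (ζ 2)])
    have h4 : |ζ 2| < r / 4 :=
      lt_of_pow_lt_pow_left₀ 2 (by positivity) (by rw [sq_abs]; nlinarith [sq_nonneg (Real.exp (ζ 0))])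
    have h5 := abs_lt.1 h4
    refine ⟨?_, ?_, ?_⟩
    · rw [← Real.lt_log_iff_exp_lt (by positivity), Real.log_div hr0.ne' (by norm_num)] at h3
      have : (1 : ℝ) < Real.log 4 := by
        rw [Real.lt_log_iff_exp_lt (by norm_num)]
        have := Real.exp_one_lt_d9
        linarith
      simp only [mem_ofPred_eq, mem_Iio]
      linarith
    · linarith
    · linarith
  · intro y hy ζ hζ
    rw [hζ, ← he, e.left_inv hy.1]

lemma expMap_log {f g : E3 → ℝ} {y : E3} {w : ℂ} {a : ℝ} (hw : w ≠ 0)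
    (hr : w.re * Real.cos a - w.im * Real.sin a = g y)
    (hi : w.im * Real.cos a + w.re * Real.sin a = f y) :
    expMap !₂[Real.log ‖w‖, w.arg + a, inner ℝ T (y - p)] = edgeCoord f g T p y := by
  have h0 : 0 < ‖w‖ := norm_pos_iff.2 hw
  have h1 := Complex.norm_mul_cos_arg w
  have h2 := Complex.norm_mul_sin_arg w
  ext i
  fin_cases i
  · simp [expMap, edgeCoord, Real.exp_log h0, Real.cos_add]
    linear_combination hr + Real.cos a * h1 - Real.sin a * h2
  · simp [expMap, edgeCoord, Real.exp_log h0, Real.sin_add]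
    linear_combination hi + Real.cos a * h2 + Real.sin a * h1
  · simp [expMap, edgeCoord]

section Log
variable {V : Set E3} {Q : E3 → E3} {r : ℝ} {P : E3 → ℝ}

/-- Pulling back along a local inverse of `Q` turns `P` into a primitive of the linking form. -/
lemma IsLogChart.pull (hL : IsLogChart σ p f g T V Q r)
    (hP : ∀ ζ ∈ slab (Real.log r - 1) (r / 2), IsPulledPrimitive σ Q (slab (Real.log r) r) ζ P)
    {X : Type*} [TopologicalSpace X] {c : X → E3} {Λ : X → E3} {y : X} (hc : ContinuousAt c y)
    (hy : c y ∈ V) (hΛ : ContinuousAt Λ y)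
    (he : ∀ᶠ z in 𝓝 y, expMap (Λ z) = edgeCoord f g T p (c z)) :
    ∃ b, IsPrimitiveNear σ b (c y) ∧ ∀ᶠ z in 𝓝 y, P (Λ z) = b (c z) := by
  have h1 := he.self_of_nhds
  obtain ⟨-, b, hb, hPb⟩ := hP _ (hL.mem_slab _ hy _ h1)
  rw [hL.apply _ hy _ h1] at hb
  refine ⟨b, hb, ?_⟩
  filter_upwards [hΛ.eventually hPb, he, hc.eventually (hL.isOpen.mem_nhds hy)] with z h2 h3 h4
  rw [h2, hL.apply _ h4 _ h3]

lemma IsLogChart.exists_shift (hL : IsLogChart σ p f g T V Q r)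
    (hP : ∀ ζ ∈ slab (Real.log r - 1) (r / 2), IsPulledPrimitive σ Q (slab (Real.log r) r) ζ P) :
    ∃ κ, ∀ ζ ∈ slab (Real.log r - 1) (r / 2), P (ζ + turn) = P ζ + κ := by
  have hR := isGermClass_isPulledPrimitive σ (isOpen_slab _ _) hL.continuousOn
  have hmem : ∀ L ρ, ∀ ζ ∈ slab L ρ, ζ + turn ∈ slab L ρ := by
    intro L ρ ζ hζ
    simpa [slab, turn] using hζ
  set ζ₀ : E3 := !₂[Real.log r - 2, 0, 0]
  have hζ₀ : ζ₀ ∈ slab (Real.log r - 1) (r / 2) := by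
    have := hL.pos
    simp [slab, ζ₀, this]
  refine ⟨P (ζ₀ + turn) - P ζ₀, fun ζ hζ => ?_⟩
  have := sub_eq_of_sections hR (convex_slab (Real.log r - 1) (r / 2)).isPreconnected
    (u := fun ζ => P (ζ + turn)) (u' := P) (fun ξ hξ => ?_) hP hζ hζ₀
  · linarith
  · obtain ⟨-, b, hb, hPb⟩ := hP _ (hmem _ _ _ hξ)
    refine ⟨(hP ξ hξ).1, b, by rwa [hL.add_turn] at hb, ?_⟩
    have h1 : ContinuousAt (fun ζ : E3 => ζ + turn) ξ := by fun_prop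
    filter_upwards [h1.eventually hPb] with z hz
    rw [hz, hL.add_turn]

end Log

end Edge

/-! ### The primitive near the boundary of a Seifert surface -/

section Edge
variable {S : Set E3} {n : E3 → E3} {σ : ℝ → E3} {U : Set E3} {f g : E3 → ℝ}
  {G N T : E3} {V : Set E3} {Q : E3 → E3} {r : ℝ} {P : E3 → ℝ}

lemma eventually_abs_sub_le {f : E3 → ℝ} {N p : E3} (hf : HasFDerivAt f (innerSL ℝ N) p)
    (h0 : f p = 0) : ∀ᶠ x in 𝓝 p, |f x - inner ℝ N (x - p)| ≤ (1 / 4) * ‖x - p‖ := by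
  have := hf.isLittleO.bound (c := 1 / 4) (by norm_num)
  filter_upwards [this] with x hx
  rwa [h0, sub_zero, innerSL_apply_apply] at hx

/-- The period of `P` is the Gauss integral of a small meridian circle. -/
lemma shift_eq_gauss (hσ : IsClosedCurve σ) {s₀ ρ κ : ℝ} (hE : IsEdgeChart S n σ (σ s₀) U f g G N)
    (hF : IsFrame G N T) (hVU : V ⊆ U) (hL : IsLogChart σ (σ s₀) f g T V Q r)
    (hP : ∀ ζ ∈ slab (Real.log r - 1) (r / 2), IsPulledPrimitive σ Q (slab (Real.log r) r) ζ P)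
    (hκ : ∀ ζ ∈ slab (Real.log r - 1) (r / 2), P (ζ + turn) = P ζ + κ) (hρ : 0 < ρ)
    (hd : ∀ s t, σ s ≠ circle (σ s₀) G N ρ t)
    (hV : ∀ x, ‖x - σ s₀‖ ≤ ρ → x ∈ V ∧ |f x - inner ℝ N (x - σ s₀)| ≤ (1 / 4) * ‖x - σ s₀‖ ∧
      |g x - inner ℝ G (x - σ s₀)| ≤ (1 / 4) * ‖x - σ s₀‖) :
    gaussLinkingIntegral σ (circle (σ s₀) G N ρ) = κ := by
  set p := σ s₀ with hp
  set c := circle p G N ρ with hc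
  have hcc : IsClosedCurve c := isClosedCurve_circle p G N ρ
  have hcn : ∀ t, ‖c t - p‖ = ρ := hF.norm_circle_sub hρ p
  have hcV : ∀ t, c t ∈ V := fun t => (hV _ (hcn t).le).1
  have hci : ∀ t, inner ℝ G (c t - p) = ρ * Real.cos (2 * Real.pi * t) ∧
      inner ℝ N (c t - p) = ρ * Real.sin (2 * Real.pi * t) := by
    intro t
    have h : c t - p = (ρ * Real.cos (2 * Real.pi * t)) • G
      + (ρ * Real.sin (2 * Real.pi * t)) • N := by simp only [hc, circle]; abel
    have NG : inner ℝ N G = 0 := by rw [real_inner_comm, hF.GN]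
    rw [h]
    simp only [inner_add_right, real_inner_smul_right, hF.GG, hF.NN, hF.GN, NG]
    constructor <;> ring
  -- the position of the circle, relative to the rotating point `exp (2πit)`
  set w : ℝ → ℂ := fun t =>
    ⟨g (c t) * Real.cos (2 * Real.pi * t) + f (c t) * Real.sin (2 * Real.pi * t),
      f (c t) * Real.cos (2 * Real.pi * t) - g (c t) * Real.sin (2 * Real.pi * t)⟩ with hw
  have hwre : ∀ t, 0 < (w t).re := by
    intro t
    obtain ⟨-, h1, h2⟩ := hV _ (hcn t).le
    rw [hcn, (hci t).1] at h2
    rw [hcn, (hci t).2] at h1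
    have h3 := Real.abs_cos_le_one (2 * Real.pi * t)
    have h4 := Real.abs_sin_le_one (2 * Real.pi * t)
    have h5 := Real.sin_sq_add_cos_sq (2 * Real.pi * t)
    have e : (w t).re = ρ + ((g (c t) - ρ * Real.cos (2 * Real.pi * t)) * Real.cos (2 * Real.pi * t)
        + (f (c t) - ρ * Real.sin (2 * Real.pi * t)) * Real.sin (2 * Real.pi * t)) := by
      simp only [hw]; linear_combination ρ * h5
    have h6 := mul_le_mul h2 h3 (abs_nonneg _) (by positivity)
    have h7 := mul_le_mul h1 h4 (abs_nonneg _) (by positivity)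
    rw [← abs_mul] at h6 h7
    have h8 := (abs_le.1 h6).1
    have h9 := (abs_le.1 h7).1
    rw [e]
    linarith
  have hw0 : ∀ t, w t ≠ 0 := fun t h => by
    have := hwre t
    rw [h] at this
    simp at this
  set ζ : ℝ → E3 := fun t => !₂[Real.log ‖w t‖, (w t).arg + 2 * Real.pi * t,
    inner ℝ T (c t - p)] with hζ
  have hζe : ∀ t, expMap (ζ t) = edgeCoord f g T p (c t) := by
    intro t
    have h5 := Real.sin_sq_add_cos_sq (2 * Real.pi * t)
    refine expMap_log (hw0 t) ?_ ?_
    · simp only [hw]; linear_combination g (c t) * h5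
    · simp only [hw]; linear_combination f (c t) * h5
  have hwc : Continuous w := by
    have hco : Continuous c := hcc.continuous
    have hf : Continuous fun t => f (c t) := continuous_iff_continuousAt.2 fun t =>
      (hE.smooth_f.continuousOn.continuousAt (hE.isOpen.mem_nhds (hVU (hcV t)))).comp
        hco.continuousAt
    have hg : Continuous fun t => g (c t) := continuous_iff_continuousAt.2 fun t =>
      (hE.smooth_g.continuousOn.continuousAt (hE.isOpen.mem_nhds (hVU (hcV t)))).comp
        hco.continuousAt
    have h1 : Continuous fun t : ℝ => Real.cos (2 * Real.pi * t) := by fun_prop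
    have h2 : Continuous fun t : ℝ => Real.sin (2 * Real.pi * t) := by fun_prop
    have h3 := Complex.equivRealProdCLM.symm.continuous.comp
      (((hg.mul h1).add (hf.mul h2)).prodMk ((hf.mul h1).sub (hg.mul h2)))
    exact h3
  have hζc : Continuous ζ := by
    refine continuous_toE3 (hwc.norm.log fun t => norm_ne_zero_iff.2 (hw0 t)) ?_ ?_
    · refine Continuous.add (continuous_iff_continuousAt.2 fun t => ?_) (by fun_prop)
      exact (Complex.continuousAt_arg (Or.inl (hwre t))).comp hwc.continuousAt
    · exact continuous_const.inner (hcc.continuous.sub continuous_const)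
  have hder : ∀ t, HasDerivAt (fun t => P (ζ t)) (linkingForm σ (c t) (deriv c t)) t := by
    intro t
    obtain ⟨b, hb, hPb⟩ := hL.pull hP hcc.continuous.continuousAt (hcV t) hζc.continuousAt
      (Eventually.of_forall hζe)
    exact (hb.self_of_nhds.comp_hasDerivAt t (hcc.hasDerivAt t)).congr_of_eventuallyEq hPb
  rw [gaussLinkingIntegral_eq_integral_linkingForm hσ hcc hd,
    intervalIntegral.integral_eq_sub_of_hasDerivAt (fun t _ => hder t)
      ((continuous_linkingForm_along hσ hcc hd).intervalIntegrable _ _)]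
  have h1 : ζ 1 = ζ 0 + turn := by
    have e1 : w 1 = w 0 := by
      simp only [hw, hcc.one_eq_zero, mul_one, mul_zero, Real.cos_two_pi, Real.sin_two_pi,
        Real.cos_zero, Real.sin_zero]
    simp only [hζ, e1, hcc.one_eq_zero]
    ext i
    fin_cases i <;> simp [turn]
  rw [h1, hκ _ (hL.mem_slab _ (hcV 0) _ (hζe 0))]
  ring

lemma shift_eq_neg_one (hσ : IsEmbeddedClosedCurve σ) {s₀ l κ : ℝ}
    (hE : IsEdgeChart S n σ (σ s₀) U f g G N)
    (hF : IsFrame G N T) (hl : 0 < l) (hv : deriv σ s₀ = l • T)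
    (hVU : V ⊆ U) (hL : IsLogChart σ (σ s₀) f g T V Q r)
    (hP : ∀ ζ ∈ slab (Real.log r - 1) (r / 2), IsPulledPrimitive σ Q (slab (Real.log r) r) ζ P)
    (hκ : ∀ ζ ∈ slab (Real.log r - 1) (r / 2), P (ζ + turn) = P ζ + κ) : κ = -1 := by
  set p := σ s₀ with hp
  obtain ⟨hfp, hgp⟩ := (hE.mem_curve p hE.mem).1 ⟨s₀, rfl⟩
  obtain ⟨C, hC⟩ := gaussLinkingIntegral_circle hσ hF hl hv
  obtain ⟨d, hd, hball⟩ := Metric.eventually_nhds_iff_ball.1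
    (((hL.isOpen.eventually_mem hL.mem).and (eventually_abs_sub_le hE.fderiv_f hfp)).and
      (eventually_abs_sub_le hE.fderiv_g hgp))
  have hρd : ∀ᶠ ρ in 𝓝[>] (0 : ℝ), ρ < d := nhdsWithin_le_nhds (gt_mem_nhds hd)
  have key : ∀ᶠ ρ in 𝓝[>] (0 : ℝ), |κ + 1| ≤ C * ρ := by
    filter_upwards [hC, hρd, self_mem_nhdsWithin] with ρ h1 h2 h3
    rw [← shift_eq_gauss hσ.toIsClosedCurve hE hF hVU hL hP hκ h3 h1.1 fun x hx => ?_]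
    · exact h1.2
    · obtain ⟨⟨a, b⟩, c⟩ := hball x (mem_ball_iff_norm.2 (hx.trans_lt h2))
      exact ⟨a, b, c⟩
  have hlim : Tendsto (fun ρ : ℝ => C * ρ) (𝓝[>] 0) (𝓝 0) := by
    have : Tendsto (fun ρ : ℝ => C * ρ) (𝓝 0) (𝓝 (C * 0)) := tendsto_id.const_mul C
    rw [mul_zero] at this
    exact this.mono_left nhdsWithin_le_nhds
  have h0 := ge_of_tendsto hlim key
  have := abs_nonpos_iff.1 h0
  linarith

end Edge

theorem exists_section_of_mem_range {S : Set E3} {n : E3 → E3} {σ : ℝ → E3} {F : E3 → E3 → ℝ}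
    (hS : IsSeifertSurface S n σ) (hF : ∀ x ∈ S \ range σ, IsSideChart S n x (F x)) (s₀ : ℝ) :
    ∃ V, IsOpen V ∧ σ s₀ ∈ V ∧ HasSection (IsJumpPrimitive σ S F) (range σ) V := by
  classical
  obtain ⟨U, f, g, G, N, T, l, hE, hFr, hl, hv⟩ := exists_edgeChart hS s₀
  set p := σ s₀ with hp
  have hσ : IsClosedCurve σ := hS.embedded.toIsClosedCurve
  obtain ⟨V, Q, r, hVU, hL⟩ := exists_logChart hE hFr ⟨s₀, rfl⟩
  obtain ⟨P, hP⟩ := exists_pulledPrimitive hσ hL.pos hL.continuousOn hL.notMem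
  obtain ⟨κ, hκ⟩ := hL.exists_shift hP
  have hκ1 : κ = -1 := shift_eq_neg_one hS.embedded hE hFr hl hv hVU hL hP hκ
  subst hκ1
  set z : E3 → ℂ := fun y => ⟨g y, f y⟩ with hz
  set Λ : E3 → E3 := fun y => !₂[Real.log ‖-z y‖, (-z y).arg + Real.pi, inner ℝ T (y - p)] with hΛ
  set Λ' : E3 → E3 := fun y => !₂[Real.log ‖z y‖, (z y).arg + 0, inner ℝ T (y - p)] with hΛ'
  have heΛ : ∀ y, z y ≠ 0 → expMap (Λ y) = edgeCoord f g T p y := fun y hy =>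
    expMap_log (neg_ne_zero.2 hy) (by simp [hz]) (by simp [hz])
  have heΛ' : ∀ y, z y ≠ 0 → expMap (Λ' y) = edgeCoord f g T p y := fun y hy =>
    expMap_log hy (by simp [hz]) (by simp [hz])
  refine ⟨V, hL.isOpen, hL.mem, fun y => P (Λ y), fun y hy hyσ => ?_⟩
  have hyU := hVU hy
  have hzc : ContinuousAt z y := by
    have hf := hE.smooth_f.continuousOn.continuousAt (hE.isOpen.mem_nhds hyU)
    have hg := hE.smooth_g.continuousOn.continuousAt (hE.isOpen.mem_nhds hyU)
    exact Complex.equivRealProdCLM.symm.continuous.continuousAt.comp (hg.prodMk hf)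
  have hz0 : z y ≠ 0 := fun h => hyσ ((hE.mem_curve y hyU).2
    ⟨congrArg Complex.im h, congrArg Complex.re h⟩)
  have hzev : ∀ᶠ x in 𝓝 y, z x ≠ 0 := hzc.eventually_ne hz0
  have hT : ContinuousAt (fun x => inner ℝ T (x - p)) y := by fun_prop
  by_cases hyS : y ∈ S
  · obtain ⟨hf0, hg0⟩ := (hE.mem_surface y hyU).1 hyS
    have hgpos : 0 < g y := lt_of_le_of_ne hg0 fun h => hyσ ((hE.mem_curve y hyU).2 ⟨hf0, h.symm⟩)
    have hΛc : ContinuousAt Λ' y := by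
      refine continuousAt_toE3 (hzc.norm.log (norm_ne_zero_iff.2 hz0)) ?_ hT
      exact ContinuousAt.add ((Complex.continuousAt_arg (Or.inl hgpos)).comp hzc) continuousAt_const
    obtain ⟨b, hb, hPb⟩ := hL.pull hP continuousAt_id hy hΛc (hzev.mono heΛ')
    obtain ⟨f₀, hf₀, hiff⟩ := hE.side y ⟨hyU, hyS⟩ hyσ
    refine isJumpPrimitive_of_mem hyS (hF y ⟨hyS, hyσ⟩) hf₀ (hb.add_const (-1)) ?_
    have hgc := hE.smooth_g.continuousOn.continuousAt (hE.isOpen.mem_nhds hyU)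
    filter_upwards [hPb, hzev, hgc.eventually (lt_mem_nhds hgpos),
      hL.isOpen.eventually_mem hy] with x h1 h2 h3 h4
    simp only [hiff]
    -- compare the two determinations of the argument
    rcases lt_trichotomy (f x) 0 with h | h | h
    · have e : Λ x = Λ' x + turn := by
        have h5 := Complex.arg_neg_eq_arg_add_pi_of_im_neg (x := z x) h
        ext i
        fin_cases i
        · simp [hΛ, hΛ', turn]
        · simp [hΛ, hΛ', turn, h5]; ring
        · simp [hΛ, hΛ', turn]
      rw [e, hκ _ (hL.mem_slab _ h4 _ (heΛ' x h2)), h1, if_neg h.not_gt]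
      simp
    · have e : Λ x = Λ' x + turn := by
        have h5 : z x = ((g x : ℝ) : ℂ) := Complex.ext rfl h
        have h6 : (z x).arg = 0 := by rw [h5, Complex.arg_ofReal_of_nonneg h3.le]
        have h7 : (-z x).arg = Real.pi := by
          rw [h5, ← Complex.ofReal_neg, Complex.arg_ofReal_of_neg (by linarith)]
        ext i
        fin_cases i
        · simp [hΛ, hΛ', turn]
        · simp [hΛ, hΛ', turn, h6, h7]; ring
        · simp [hΛ, hΛ', turn]
      rw [e, hκ _ (hL.mem_slab _ h4 _ (heΛ' x h2)), h1, if_neg (by rw [h]; exact lt_irrefl _)]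
      simp
    · have e : Λ x = Λ' x := by
        have h5 := Complex.arg_neg_eq_arg_sub_pi_of_im_pos (x := z x) h
        ext i
        fin_cases i
        · simp [hΛ, hΛ']
        · simp [hΛ, hΛ', h5]
        · simp [hΛ, hΛ']
      rw [e, h1, if_pos h]
      simp
  · have hslit : -z y ∈ Complex.slitPlane := by
      rw [Complex.mem_slitPlane_iff]
      by_contra hcon
      rw [not_or, not_not] at hcon
      refine hyS ((hE.mem_surface y hyU).2 ⟨?_, ?_⟩)
      · simpa [hz] using hcon.2
      · simpa [hz] using hcon.1
    have hΛc : ContinuousAt Λ y := by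
      refine continuousAt_toE3 (hzc.neg.norm.log (norm_ne_zero_iff.2 (neg_ne_zero.2 hz0))) ?_ hT
      exact ContinuousAt.add (ContinuousAt.comp (g := Complex.arg) (f := fun y => -z y)
        (Complex.continuousAt_arg hslit) hzc.neg) continuousAt_const
    obtain ⟨b, hb, hPb⟩ := hL.pull hP continuousAt_id hy hΛc (hzev.mono heΛ)
    exact isJumpPrimitive_of_notMem hyS hb hPb

/-! ### The Gauss integral as an intersection number -/

section Seifert
variable {S : Set E3} {n : E3 → E3} {σ₁ σ₂ : ℝ → E3}

/-- Along a curve that crosses the surface, a side chart vanishes with derivative of the sign of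
the crossing. -/
lemma IsSideChart.hasDerivAt {x : E3} {f : E3 → ℝ} {t : ℝ} (h₂ : IsClosedCurve σ₂)
    (hx : σ₂ t = x) (hxS : x ∈ S) (hf : IsSideChart S n x f) :
    f x = 0 ∧ (∀ᶠ t' in 𝓝 t, σ₂ t' ∈ S ↔ f (σ₂ t') = 0) ∧
      ∃ a > 0, HasDerivAt (fun t => f (σ₂ t)) (a * inner ℝ (n x) (deriv σ₂ t)) t := by
  subst hx
  obtain ⟨U, hU, hxU, hfU, hS, hn⟩ := hf
  obtain ⟨h0, hnx⟩ := hn _ ⟨hxU, hxS⟩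
  have ha : 0 < ‖∇ f (σ₂ t)‖ := norm_pos_iff.2 h0
  refine ⟨(hS _ hxU).1 hxS, (h₂.continuous.continuousAt.eventually (hU.mem_nhds hxU)).mono
    fun t' ht' => hS _ ht', ‖∇ f (σ₂ t)‖, ha, ?_⟩
  have h1 := (hasFDerivAt_gradient ((hfU.contDiffAt (hU.mem_nhds hxU)).differentiableAt
    (by simp))).comp_hasDerivAt t (h₂.hasDerivAt t)
  refine HasDerivAt.congr_deriv (f := fun t => f (σ₂ t)) h1 ?_
  rw [innerSL_apply_apply, hnx, real_inner_smul_left]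
  field_simp

lemma IsSeifertSurface.exists_charts (hS : IsSeifertSurface S n σ₁) :
    ∃ F : E3 → E3 → ℝ, ∀ x ∈ S \ range σ₁, IsSideChart S n x (F x) := by
  have : ∀ x ∈ S \ range σ₁, ∃ f, IsSideChart S n x f := fun x hx => by
    obtain ⟨U, f, h1, h2, h3, h4, h5⟩ := hS.interior_chart x hx
    exact ⟨f, U, h1, h2, h3, h4, h5⟩
  choose! F hF using this
  exact ⟨F, hF⟩

lemma surface_isolated (h₂ : IsClosedCurve σ₂) (hd : ∀ s t, σ₁ s ≠ σ₂ t)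
    (hS : IsSeifertSurface S n σ₁) (hT : CrossesTransversally σ₂ S n) (t : ℝ) :
    ∀ᶠ t' in 𝓝[≠] t, t' ∉ {t | σ₂ t ∈ S} := by
  by_cases ht : σ₂ t ∈ S
  · obtain ⟨F, hF⟩ := IsSeifertSurface.exists_charts hS
    obtain ⟨-, h1, a, ha, h2⟩ := IsSideChart.hasDerivAt h₂ rfl ht
      (hF _ ⟨ht, fun ⟨s, hs⟩ => hd s t hs⟩)
    filter_upwards [h2.eventually_ne (mul_ne_zero ha.ne' (hT t ht)) (c := 0),
      h1.filter_mono nhdsWithin_le_nhds] with t' h3 h4 h5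
    exact h3 (h4.1 h5)
  · exact (h₂.continuous.continuousAt.eventually
      (hS.compact.isClosed.isOpen_compl.mem_nhds ht)).filter_mono nhdsWithin_le_nhds

/-- A primitive of the linking form on the complement of the curve, that jumps across the
surface. -/
lemma exists_jumpPrimitive (hS : IsSeifertSurface S n σ₁) {F : E3 → E3 → ℝ}
    (hF : ∀ x ∈ S \ range σ₁, IsSideChart S n x (F x)) {K : Set E3} (hK : Bornology.IsBounded K) :
    ∃ u, ∀ x ∈ K, x ∉ range σ₁ → IsJumpPrimitive σ₁ S F x u := by
  have hσ : IsClosedCurve σ₁ := hS.embedded.toIsClosedCurve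
  obtain ⟨r, hr⟩ := hK.subset_ball 0
  refine (HasSection.of_local (isGermClass_isJumpPrimitive σ₁ S F) (isCompact_range hσ).isClosed
    (fun C hC hCo => isPreconnected_diff_range hσ hC hCo) (convex_ball 0 r) Metric.isOpen_ball
    Metric.isBounded_ball fun x _ => ?_).mono hr
  by_cases hx : x ∈ range σ₁
  · obtain ⟨s, rfl⟩ := hx
    exact exists_section_of_mem_range hS hF s
  · exact exists_section_of_notMem_range hσ hS.compact.isClosed hF hx

theorem gaussLinkingIntegral_seifert (h₂ : IsClosedCurve σ₂) (hd : ∀ s t, σ₁ s ≠ σ₂ t)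
    (hS : IsSeifertSurface S n σ₁) (hT : CrossesTransversally σ₂ S n) :
    gaussLinkingIntegral σ₁ σ₂ = -intersectionNumber σ₂ S n := by
  have hσ : IsClosedCurve σ₁ := hS.embedded.toIsClosedCurve
  obtain ⟨F, hF⟩ := IsSeifertSurface.exists_charts hS
  obtain ⟨u, hu⟩ := exists_jumpPrimitive hS hF (isCompact_range h₂).isBounded
  have hnot : ∀ t, σ₂ t ∉ range σ₁ := fun t ⟨s, hs⟩ => hd s t hs
  have hu' : ∀ t, IsJumpPrimitive σ₁ S F (σ₂ t) u := fun t => hu _ ⟨t, rfl⟩ (hnot t)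
  rw [gaussLinkingIntegral_eq_integral_linkingForm hσ h₂ hd]
  refine integral_eq_neg_sum_jumps (T := {t | σ₂ t ∈ S}) (Ω := fun t => u (σ₂ t))
    (J := fun t => Real.sign (inner ℝ (n (σ₂ t)) (deriv σ₂ t)))
    (continuous_linkingForm_along hσ h₂ hd) (surface_isolated h₂ hd hS hT)
    (by simp only [mem_ofPred_eq, h₂.one_eq_zero])
    (fun t => by simp only [h₂.periodic t]) ?_ ?_
  · intro t ht
    obtain ⟨b, hb, hub⟩ := hu' t
    refine (hb.self_of_nhds.comp_hasDerivAt t (h₂.hasDerivAt t)).congr_of_eventuallyEq ?_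
    filter_upwards [h₂.continuous.continuousAt.eventually hub] with t' ht'
    have : σ₂ t ∉ S := ht
    simp [ht', side, this]
  · intro t ht
    have htS : σ₂ t ∈ S := ht
    obtain ⟨b, hb, hub⟩ := hu' t
    obtain ⟨h0, -, a, ha, hder⟩ := IsSideChart.hasDerivAt h₂ rfl htS (hF _ ⟨htS, hnot t⟩)
    have hbc : ∀ s c, Tendsto (fun t' => b (σ₂ t') + c) (𝓝[s] t) (𝓝 (b (σ₂ t) + c)) := fun s c =>
      ((hb.self_of_nhds.comp_hasDerivAt t (h₂.hasDerivAt t)).continuousAt.tendsto.add_const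
        c).mono_left nhdsWithin_le_nhds
    have hub' := h₂.continuous.continuousAt.eventually hub
    have key : ∀ s : Set ℝ, ((∀ᶠ t' in 𝓝[s] t, 0 < F (σ₂ t) (σ₂ t')) →
        Tendsto (fun t => u (σ₂ t)) (𝓝[s] t) (𝓝 (b (σ₂ t) + 1))) ∧
        ((∀ᶠ t' in 𝓝[s] t, F (σ₂ t) (σ₂ t') < 0) →
        Tendsto (fun t => u (σ₂ t)) (𝓝[s] t) (𝓝 (b (σ₂ t) + 0))) := by
      intro s
      constructor
      · intro h
        refine (hbc s 1).congr' ?_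
        filter_upwards [h, hub'.filter_mono nhdsWithin_le_nhds] with t' h1 h2
        rw [h2, side, if_pos ⟨htS, h1⟩]
      · intro h
        refine (hbc s 0).congr' ?_
        filter_upwards [h, hub'.filter_mono nhdsWithin_le_nhds] with t' h1 h2
        rw [h2, side, if_neg fun h3 => h3.2.not_gt h1]
    rcases lt_or_gt_of_ne (hT t htS) with h | h
    · obtain ⟨hl, hr⟩ := eventually_left_right_of_neg hder h0 (mul_neg_of_pos_of_neg ha h)
      refine ⟨_, (key _).1 hl, ?_⟩
      have := (key _).2 hr
      rw [Real.sign_of_neg h]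
      convert this using 2
      ring
    · obtain ⟨hl, hr⟩ := eventually_left_right_of_pos hder h0 (mul_pos ha h)
      refine ⟨_, (key _).2 hl, ?_⟩
      have := (key _).1 hr
      rw [Real.sign_of_pos h]
      convert this using 2
      ring

end Seifert

/-! ### Constructions of disjoint homotopies -/

/-- The point of three-space above the point `w` of the plane, at height `z`. -/
noncomputable def toE3 (w : ℂ) (z : ℝ) : E3 := !₂[w.re, w.im, z]

/-- The projection of three-space to the plane. -/
noncomputable def horiz (x : E3) : ℂ := ⟨x 0, x 1⟩

@[simp] lemma horiz_toE3 (w : ℂ) (z : ℝ) : horiz (toE3 w z) = w := by simp [horiz, toE3]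

@[simp] lemma toE3_zero (w : ℂ) (z : ℝ) : toE3 w z 0 = w.re := by simp [toE3]

@[simp] lemma toE3_one (w : ℂ) (z : ℝ) : toE3 w z 1 = w.im := by simp [toE3]

@[simp] lemma toE3_two (w : ℂ) (z : ℝ) : toE3 w z 2 = z := by simp [toE3]

@[simp] lemma toE3_horiz (x : E3) : toE3 (horiz x) (x 2) = x := by
  ext i; fin_cases i <;> simp [toE3, horiz]

lemma toE3_inj {w w' : ℂ} {z z' : ℝ} : toE3 w z = toE3 w' z' ↔ w = w' ∧ z = z' := by
  refine ⟨fun h => ⟨?_, ?_⟩, fun h => by rw [h.1, h.2]⟩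
  · rw [← horiz_toE3 w z, h, horiz_toE3]
  · rw [← toE3_two w z, h, toE3_two]

lemma toE3_sub (w w' : ℂ) (z z' : ℝ) : toE3 w z - toE3 w' z' = toE3 (w - w') (z - z') := by
  ext i; fin_cases i <;> simp [toE3]

lemma norm_toE3_le (w : ℂ) (z : ℝ) : ‖toE3 w z‖ ≤ ‖w‖ + |z| := by
  refine le_of_sq_le_sq ?_ (by positivity)
  have h : ‖w‖ ^ 2 = w.re ^ 2 + w.im ^ 2 := by
    rw [Complex.sq_norm, Complex.normSq_apply]; ring
  rw [norm_sq_eq, add_sq, h, sq_abs]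
  simp only [toE3_zero, toE3_one, toE3_two]
  nlinarith [mul_nonneg (norm_nonneg w) (abs_nonneg z)]

lemma contDiff_toE3 {X : Type*} [NormedAddCommGroup X] [NormedSpace ℝ X] {w : X → ℂ} {z : X → ℝ}
    (hw : ContDiff ℝ ∞ w) (hz : ContDiff ℝ ∞ z) : ContDiff ℝ ∞ fun x => toE3 (w x) (z x) := by
  rw [contDiff_euclidean]
  intro i
  fin_cases i
  · exact Complex.reCLM.contDiff.comp hw
  · exact Complex.imCLM.contDiff.comp hw
  · exact hz

lemma contDiff_complex_mk {X : Type*} [NormedAddCommGroup X] [NormedSpace ℝ X] {a b : X → ℝ}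
    (ha : ContDiff ℝ ∞ a) (hb : ContDiff ℝ ∞ b) : ContDiff ℝ ∞ fun x => (⟨a x, b x⟩ : ℂ) :=
  Complex.equivRealProdCLM.symm.contDiff.comp (ha.prodMk hb)

lemma contDiff_horiz : ContDiff ℝ ∞ horiz := contDiff_complex_mk (contDiff_coord 0) (contDiff_coord 1)

lemma isClosedCurve_toE3 {w : ℝ → ℂ} {z : ℝ → ℝ} (hw : ContDiff ℝ ∞ w) (hz : ContDiff ℝ ∞ z)
    (pw : Function.Periodic w 1) (pz : Function.Periodic z 1) :
    IsClosedCurve fun t => toE3 (w t) (z t) :=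
  ⟨contDiff_toE3 hw hz, fun t => by simp only [pw t, pz t]⟩

section Homotopy
variable {γ₁ γ₂ η₁ η₂ : ℝ → E3}

lemma _root_.DisjointlyHomotopic.trans {θ₁ θ₂ : ℝ → E3} (h : DisjointlyHomotopic γ₁ γ₂ η₁ η₂)
    (h' : DisjointlyHomotopic η₁ η₂ θ₁ θ₂) : DisjointlyHomotopic γ₁ γ₂ θ₁ θ₂ := by
  obtain ⟨c₁, c₂, -⟩ := DisjointlyHomotopic.target h
  obtain ⟨A₁, A₂, a₁, a₂, ap, ad, a0, a1⟩ := DisjointlyHomotopic.exists_global h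
  obtain ⟨B₁, B₂, b₁, b₂, bp, bd, b0, b1⟩ := DisjointlyHomotopic.exists_global h'
  have key : ∀ τ : ℝ, (A₁ (3 * τ) = η₁ ∧ A₂ (3 * τ) = η₂) ∨
      (B₁ (3 * τ - 2) = η₁ ∧ B₂ (3 * τ - 2) = η₂) := by
    intro τ
    rcases le_total (1 / 2) τ with h | h
    · exact Or.inl (a1 _ (by linarith))
    · exact Or.inr (b0 _ (by linarith))
  have sA : ContDiff ℝ ∞ fun x : ℝ × ℝ => (3 * x.1, x.2) :=
    (contDiff_const.mul contDiff_fst).prodMk contDiff_snd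
  have sB : ContDiff ℝ ∞ fun x : ℝ × ℝ => (3 * x.1 - 2, x.2) :=
    ((contDiff_const.mul contDiff_fst).sub contDiff_const).prodMk contDiff_snd
  -- at every time, one of the two homotopies is at rest at the middle pair
  refine ⟨fun τ s => A₁ (3 * τ) s + B₁ (3 * τ - 2) s - η₁ s,
    fun τ s => A₂ (3 * τ) s + B₂ (3 * τ - 2) s - η₂ s, ?_, ?_, fun τ _ => ⟨fun s => ?_, fun s => ?_⟩,
    fun τ _ s t => ?_, ?_, ?_, ?_, ?_⟩
  · exact ((a₁.comp sA).add (b₁.comp sB)).sub (c₁.smooth.comp contDiff_snd)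
  · exact ((a₂.comp sA).add (b₂.comp sB)).sub (c₂.smooth.comp contDiff_snd)
  · simp only [(ap _).1 s, (bp _).1 s, c₁.periodic s]
  · simp only [(ap _).2 s, (bp _).2 s, c₂.periodic s]
  · rcases key τ with ⟨h1, h2⟩ | ⟨h1, h2⟩
    · simp only [h1, h2, add_sub_cancel_left]
      exact bd _ _ _
    · simp only [h1, h2, add_sub_cancel_right]
      exact ad _ _ _
  · funext s
    dsimp only
    rw [(a0 (3 * 0) (by norm_num)).1, (b0 (3 * 0 - 2) (by norm_num)).1, add_sub_cancel_right]
  · funext s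
    dsimp only
    rw [(a0 (3 * 0) (by norm_num)).2, (b0 (3 * 0 - 2) (by norm_num)).2, add_sub_cancel_right]
  · funext s
    dsimp only
    rw [(a1 (3 * 1) (by norm_num)).1, (b1 (3 * 1 - 2) (by norm_num)).1, add_sub_cancel_left]
  · funext s
    dsimp only
    rw [(a1 (3 * 1) (by norm_num)).2, (b1 (3 * 1 - 2) (by norm_num)).2, add_sub_cancel_left]

/-- The straight-line homotopy between pairs of curves. -/
lemma disjointlyHomotopic_of_line (h₁ : IsClosedCurve γ₁) (h₂ : IsClosedCurve γ₂)
    (k₁ : IsClosedCurve η₁) (k₂ : IsClosedCurve η₂)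
    (hd : ∀ τ ∈ Icc (0 : ℝ) 1, ∀ s t,
      γ₁ s + τ • (η₁ s - γ₁ s) ≠ γ₂ t + τ • (η₂ t - γ₂ t)) :
    DisjointlyHomotopic γ₁ γ₂ η₁ η₂ := by
  have hsm : ∀ {γ η : ℝ → E3}, IsClosedCurve γ → IsClosedCurve η →
      ContDiff ℝ ∞ fun x : ℝ × ℝ => γ x.2 + x.1 • (η x.2 - γ x.2) := fun h k =>
    (h.smooth.comp contDiff_snd).add (contDiff_fst.smul
      ((k.smooth.comp contDiff_snd).sub (h.smooth.comp contDiff_snd)))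
  refine ⟨fun τ s => γ₁ s + τ • (η₁ s - γ₁ s), fun τ s => γ₂ s + τ • (η₂ s - γ₂ s), hsm h₁ k₁,
    hsm h₂ k₂, fun τ _ => ⟨fun s => ?_, fun s => ?_⟩, hd, ?_, ?_, ?_, ?_⟩
  · simp only [h₁.periodic s, k₁.periodic s]
  · simp only [h₂.periodic s, k₂.periodic s]
  all_goals funext s; simp

/-- Small perturbations of disjoint closed curves are disjointly homotopic to them. -/
lemma exists_pos_forall_disjointlyHomotopic (h₁ : IsClosedCurve γ₁) (h₂ : IsClosedCurve γ₂)
    (hd : ∀ s t, γ₁ s ≠ γ₂ t) : ∃ δ > 0, ∀ η₁ η₂ : ℝ → E3, IsClosedCurve η₁ → IsClosedCurve η₂ →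
      (∀ s, ‖η₁ s - γ₁ s‖ < δ) → (∀ t, ‖η₂ t - γ₂ t‖ < δ) → DisjointlyHomotopic γ₁ γ₂ η₁ η₂ := by
  obtain ⟨r, hr, hdist⟩ := (Set.disjoint_iff_forall_ne.2 (by
    rintro _ ⟨s, rfl⟩ _ ⟨t, rfl⟩; exact hd s t) :
      Disjoint (range γ₁) (range γ₂)).exists_thickenings (isCompact_range h₁)
      (isCompact_range h₂).isClosed
  refine ⟨r, hr, fun η₁ η₂ k₁ k₂ e₁ e₂ => disjointlyHomotopic_of_line h₁ h₂ k₁ k₂ ?_⟩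
  intro τ hτ s t heq
  have key : ∀ {γ η : ℝ → E3} (s : ℝ), ‖η s - γ s‖ < r →
      γ s + τ • (η s - γ s) ∈ Metric.thickening r (range γ) := by
    intro γ η s h
    refine Metric.mem_thickening_iff.2 ⟨γ s, ⟨s, rfl⟩, ?_⟩
    rw [dist_eq_norm, add_sub_cancel_left, norm_smul, Real.norm_of_nonneg hτ.1]
    exact (mul_le_of_le_one_left (norm_nonneg _) hτ.2).trans_lt h
  exact Set.disjoint_left.1 hdist (key s (e₁ s)) (heq ▸ key t (e₂ t))

/-- Reparametrisation of the first curve. -/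
lemma disjointlyHomotopic_reparam (h₁ : IsClosedCurve γ₁) (h₂ : IsClosedCurve γ₂)
    (hd : ∀ s t, γ₁ s ≠ γ₂ t) {φ : ℝ → ℝ} (hφ : ContDiff ℝ ∞ φ) (hφ1 : ∀ s, φ (s + 1) = φ s + 1) :
    DisjointlyHomotopic γ₁ γ₂ (fun s => γ₁ (φ s)) γ₂ := by
  refine ⟨fun τ s => γ₁ (s + τ * (φ s - s)), fun _ => γ₂, ?_, h₂.smooth.comp contDiff_snd,
    fun τ _ => ⟨fun s => ?_, h₂.periodic⟩, fun τ _ s t => hd _ _, ?_, rfl, ?_, rfl⟩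
  · exact h₁.smooth.comp (contDiff_snd.add (contDiff_fst.mul ((hφ.comp contDiff_snd).sub
      contDiff_snd)))
  · simp only [hφ1]
    rw [← h₁.periodic (s + τ * (φ s - s))]
    congr 1; ring
  · funext s; simp
  · funext s; simp

/-- Ambient isotopies move pairs of disjoint curves to disjoint curves. -/
lemma disjointlyHomotopic_ambient (h₁ : IsClosedCurve γ₁) (h₂ : IsClosedCurve γ₂)
    (hd : ∀ s t, γ₁ s ≠ γ₂ t) {F : ℝ → E3 → E3}
    (hF : ContDiff ℝ ∞ fun x : ℝ × E3 => F x.1 x.2) (hinj : ∀ τ, Function.Injective (F τ))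
    (h0 : ∀ x, F 0 x = x) :
    DisjointlyHomotopic γ₁ γ₂ (fun s => F 1 (γ₁ s)) fun t => F 1 (γ₂ t) := by
  refine ⟨fun τ s => F τ (γ₁ s), fun τ s => F τ (γ₂ s), ?_, ?_, fun τ _ => ⟨fun s => ?_,
    fun s => ?_⟩, fun τ _ s t h => hd s t (hinj τ h), ?_, ?_, rfl, rfl⟩
  · exact hF.comp (contDiff_fst.prodMk (h₁.smooth.comp contDiff_snd))
  · exact hF.comp (contDiff_fst.prodMk (h₂.smooth.comp contDiff_snd))
  · simp only [h₁.periodic s]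
  · simp only [h₂.periodic s]
  · funext s; exact h0 _
  · funext s; exact h0 _

end Homotopy

/-- The image of an open set under a differentiable map to a space of larger dimension has dense
complement. -/
lemma dense_compl_image {E F : Type*} [NormedAddCommGroup E] [NormedSpace ℝ E]
    [FiniteDimensional ℝ E] [NormedAddCommGroup F] [NormedSpace ℝ F] [FiniteDimensional ℝ F]
    {f : E → F} {U : Set E} (hU : IsOpen U) (hf : ContDiffOn ℝ 1 f U)
    (h : Module.finrank ℝ E < Module.finrank ℝ F) : Dense (f '' U)ᶜ := by
  refine dense_compl_of_dimH_lt_finrank ?_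
  refine (dimH_image_le_of_locally_lipschitzOn fun x hx => ?_).trans_lt ?_ (b := dimH U)
  · obtain ⟨K, t, ht, hK⟩ := (hf.contDiffAt (hU.mem_nhds hx)).exists_lipschitzOnWith
    exact ⟨K, t, mem_nhdsWithin_of_mem_nhds ht, hK⟩
  · refine (dimH_mono (subset_univ U)).trans_lt ?_
    rw [Real.dimH_univ_eq_finrank]
    exact_mod_cast h

/-! ### Unknotting the first curve by a change of heights -/

/-- No point of the second curve lies vertically between two points of the first curve. -/
def NotBetween (γ₁ γ₂ : ℝ → E3) : Prop :=
  ∀ s s' t, horiz (γ₁ s) = horiz (γ₂ t) → horiz (γ₁ s') = horiz (γ₂ t) →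
    ¬(γ₁ s 2 < γ₂ t 2 ∧ γ₂ t 2 < γ₁ s' 2)

/-- Shearing the first curve and translating the second one, by a generic small amount, achieves
that no point of the second curve lies vertically between two points of the first: the bad
parameters form the image of a three-dimensional space in a four-dimensional one. -/
lemma exists_notBetween {γ₁ γ₂ : ℝ → E3} (h₁ : IsClosedCurve γ₁) (h₂ : IsClosedCurve γ₂)
    (hd : ∀ s t, γ₁ s ≠ γ₂ t) :
    ∃ η₁ η₂, DisjointlyHomotopic γ₁ γ₂ η₁ η₂ ∧ NotBetween η₁ η₂ := by
  obtain ⟨δ, hδ, hsmall⟩ := exists_pos_forall_disjointlyHomotopic h₁ h₂ hd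
  obtain ⟨M, hM⟩ := (isCompact_range h₁).isBounded.exists_norm_le
  have hM0 : 0 ≤ M := (norm_nonneg _).trans (hM _ ⟨0, rfl⟩)
  set w₁ : ℝ → ℂ := fun s => horiz (γ₁ s)
  set z₁ : ℝ → ℝ := fun s => γ₁ s 2
  set w₂ : ℝ → ℂ := fun s => horiz (γ₂ s)
  set z₂ : ℝ → ℝ := fun s => γ₂ s 2
  have cw₁ : ContDiff ℝ ∞ w₁ := contDiff_horiz.comp h₁.smooth
  have cw₂ : ContDiff ℝ ∞ w₂ := contDiff_horiz.comp h₂.smooth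
  have cz₁ : ContDiff ℝ ∞ z₁ := (contDiff_coord 2).comp h₁.smooth
  have cz₂ : ContDiff ℝ ∞ z₂ := (contDiff_coord 2).comp h₂.smooth
  set U : Set (ℝ × ℝ × ℝ) := {x | z₁ x.1 - z₁ x.2.1 ≠ 0}
  set A : ℝ × ℝ × ℝ → ℂ := fun x => (z₁ x.1 - z₁ x.2.1)⁻¹ • (w₁ x.2.1 - w₁ x.1)
  have cz : ContDiff ℝ ∞ fun x : ℝ × ℝ × ℝ => z₁ x.1 - z₁ x.2.1 :=
    (cz₁.comp contDiff_fst).sub (cz₁.comp (contDiff_fst.comp contDiff_snd))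
  have hU : IsOpen U := isOpen_ne.preimage cz.continuous
  have cA : ContDiffOn ℝ ∞ A U := (cz.contDiffOn.inv fun x hx => hx).smul
    ((cw₁.comp (contDiff_fst.comp contDiff_snd)).sub (cw₁.comp contDiff_fst)).contDiffOn
  have cf : ContDiffOn ℝ 1 (fun x : ℝ × ℝ × ℝ =>
      (A x, w₁ x.1 + z₁ x.1 • A x - w₂ x.2.2)) U := by
    refine ContDiffOn.of_le (cA.prodMk ?_) (by simp)
    exact ((cw₁.comp contDiff_fst).contDiffOn.add
      ((cz₁.comp contDiff_fst).contDiffOn.smul cA)).sub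
      (cw₂.comp (contDiff_snd.comp contDiff_snd)).contDiffOn
  have hdense := dense_compl_image hU cf (by simp [Complex.finrank_real_complex])
  obtain ⟨⟨a, v⟩, hav, hgood⟩ := hdense.inter_open_nonempty
    (Metric.ball (0 : ℂ × ℂ) (δ / (M + 1))) Metric.isOpen_ball
    ⟨0, Metric.mem_ball_self (by positivity)⟩
  rw [mem_ball_zero_iff, Prod.norm_def, max_lt_iff] at hav
  obtain ⟨ha, hv⟩ := hav
  refine ⟨fun s => toE3 (w₁ s + z₁ s • a) (z₁ s), fun t => toE3 (w₂ t + v) (z₂ t),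
    hsmall _ _ (isClosedCurve_toE3 (cw₁.add (cz₁.smul contDiff_const)) cz₁
      (fun s => by simp only [w₁, z₁, h₁.periodic s]) (fun s => by simp only [z₁, h₁.periodic s]))
      (isClosedCurve_toE3 (cw₂.add contDiff_const) cz₂
      (fun s => by simp only [w₂, h₂.periodic s]) (fun s => by simp only [z₂, h₂.periodic s]))
      (fun s => ?_) (fun t => ?_), ?_⟩
  · rw [← toE3_horiz (γ₁ s), toE3_sub]
    refine (norm_toE3_le _ _).trans_lt ?_
    have e : w₁ s + z₁ s • a - horiz (γ₁ s) = z₁ s • a := by simp only [w₁]; abel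
    have hz : |z₁ s| ≤ M := (PiLp.norm_apply_le (γ₁ s) 2).trans (hM _ ⟨s, rfl⟩)
    rw [e, sub_self, abs_zero, add_zero, norm_smul, Real.norm_eq_abs]
    rw [lt_div_iff₀ (by positivity)] at ha
    simp only at ha
    nlinarith [norm_nonneg a]
  · rw [← toE3_horiz (γ₂ t), toE3_sub]
    refine (norm_toE3_le _ _).trans_lt ?_
    have e : w₂ t + v - horiz (γ₂ t) = v := by simp only [w₂]; abel
    rw [e, sub_self, abs_zero, add_zero]
    exact hv.trans_le (div_le_self hδ.le (by linarith))
  · intro s s' t h1 h2 h3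
    simp only [horiz_toE3, toE3_two] at h1 h2 h3
    have hne : z₁ s - z₁ s' ≠ 0 := by linarith [h3.1.trans h3.2]
    have ea : A (s, s', t) = a := by
      simp only [A]
      rw [inv_smul_eq_iff₀ hne, sub_smul]
      linear_combination h2 - h1
    refine hgood ⟨(s, s', t), hne, ?_⟩
    rw [Prod.mk.injEq, ea]
    exact ⟨rfl, by linear_combination h1⟩

lemma exists_int_of_cos_sin_eq {t t' : ℝ}
    (hc : Real.cos (2 * Real.pi * t) = Real.cos (2 * Real.pi * t'))
    (hs : Real.sin (2 * Real.pi * t) = Real.sin (2 * Real.pi * t')) : ∃ k : ℤ, t = t' + k := by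
  have h1 : Complex.exp (2 * Real.pi * t * Complex.I)
      = Complex.exp (2 * Real.pi * t' * Complex.I) := by
    rw [Complex.exp_mul_I, Complex.exp_mul_I]
    norm_cast
    rw [hc, hs]
  obtain ⟨k, hk⟩ := Complex.exp_eq_exp_iff_exists_int.1 h1
  refine ⟨k, ?_⟩
  have h2 : (2 * Real.pi * Complex.I) * (t - (t' + k)) = 0 := by linear_combination hk
  rw [mul_eq_zero, or_iff_right Complex.two_pi_I_ne_zero] at h2
  have := sub_eq_zero.1 h2
  exact_mod_cast this

/-- A periodic height function for the second curve, compatible with given height functions for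
the first one. -/
lemma exists_height {γ₁ γ₂ : ℝ → E3} (h₁ : IsClosedCurve γ₁) (h₂ : IsClosedCurve γ₂)
    (hd : ∀ s t, γ₁ s ≠ γ₂ t) (hb : NotBetween γ₁ γ₂) {ζ : ℝ → ℝ} (hζ : Continuous ζ)
    (hζp : Function.Periodic ζ 1) :
    ∃ h : ℝ → ℝ, ContDiff ℝ ∞ h ∧ Function.Periodic h 1 ∧
      ∀ s t, horiz (γ₁ s) = horiz (γ₂ t) → 0 < (γ₂ t 2 - γ₁ s 2) * (h t - ζ s) := by
  set e : ℝ → ℝ × ℝ := fun t => (Real.cos (2 * Real.pi * t), Real.sin (2 * Real.pi * t))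
  have he : ContDiff ℝ ∞ e :=
    (contDiff_const.mul contDiff_id).cos.prodMk (contDiff_const.mul contDiff_id).sin
  have hep : Function.Periodic e 1 := fun t => by
    simp only [e, mul_add, mul_one, Real.cos_add_two_pi, Real.sin_add_two_pi]
  have einj : ∀ t t', e t = e t' → ∃ k : ℤ, t = t' + k := fun t t' h =>
    exists_int_of_cos_sin_eq (congrArg Prod.fst h) (congrArg Prod.snd h)
  obtain ⟨B, hB⟩ : ∃ B, ∀ s, |ζ s| ≤ B := by
    obtain ⟨B, hB⟩ := (isCompact_Icc (a := (0 : ℝ)) (b := 1)).exists_bound_of_continuousOn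
      hζ.continuousOn
    refine ⟨B, fun s => ?_⟩
    obtain ⟨s', hs', h⟩ := hζp.exists_mem_Ico₀ one_pos s
    rw [h]
    exact hB s' (Ico_subset_Icc_self hs')
  have hloc : ∀ y : ℝ × ℝ, ∃ c : ℝ, ∀ᶠ y' in 𝓝 y, ∀ t, e t = y' →
      ∀ s, horiz (γ₁ s) = horiz (γ₂ t) → 0 < (γ₂ t 2 - γ₁ s 2) * (c - ζ s) := by
    intro y
    -- a height for the points over `y`
    obtain ⟨c, hc⟩ : ∃ c : ℝ, ∀ t, e t = y → ∀ s, horiz (γ₁ s) = horiz (γ₂ t) →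
        0 < (γ₂ t 2 - γ₁ s 2) * (c - ζ s) := by
      by_cases hy : ∃ t, e t = y
      · obtain ⟨t₀, rfl⟩ := hy
        have hγ : ∀ t, e t = e t₀ → γ₂ t = γ₂ t₀ := by
          intro t ht
          obtain ⟨k, rfl⟩ := einj t t₀ ht
          have := h₂.periodic.int_mul k t₀
          rwa [mul_one] at this
        have hne : ∀ s, horiz (γ₁ s) = horiz (γ₂ t₀) → γ₁ s 2 ≠ γ₂ t₀ 2 := by
          intro s hs hz
          refine hd s t₀ ?_
          rw [← toE3_horiz (γ₁ s), hs, hz, toE3_horiz]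
        by_cases hbelow : ∃ s, horiz (γ₁ s) = horiz (γ₂ t₀) ∧ γ₁ s 2 < γ₂ t₀ 2
        · obtain ⟨s₀, hs₀, hlt⟩ := hbelow
          refine ⟨B + 1, fun t ht s hs => ?_⟩
          rw [hγ t ht] at hs ⊢
          have h1 : γ₁ s 2 < γ₂ t₀ 2 := by
            by_contra hcon
            exact hb s₀ s t₀ hs₀ hs ⟨hlt, lt_of_le_of_ne (not_lt.1 hcon) (hne s hs).symm⟩
          exact mul_pos (by linarith) (by linarith [(abs_le.1 (hB s)).2])
        · refine ⟨-B - 1, fun t ht s hs => ?_⟩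
          rw [hγ t ht] at hs ⊢
          have h1 : γ₂ t₀ 2 < γ₁ s 2 := by
            by_contra hcon
            exact hbelow ⟨s, hs, lt_of_le_of_ne (not_lt.1 hcon) (hne s hs)⟩
          exact mul_pos_of_neg_of_neg (by linarith) (by linarith [(abs_le.1 (hB s)).1])
      · exact ⟨0, fun t ht => (hy ⟨t, ht⟩).elim⟩
    refine ⟨c, ?_⟩
    -- the parameters for which `c` is not admissible form a compact set
    set K : Set (ℝ × ℝ) := (Icc 0 1 ×ˢ Icc 0 1) ∩ {x | horiz (γ₁ x.1) = horiz (γ₂ x.2) ∧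
      (γ₂ x.2 2 - γ₁ x.1 2) * (c - ζ x.1) ≤ 0} with hK
    have c₁ : Continuous fun x : ℝ × ℝ => γ₁ x.1 := h₁.continuous.comp continuous_fst
    have c₂ : Continuous fun x : ℝ × ℝ => γ₂ x.2 := h₂.continuous.comp continuous_snd
    have hKc : IsCompact K := by
      refine (isCompact_Icc.prod isCompact_Icc).inter_right (IsClosed.and ?_ ?_)
      · exact isClosed_eq (contDiff_horiz.continuous.comp c₁) (contDiff_horiz.continuous.comp c₂)
      · exact isClosed_le ((((continuous_coord 2).comp c₂).sub ((continuous_coord 2).comp c₁)).mul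
          (continuous_const.sub (hζ.comp continuous_fst))) continuous_const
    have hyK : y ∉ (fun x : ℝ × ℝ => e x.2) '' K := by
      rintro ⟨x, hx, hxy⟩
      exact (hc x.2 hxy x.1 hx.2.1).not_ge hx.2.2
    have hcl : IsClosed ((fun x : ℝ × ℝ => e x.2) '' K) :=
      (hKc.image (he.continuous.comp continuous_snd)).isClosed
    filter_upwards [hcl.isOpen_compl.mem_nhds hyK] with y' hy' t ht s hs
    by_contra hcon
    obtain ⟨s', hs', es⟩ : ∃ s' ∈ Ico (0 : ℝ) 1, (γ₁ s, ζ s) = (γ₁ s', ζ s') :=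
      Function.Periodic.exists_mem_Ico₀ (f := fun s => (γ₁ s, ζ s))
        (fun s => by simp only [h₁.periodic s, hζp s]) one_pos s
    obtain ⟨t', ht', et⟩ : ∃ t' ∈ Ico (0 : ℝ) 1, (γ₂ t, e t) = (γ₂ t', e t') :=
      Function.Periodic.exists_mem_Ico₀ (f := fun s => (γ₂ s, e s))
        (fun s => by simp only [h₂.periodic s, hep s]) one_pos t
    rw [Prod.mk.injEq] at es et
    rw [es.1, es.2, et.1] at hcon
    rw [es.1, et.1] at hs
    exact hy' ⟨(s', t'), ⟨⟨Ico_subset_Icc_self hs', Ico_subset_Icc_self ht'⟩, hs, not_lt.1 hcon⟩,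
      by rw [← ht, et.2]⟩
  choose c hc using hloc
  have hconv : ∀ y : ℝ × ℝ, Convex ℝ {x : ℝ | ∀ t, e t = y →
      ∀ s, horiz (γ₁ s) = horiz (γ₂ t) → 0 < (γ₂ t 2 - γ₁ s 2) * (x - ζ s)} := by
    intro y a ha b hb' p q hp hq hpq t ht s hs
    have h1 := ha t ht s hs
    have h2 := hb' t ht s hs
    have e : (γ₂ t 2 - γ₁ s 2) * (p • a + q • b - ζ s)
        = p * ((γ₂ t 2 - γ₁ s 2) * (a - ζ s)) + q * ((γ₂ t 2 - γ₁ s 2) * (b - ζ s)) := by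
      simp only [smul_eq_mul]
      linear_combination (γ₂ t 2 - γ₁ s 2) * ζ s * hpq
    rw [e]
    rcases eq_or_lt_of_le hp with h | h
    · have : q = 1 := by linarith
      rw [← h, this]; linarith
    · have := mul_pos h h1
      have := mul_nonneg hq h2.le
      linarith
  obtain ⟨H, hH⟩ := exists_contMDiffMap_forall_mem_convex_of_local_const
    (I := modelWithCornersSelf ℝ (ℝ × ℝ)) (n := (⊤ : ℕ∞)) hconv fun y => ⟨c y, hc y⟩
  exact ⟨fun t => H (e t), H.contMDiff.contDiff.comp he, fun t => by simp only [hep t],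
    fun s t hst => hH (e t) t rfl s hst⟩

/-- The heights of the first curve can be changed arbitrarily. -/
lemma disjointlyHomotopic_heights {γ₁ γ₂ : ℝ → E3} (h₁ : IsClosedCurve γ₁) (h₂ : IsClosedCurve γ₂)
    (hd : ∀ s t, γ₁ s ≠ γ₂ t) (hb : NotBetween γ₁ γ₂) {ζ : ℝ → ℝ} (hζ : ContDiff ℝ ∞ ζ)
    (hζp : Function.Periodic ζ 1) :
    ∃ η₂, DisjointlyHomotopic γ₁ γ₂ (fun s => toE3 (horiz (γ₁ s)) (ζ s)) η₂ := by
  obtain ⟨h, hh, hp, hpos⟩ := exists_height h₁ h₂ hd hb hζ.continuous hζp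
  refine ⟨fun t => toE3 (horiz (γ₂ t)) (h t), disjointlyHomotopic_of_line h₁ h₂
    (isClosedCurve_toE3 (contDiff_horiz.comp h₁.smooth) hζ
      (fun s => by simp only [h₁.periodic s]) hζp)
    (isClosedCurve_toE3 (contDiff_horiz.comp h₂.smooth) hh
      (fun s => by simp only [h₂.periodic s]) hp) ?_⟩
  intro τ hτ s t heq
  have e : ∀ (x : E3) (c : ℝ), x + τ • (toE3 (horiz x) c - x)
      = toE3 (horiz x) (x 2 + τ * (c - x 2)) := by
    intro x c
    ext i
    fin_cases i <;> simp [toE3, horiz]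
  rw [e, e, toE3_inj] at heq
  have h1 := hpos s t heq.1
  have h2 : (1 - τ) * (γ₂ t 2 - γ₁ s 2) + τ * (h t - ζ s) = 0 := by linear_combination -heq.2
  have h3 : (1 - τ) * (γ₂ t 2 - γ₁ s 2) ^ 2 + τ * ((γ₂ t 2 - γ₁ s 2) * (h t - ζ s)) = 0 := by
    linear_combination (γ₂ t 2 - γ₁ s 2) * h2
  have h4 : γ₂ t 2 - γ₁ s 2 ≠ 0 := fun h => by rw [h, zero_mul] at h1; exact lt_irrefl _ h1
  have h5 : 0 < (γ₂ t 2 - γ₁ s 2) ^ 2 := by positivity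
  have h6 := mul_nonneg (sub_nonneg.2 hτ.2) h5.le
  have h7 := mul_nonneg hτ.1 h1.le
  rcases eq_or_lt_of_le hτ.1 with h | h
  · rw [← h] at h3; linarith
  · have := mul_pos h h1
    linarith

/-! ### Moving the first curve to a round circle -/

/-- A reparametrisation of the circle that is constant, modulo periods, on more than half of it. -/
lemma exists_flat_reparam : ∃ φ : ℝ → ℝ, ContDiff ℝ ∞ φ ∧ (∀ s, φ (s + 1) = φ s + 1) ∧
    ∀ s, -(1 / 2) ≤ Real.sin (2 * Real.pi * s) → ∃ k : ℤ, φ s = k := by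
  set b : ℝ → ℝ := fun s => expNegInvGlue (-Real.sin (2 * Real.pi * s) - 1 / 2) with hb
  have cb : ContDiff ℝ ∞ b :=
    expNegInvGlue.contDiff.comp ((contDiff_const.mul contDiff_id).sin.neg.sub contDiff_const)
  have bp : Function.Periodic b 1 := fun s => by
    simp only [hb, mul_add, mul_one, Real.sin_add_two_pi]
  have b0 : ∀ s, -(1 / 2) ≤ Real.sin (2 * Real.pi * s) → b s = 0 := fun s hs =>
    expNegInvGlue.zero_of_nonpos (by linarith)
  have hint : ∀ x y, IntervalIntegrable b volume x y := fun x y =>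
    cb.continuous.intervalIntegrable x y
  set C := ∫ s in (0 : ℝ)..1, b s with hC
  have hCpos : 0 < C := by
    refine intervalIntegral.integral_pos one_pos cb.continuous.continuousOn
      (fun x _ => expNegInvGlue.nonneg _) ⟨3 / 4, by norm_num, expNegInvGlue.pos_of_pos ?_⟩
    have : 2 * Real.pi * (3 / 4) = Real.pi / 2 + Real.pi := by ring
    rw [this, Real.sin_add_pi, Real.sin_pi_div_two]
    norm_num
  have hadd : ∀ s, C⁻¹ * ∫ u in (0 : ℝ)..(s + 1), b u = C⁻¹ * (∫ u in (0 : ℝ)..s, b u) + 1 := by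
    intro s
    have := bp.intervalIntegral_add_eq 0 s
    rw [zero_add, ← hC] at this
    rw [← intervalIntegral.integral_add_adjacent_intervals (hint 0 s) (hint s (s + 1)), ← this,
      mul_add, inv_mul_cancel₀ hCpos.ne']
  set φ : ℝ → ℝ := fun s => C⁻¹ * ∫ u in (0 : ℝ)..s, b u with hφ
  have hder : ∀ s, HasDerivAt φ (C⁻¹ * b s) s := fun s =>
    (intervalIntegral.integral_hasDerivAt_right (hint 0 s)
      (cb.continuous.stronglyMeasurableAtFilter _ _) cb.continuous.continuousAt).const_mul _
  refine ⟨φ, ?_, hadd, fun s hs => ?_⟩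
  · rw [contDiff_infty_iff_deriv]
    refine ⟨fun s => (hder s).differentiableAt, ?_⟩
    have : deriv φ = fun s => C⁻¹ * b s := funext fun s => (hder s).deriv
    rw [this]
    exact contDiff_const.mul cb
  · have hφk : ∀ (k : ℤ) (s : ℝ), φ (s + k) = φ s + k := by
      intro k
      induction k using Int.induction_on with
      | zero => intro s; simp
      | succ n ih =>
        intro s
        have := hadd (s + n)
        have h2 := ih s
        push_cast at h2 ⊢
        rw [← add_assoc]
        exact this.trans (by rw [← add_assoc]; exact congrArg (· + 1) h2)
      | pred n ih =>
        intro s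
        have h1 := hadd (s - n - 1)
        have h2 := ih s
        push_cast at h2 ⊢
        have e1 : s + (-(n : ℝ) - 1) = s - n - 1 := by ring
        have e2 : s - n - 1 + 1 = s + -(n : ℝ) := by ring
        rw [e1]
        rw [e2] at h1
        have h3 : φ (s + -(n : ℝ)) = φ (s - n - 1) + 1 := h1
        linarith
    -- reduce to the period `[-1/4, 3/4)`
    have hs0 : ∀ s, -(1 / 4) ≤ s → s ≤ 3 / 4 → -(1 / 2) ≤ Real.sin (2 * Real.pi * s) → φ s = 0 := by
      intro s h1 h2 h3
      have hpi := Real.pi_pos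
      have hzero : ∀ u ∈ uIcc 0 s, b u = 0 := by
        intro u hu
        refine b0 u ?_
        rcases le_total s (1 / 4) with h4 | h4
        · rcases le_total 0 s with h5 | h5
          · rw [uIcc_of_le h5] at hu
            have := Real.sin_nonneg_of_nonneg_of_le_pi (x := 2 * Real.pi * u)
              (by have := hu.1; positivity) (by nlinarith [hu.2])
            linarith
          · rw [uIcc_of_ge h5] at hu
            exact h3.trans (Real.sin_le_sin_of_le_of_le_pi_div_two (by nlinarith)
              (by nlinarith [hu.2]) (by nlinarith [hu.1]))
        · rw [uIcc_of_le (by linarith)] at hu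
          rcases le_total u (1 / 2) with h5 | h5
          · have := Real.sin_nonneg_of_nonneg_of_le_pi (x := 2 * Real.pi * u)
              (by have := hu.1; positivity) (by nlinarith)
            linarith
          · rw [← Real.sin_pi_sub] at h3 ⊢
            exact h3.trans (Real.sin_le_sin_of_le_of_le_pi_div_two (by nlinarith)
              (by nlinarith) (by nlinarith [hu.2]))
      simp only [hφ]
      rw [intervalIntegral.integral_congr (g := fun _ => (0 : ℝ)) hzero]
      simp
    set k : ℤ := ⌊s + 1 / 4⌋ with hk
    have h1 := Int.floor_le (s + 1 / 4)
    have h2 := Int.lt_floor_add_one (s + 1 / 4)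
    rw [← hk] at h1 h2
    refine ⟨k, ?_⟩
    have h3 : Real.sin (2 * Real.pi * (s - k)) = Real.sin (2 * Real.pi * s) := by
      rw [mul_sub, mul_comm (2 * Real.pi) (k : ℝ), Real.sin_sub_int_mul_two_pi]
    have h4 := hs0 (s - k) (by linarith) (by linarith) (by rw [h3]; exact hs)
    have h5 := hφk k (s - k)
    rw [sub_add_cancel, h4, zero_add] at h5
    exact h5

/-- A smooth positive function that agrees with `√(1 - z²)` for `z² ≤ 3/4`. -/
lemma exists_smooth_sqrt : ∃ r : ℝ → ℝ, ContDiff ℝ ∞ r ∧ (∀ z, 0 < r z) ∧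
    ∀ z, z ^ 2 ≤ 3 / 4 → r z = Real.sqrt (1 - z ^ 2) := by
  set T : ℝ → ℝ := fun z => Real.smoothTransition (8 * (z ^ 2 - 3 / 4)) with hT
  have cT : ContDiff ℝ ∞ T :=
    Real.smoothTransition.contDiff.comp (contDiff_const.mul ((contDiff_id.pow 2).sub contDiff_const))
  have hpos : ∀ z, 0 < 1 - z ^ 2 * (1 - T z) := by
    intro z
    rcases lt_or_ge (z ^ 2) 1 with h | h
    · have h1 := Real.smoothTransition.nonneg (8 * (z ^ 2 - 3 / 4))
      have : z ^ 2 * (1 - T z) ≤ z ^ 2 := mul_le_of_le_one_right (sq_nonneg z) (by simp only [hT]; linarith)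
      linarith
    · have h1 : T z = 1 := Real.smoothTransition.one_of_one_le (by linarith)
      rw [h1]; norm_num
  refine ⟨fun z => Real.sqrt (1 - z ^ 2 * (1 - T z)), ?_, fun z => Real.sqrt_pos.2 (hpos z), ?_⟩
  · exact ContDiff.sqrt (contDiff_const.sub ((contDiff_id.pow 2).mul (contDiff_const.sub cT)))
      fun z => (hpos z).ne'
  · intro z hz
    have h1 : T z = 0 := Real.smoothTransition.zero_of_nonpos (by linarith)
    simp only [h1, sub_zero, mul_one]

/-- Rotations and dilations of the horizontal planes about centres depending smoothly on the
height. -/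
lemma disjointlyHomotopic_twist {γ₁ γ₂ : ℝ → E3} (h₁ : IsClosedCurve γ₁) (h₂ : IsClosedCurve γ₂)
    (hd : ∀ s t, γ₁ s ≠ γ₂ t) {l c : ℝ → ℂ} (hl : ContDiff ℝ ∞ l) (hc : ContDiff ℝ ∞ c) :
    ∃ η₂, DisjointlyHomotopic γ₁ γ₂ (fun s => toE3 (Complex.exp (-l (γ₁ s 2)) *
      (horiz (γ₁ s) - c (γ₁ s 2)) + c (γ₁ s 2)) (γ₁ s 2)) η₂ := by
  set F : ℝ → E3 → E3 := fun τ x => toE3 (Complex.exp (-(τ • l (x 2))) *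
      (horiz x - c (x 2)) + c (x 2)) (x 2) with hF
  have h2 : ContDiff ℝ ∞ fun x : ℝ × E3 => x.2 2 := (contDiff_coord 2).comp contDiff_snd
  have hw : ContDiff ℝ ∞ fun x : ℝ × E3 => horiz x.2 := contDiff_horiz.comp contDiff_snd
  have hl2 : ContDiff ℝ ∞ fun x : ℝ × E3 => l (x.2 2) := hl.comp h2
  have hc2 : ContDiff ℝ ∞ fun x : ℝ × E3 => c (x.2 2) := hc.comp h2
  have hFs : ContDiff ℝ ∞ fun x : ℝ × E3 => F x.1 x.2 :=
    contDiff_toE3 (((contDiff_fst.smul hl2).neg.cexp.mul (hw.sub hc2)).add hc2) h2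
  have := disjointlyHomotopic_ambient h₁ h₂ hd hFs (fun τ x y hxy => ?_) fun x => ?_
  · simp only [hF, one_smul] at this
    exact ⟨_, this⟩
  · simp only [hF, toE3_inj] at hxy
    obtain ⟨hxy1, hxy2⟩ := hxy
    rw [hxy2] at hxy1
    have h3 := mul_left_cancel₀ (Complex.exp_ne_zero _) (add_right_cancel hxy1)
    rw [← toE3_horiz x, ← toE3_horiz y, hxy2, sub_left_injective h3]
  · simp [hF]

lemma contDiff_complex_div {X : Type*} [NormedAddCommGroup X] [NormedSpace ℝ X] {f g : X → ℂ}
    (hf : ContDiff ℝ ∞ f) (hg : ContDiff ℝ ∞ g) (h0 : ∀ x, g x ≠ 0) :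
    ContDiff ℝ ∞ fun x => f x / g x := by
  simp only [div_eq_mul_inv]
  exact hf.mul (hg.inv h0)

/-- On the strand `1/2 ≤ s ≤ 1` of a curve of height `z = cos 2πs`, a function `P` that vanishes
near the ends of the strand depends smoothly on the height: there `s = 1 - arccos z / 2π`, and
`arccos` is smooth away from `z = ± 1`. -/
lemma contDiff_comp_arccos {P : ℝ → ℂ} (hP : ContDiff ℝ ∞ P)
    (hP0 : ∀ s, -(1 / 2) ≤ Real.sin (2 * Real.pi * s) → P s = 0) :
    ContDiff ℝ ∞ fun z => P (1 - Real.arccos z / (2 * Real.pi)) := by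
  rw [contDiff_iff_contDiffAt]
  intro z
  have hpi := Real.pi_ne_zero
  by_cases hz : z ^ 2 < 1
  · have h1 : |z| < 1 := by rwa [← sq_lt_one_iff_abs_lt_one]
    obtain ⟨h2, h3⟩ := abs_lt.1 h1
    exact hP.contDiffAt.comp z (contDiffAt_const.sub
      ((Real.contDiffAt_arccos h2.ne' h3.ne).div_const _))
  · have h1 : ∀ᶠ x : ℝ in 𝓝 z, 3 / 4 < x ^ 2 :=
      (continuous_pow 2).continuousAt.eventually (lt_mem_nhds (by linarith))
    refine (contDiffAt_const (c := (0 : ℂ))).congr_of_eventuallyEq ?_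
    filter_upwards [h1] with x hx
    refine hP0 _ ?_
    have e : 2 * Real.pi * (1 - Real.arccos x / (2 * Real.pi))
        = 2 * Real.pi - Real.arccos x := by field_simp
    rw [e, Real.sin_two_pi_sub, Real.sin_arccos, neg_le_neg_iff]
    exact Real.sqrt_le_iff.2 ⟨by norm_num, by linarith⟩

/-- The strand `1/2 ≤ s ≤ 1` of a curve of height `cos 2πs`, parametrised by the height. -/
lemma comp_arccos_cos {P : ℝ → ℂ} (hp : Function.Periodic P 1) {s : ℝ}
    (hs : Real.sin (2 * Real.pi * s) < 0) :
    P (1 - Real.arccos (Real.cos (2 * Real.pi * s)) / (2 * Real.pi)) = P s := by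
  have hpi := Real.pi_pos
  set x := Int.fract s with hx
  have hsx : s = x + ⌊s⌋ := (Int.fract_add_floor s).symm
  have h0 : 0 ≤ x := Int.fract_nonneg s
  have h1 : x < 1 := Int.fract_lt_one s
  have e1 : P s = P x := by
    have := hp.int_mul ⌊s⌋ x
    rw [mul_one] at this
    rw [hsx, this]
  have e2 : 2 * Real.pi * s = 2 * Real.pi * x + ⌊s⌋ * (2 * Real.pi) := by
    conv_lhs => rw [hsx]
    ring
  rw [e2, Real.sin_add_int_mul_two_pi] at hs
  have h2 : 1 / 2 < x := by
    by_contra h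
    have := Real.sin_nonneg_of_nonneg_of_le_pi (x := 2 * Real.pi * x) (by positivity)
      (by nlinarith)
    linarith
  rw [e1, e2, Real.cos_add_int_mul_two_pi, ← Real.cos_two_pi_sub,
    Real.arccos_cos (by nlinarith) (by nlinarith)]
  congr 1
  field_simp
  ring

/-- The round unit circle in the horizontal plane. -/
noncomputable def unitCircle (s : ℝ) : E3 :=
  !₂[Real.cos (2 * Real.pi * s), Real.sin (2 * Real.pi * s), 0]

/-- A curve in a vertical plane over an ellipse is moved to the unit circle by a dilation and
two rotations. -/
lemma exists_unitCircle_of_ellipse {γ₁ γ₂ : ℝ → E3} (h₁ : IsClosedCurve γ₁) (h₂ : IsClosedCurve γ₂)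
    (hd : ∀ s t, γ₁ s ≠ γ₂ t) {w₀ q : ℂ} (hq : q ≠ 0)
    (hγ : ∀ s, γ₁ s = toE3 (w₀ + Real.sin (2 * Real.pi * s) • q) (Real.cos (2 * Real.pi * s))) :
    ∃ η₂, DisjointlyHomotopic γ₁ γ₂ unitCircle η₂ := by
  obtain ⟨θ₂, hθ⟩ := disjointlyHomotopic_twist h₁ h₂ hd (l := fun _ => Complex.log q)
    (c := fun _ => w₀) contDiff_const contDiff_const
  have e1 : (fun s => toE3 (Complex.exp (-Complex.log q) * (horiz (γ₁ s) - w₀) + w₀) (γ₁ s 2))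
      = fun s => toE3 (w₀ + (Real.sin (2 * Real.pi * s) : ℂ)) (Real.cos (2 * Real.pi * s)) := by
    funext s
    rw [hγ s, horiz_toE3, toE3_two, Complex.exp_neg, Complex.exp_log hq, add_sub_cancel_left,
      Complex.real_smul, mul_comm _ q, inv_mul_cancel_left₀ hq, add_comm]
  rw [e1] at hθ
  obtain ⟨a₁, a₂, ad⟩ := DisjointlyHomotopic.target hθ
  -- translate to the vertical axis, and rotate the vertical circle into the horizontal plane
  set v : E3 := toE3 w₀ 0 with hv
  set F : ℝ → E3 → E3 := fun τ x => !₂[Real.cos (Real.pi / 2 * τ) * (x 0 - τ * v 0)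
      + Real.sin (Real.pi / 2 * τ) * x 2, x 1 - τ * v 1,
      -Real.sin (Real.pi / 2 * τ) * (x 0 - τ * v 0) + Real.cos (Real.pi / 2 * τ) * x 2] with hF
  have hτ : ContDiff ℝ ∞ fun x : ℝ × E3 => Real.pi / 2 * x.1 := contDiff_const.mul contDiff_fst
  have hx : ∀ i, ContDiff ℝ ∞ fun x : ℝ × E3 => x.2 i := fun i => (contDiff_coord i).comp contDiff_snd
  have hxv : ∀ i, ContDiff ℝ ∞ fun x : ℝ × E3 => x.2 i - x.1 * v i := fun i =>
    (hx i).sub (contDiff_fst.mul contDiff_const)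
  have hFs : ContDiff ℝ ∞ fun x : ℝ × E3 => F x.1 x.2 := by
    rw [contDiff_euclidean]
    intro i
    fin_cases i
    · exact (hτ.cos.mul (hxv 0)).add (hτ.sin.mul (hx 2))
    · exact hxv 1
    · exact (hτ.sin.neg.mul (hxv 0)).add (hτ.cos.mul (hx 2))
  have hθ2 := disjointlyHomotopic_ambient a₁ a₂ ad hFs (fun τ x y hxy => ?_) fun x => ?_
  rotate_left
  · have k0 := congrFun (congrArg WithLp.ofLp hxy) 0
    have k1 := congrFun (congrArg WithLp.ofLp hxy) 1
    have k2 := congrFun (congrArg WithLp.ofLp hxy) 2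
    simp only [hF, PiLp.toLp_apply, Matrix.cons_val_zero, Matrix.cons_val_one, Matrix.cons_val]
      at k0 k1 k2
    have hsc := Real.sin_sq_add_cos_sq (Real.pi / 2 * τ)
    ext i
    fin_cases i
    · change x 0 = y 0
      linear_combination Real.cos (Real.pi / 2 * τ) * k0 - Real.sin (Real.pi / 2 * τ) * k2
        - (x 0 - y 0) * hsc
    · change x 1 = y 1
      linarith
    · change x 2 = y 2
      linear_combination Real.sin (Real.pi / 2 * τ) * k0 + Real.cos (Real.pi / 2 * τ) * k2
        - (x 2 - y 2) * hsc
  · ext i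
    fin_cases i <;> simp [hF]
  have e2 : (fun s => F 1 (toE3 (w₀ + (Real.sin (2 * Real.pi * s) : ℂ)) (Real.cos (2 * Real.pi * s))))
      = fun s => !₂[Real.cos (2 * Real.pi * s), 0, -Real.sin (2 * Real.pi * s)] := by
    funext s
    ext i
    fin_cases i <;> simp [hF, hv, -Complex.ofReal_sin]
  rw [e2] at hθ2
  obtain ⟨b₁, b₂, bd⟩ := DisjointlyHomotopic.target hθ2
  set G : ℝ → E3 → E3 := fun τ x => !₂[x 0, Real.cos (Real.pi / 2 * τ) * x 1
      - Real.sin (Real.pi / 2 * τ) * x 2,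
      Real.sin (Real.pi / 2 * τ) * x 1 + Real.cos (Real.pi / 2 * τ) * x 2] with hG
  have hGs : ContDiff ℝ ∞ fun x : ℝ × E3 => G x.1 x.2 := by
    rw [contDiff_euclidean]
    intro i
    fin_cases i
    · exact hx 0
    · exact (hτ.cos.mul (hx 1)).sub (hτ.sin.mul (hx 2))
    · exact (hτ.sin.mul (hx 1)).add (hτ.cos.mul (hx 2))
  have hθ3 := disjointlyHomotopic_ambient b₁ b₂ bd hGs (fun τ x y hxy => ?_) fun x => ?_
  rotate_left
  · have k0 := congrFun (congrArg WithLp.ofLp hxy) 0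
    have k1 := congrFun (congrArg WithLp.ofLp hxy) 1
    have k2 := congrFun (congrArg WithLp.ofLp hxy) 2
    simp only [hG, PiLp.toLp_apply, Matrix.cons_val_zero, Matrix.cons_val_one, Matrix.cons_val]
      at k0 k1 k2
    have hsc := Real.sin_sq_add_cos_sq (Real.pi / 2 * τ)
    ext i
    fin_cases i
    · exact k0
    · change x 1 = y 1
      linear_combination Real.cos (Real.pi / 2 * τ) * k1 + Real.sin (Real.pi / 2 * τ) * k2
        - (x 1 - y 1) * hsc
    · change x 2 = y 2
      linear_combination Real.cos (Real.pi / 2 * τ) * k2 - Real.sin (Real.pi / 2 * τ) * k1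
        - (x 2 - y 2) * hsc
  · ext i
    fin_cases i <;> simp [hG]
  have e3 : (fun s => G 1 !₂[Real.cos (2 * Real.pi * s), 0, -Real.sin (2 * Real.pi * s)])
      = unitCircle := by
    funext s
    ext i
    fin_cases i <;> simp [hG, unitCircle]
  rw [e3] at hθ3
  exact ⟨_, (hθ.trans hθ2).trans hθ3⟩

/-- A curve of height `cos 2πs` meets each horizontal plane in at most two points. If one of
the two strands is `-(q/2) sin 2πs`, then the plane can be rotated and dilated about this strand,
moving the other strand to the opposite side. -/
lemma exists_unitCircle_of_heights {γ₁ γ₂ : ℝ → E3} (h₁ : IsClosedCurve γ₁) (h₂ : IsClosedCurve γ₂)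
    (hd : ∀ s t, γ₁ s ≠ γ₂ t) {w₀ q : ℂ} {P : ℝ → ℂ} (hq : q ≠ 0) (hP : ContDiff ℝ ∞ P)
    (hPp : Function.Periodic P 1) (hP0 : ∀ s, -(1 / 2) ≤ Real.sin (2 * Real.pi * s) → P s = 0)
    (hPq : ∀ s, Real.sin (2 * Real.pi * s) ≠ 0 → P s ≠ Real.sin (2 * Real.pi * s) • q)
    (hγ : ∀ s, γ₁ s = toE3 (w₀ + P s - Real.sin (2 * Real.pi * s) • (q / 2))
      (Real.cos (2 * Real.pi * s))) :
    ∃ η₂, DisjointlyHomotopic γ₁ γ₂ unitCircle η₂ := by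
  obtain ⟨r, cr, rpos, hr⟩ := exists_smooth_sqrt
  set D : ℝ → ℂ := fun z => 1 + P (1 - Real.arccos z / (2 * Real.pi)) / ((r z : ℂ) * q) with hD
  have cD : ContDiff ℝ ∞ D := contDiff_const.add (contDiff_complex_div
    (contDiff_comp_arccos hP hP0) ((Complex.ofRealCLM.contDiff.comp cr).mul contDiff_const)
    fun z => mul_ne_zero (Complex.ofReal_ne_zero.2 (rpos z).ne') hq)
  have hpi := Real.pi_ne_zero
  have hsin : ∀ z, Real.sin (2 * Real.pi * (1 - Real.arccos z / (2 * Real.pi)))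
      = -Real.sqrt (1 - z ^ 2) := by
    intro z
    have e : 2 * Real.pi * (1 - Real.arccos z / (2 * Real.pi))
        = 2 * Real.pi - Real.arccos z := by field_simp
    rw [e, Real.sin_two_pi_sub, Real.sin_arccos]
  have hD1 : ∀ z, 3 / 4 ≤ z ^ 2 → D z = 1 := by
    intro z hz
    have : P (1 - Real.arccos z / (2 * Real.pi)) = 0 := by
      refine hP0 _ ?_
      rw [hsin, neg_le_neg_iff]
      exact Real.sqrt_le_iff.2 ⟨by norm_num, by linarith⟩
    simp only [hD, this, zero_div, add_zero]
  have hDne : ∀ z, D z ≠ 0 := by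
    intro z h
    rcases le_total (3 / 4) (z ^ 2) with hz | hz
    · rw [hD1 z hz] at h
      exact one_ne_zero h
    · have hrz := hr z hz
      have h1 : P (1 - Real.arccos z / (2 * Real.pi)) = -((r z : ℂ) * q) := by
        have h2 : (r z : ℂ) * q ≠ 0 := mul_ne_zero (Complex.ofReal_ne_zero.2 (rpos z).ne') hq
        simp only [hD] at h
        rw [← neg_eq_iff_add_eq_zero, eq_comm, div_eq_iff h2] at h
        rw [h]
        ring
      refine hPq (1 - Real.arccos z / (2 * Real.pi)) ?_ ?_
      · rw [hsin, ← hrz]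
        exact neg_ne_zero.2 (rpos z).ne'
      · rw [h1, hsin, ← hrz, Complex.real_smul]
        push_cast
        ring
  have cD' : ContDiff ℝ ∞ (deriv D) := (contDiff_infty_iff_deriv.1 cD).2
  obtain ⟨l, hl, hle⟩ := exists_log (D := D) (D' := deriv D)
    (fun z => (cD.differentiable (by simp) z).hasDerivAt) cD'.continuous hDne
  have cl : ContDiff ℝ ∞ l := by
    rw [contDiff_infty_iff_deriv]
    refine ⟨fun z => (hl z).differentiableAt, ?_⟩
    rw [show deriv l = fun z => deriv D z / D z from funext fun z => (hl z).deriv]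
    exact contDiff_complex_div cD' cD hDne
  obtain ⟨θ₂, hθ⟩ := disjointlyHomotopic_twist h₁ h₂ hd cl
    (c := fun z => w₀ - (r z : ℂ) * (q / 2))
    (contDiff_const.sub ((Complex.ofRealCLM.contDiff.comp cr).mul contDiff_const))
  obtain ⟨a₁, a₂, ad⟩ := DisjointlyHomotopic.target hθ
  suffices hform : ∀ s, toE3 (Complex.exp (-l (γ₁ s 2)) *
      (horiz (γ₁ s) - (w₀ - (r (γ₁ s 2) : ℂ) * (q / 2))) + (w₀ - (r (γ₁ s 2) : ℂ) * (q / 2)))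
      (γ₁ s 2) = toE3 (w₀ + Real.sin (2 * Real.pi * s) • -(q / 2))
        (Real.cos (2 * Real.pi * s)) by
    obtain ⟨η₂, hη⟩ := exists_unitCircle_of_ellipse a₁ a₂ ad
      (neg_ne_zero.2 (div_ne_zero hq two_ne_zero)) hform
    exact ⟨η₂, hθ.trans hη⟩
  · intro s
    rw [hγ s, horiz_toE3, toE3_two, Complex.exp_neg, hle]
    rw [toE3_inj]
    refine ⟨?_, rfl⟩
    have hcs := Real.sin_sq_add_cos_sq (2 * Real.pi * s)
    simp only [Complex.real_smul]
    set S := Real.sin (2 * Real.pi * s) with hS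
    set z := Real.cos (2 * Real.pi * s) with hz
    rcases le_or_gt (3 / 4) (z ^ 2) with h | h
    · -- near the top and the bottom
      have h3 : P s = 0 := hP0 s (by nlinarith)
      rw [hD1 z h, h3]
      ring
    · have hrz : r z = |S| := by
        rw [hr z h.le, ← Real.sqrt_sq_eq_abs]
        congr 1
        linarith
      rcases le_or_gt 0 S with h5 | h5
      · have h3 : P s = 0 := hP0 s (by linarith)
        rw [hrz, abs_of_nonneg h5, h3]
        ring
      · have h6 := hDne z
        have h7 : (r z : ℂ) = -(S : ℂ) := by rw [hrz, abs_of_neg h5]; push_cast; rfl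
        have h8 : w₀ + P s - S * (q / 2) - (w₀ - (r z : ℂ) * (q / 2)) = D z * ((r z : ℂ) * q) := by
          have h9 : (r z : ℂ) * q ≠ 0 := mul_ne_zero (Complex.ofReal_ne_zero.2 (rpos z).ne') hq
          have h10 := comp_arccos_cos hPp h5
          rw [← hz] at h10
          simp only [hD]
          rw [h10, add_mul, div_mul_cancel₀ _ h9, h7]
          ring
        rw [h8, inv_mul_cancel_left₀ h6, h7]
        ring

/-- The first of two disjoint closed curves can be moved to a round circle. -/
theorem exists_disjointlyHomotopic_unitCircle {γ₁ γ₂ : ℝ → E3} (h₁ : IsClosedCurve γ₁)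
    (h₂ : IsClosedCurve γ₂) (hd : ∀ s t, γ₁ s ≠ γ₂ t) :
    ∃ η₂, DisjointlyHomotopic γ₁ γ₂ unitCircle η₂ := by
  obtain ⟨α₁, α₂, hα, hb⟩ := exists_notBetween h₁ h₂ hd
  obtain ⟨a₁, a₂, ad⟩ := DisjointlyHomotopic.target hα
  obtain ⟨φ, cφ, hφ1, hφ⟩ := exists_flat_reparam
  have hβ := disjointlyHomotopic_reparam a₁ a₂ ad cφ hφ1
  obtain ⟨b₁, -, bd⟩ := DisjointlyHomotopic.target hβ
  have ccos : ContDiff ℝ ∞ fun s : ℝ => Real.cos (2 * Real.pi * s) :=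
    (contDiff_const.mul contDiff_id).cos
  have csin : ContDiff ℝ ∞ fun s : ℝ => Real.sin (2 * Real.pi * s) :=
    (contDiff_const.mul contDiff_id).sin
  have pcos : Function.Periodic (fun s : ℝ => Real.cos (2 * Real.pi * s)) 1 := fun s => by
    simp only [mul_add, mul_one, Real.cos_add_two_pi]
  have psin : Function.Periodic (fun s : ℝ => Real.sin (2 * Real.pi * s)) 1 := fun s => by
    simp only [mul_add, mul_one, Real.sin_add_two_pi]
  obtain ⟨κ₂, hκ⟩ := disjointlyHomotopic_heights b₁ a₂ bd (fun s s' t => hb _ _ t) ccos pcos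
  obtain ⟨c₁, c₂, cd⟩ := DisjointlyHomotopic.target hκ
  set w₀ : ℂ := horiz (α₁ 0) with hw₀
  set P : ℝ → ℂ := fun s => horiz (α₁ (φ s)) - w₀ with hPdef
  have hP : ContDiff ℝ ∞ P := (contDiff_horiz.comp b₁.smooth).sub contDiff_const
  have hPp : Function.Periodic P 1 := fun s => by
    have : α₁ (φ (s + 1)) = α₁ (φ s) := b₁.periodic s
    simp only [hPdef, this]
  have hP0 : ∀ s, -(1 / 2) ≤ Real.sin (2 * Real.pi * s) → P s = 0 := by
    intro s hs
    obtain ⟨k, hk⟩ := hφ s hs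
    have := a₁.periodic.int_mul k 0
    rw [mul_one, zero_add] at this
    simp only [hPdef, hk, this, hw₀, sub_self]
  obtain ⟨δ, hδ, hsmall⟩ := exists_pos_forall_disjointlyHomotopic c₁ c₂ cd
  -- a small generic displacement separates the two strands
  have hdense := dense_compl_image (f := fun s => (Real.sin (2 * Real.pi * s))⁻¹ • P s)
    (U := {s | Real.sin (2 * Real.pi * s) ≠ 0}) (isOpen_ne.preimage csin.continuous)
    ((csin.contDiffOn.inv fun s hs => hs).smul hP.contDiffOn |>.of_le (by simp))
    (by simp [Complex.finrank_real_complex])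
  obtain ⟨q, hqδ, hq⟩ := hdense.inter_open_nonempty (Metric.ball 0 δ) Metric.isOpen_ball
    ⟨0, Metric.mem_ball_self hδ⟩
  rw [mem_ball_zero_iff] at hqδ
  have h14 : Real.sin (2 * Real.pi * (1 / 4)) = 1 := by
    rw [show 2 * Real.pi * (1 / 4) = Real.pi / 2 by ring, Real.sin_pi_div_two]
  have hq0 : q ≠ 0 := by
    rintro rfl
    refine hq ⟨1 / 4, ?_, ?_⟩
    · simp only [mem_ofPred_eq, h14]; norm_num
    · simp only
      rw [hP0 _ (by rw [h14]; norm_num), smul_zero]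
  have hPq : ∀ s, Real.sin (2 * Real.pi * s) ≠ 0 → P s ≠ Real.sin (2 * Real.pi * s) • q := by
    intro s hs h
    refine hq ⟨s, hs, ?_⟩
    simp only
    rw [h, inv_smul_smul₀ hs]
  have d₁ : IsClosedCurve fun s => toE3 (w₀ + P s - Real.sin (2 * Real.pi * s) • (q / 2))
      (Real.cos (2 * Real.pi * s)) :=
    isClosedCurve_toE3 ((contDiff_const.add hP).sub (csin.smul contDiff_const)) ccos
      (fun s => by
        have := psin s
        simp only at this
        simp only [hPp s, this]) pcos
  have hκ' := hsmall _ κ₂ d₁ c₂ (fun s => ?_) fun t => by rw [sub_self, norm_zero]; exact hδ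
  · obtain ⟨-, -, dd⟩ := DisjointlyHomotopic.target hκ'
    obtain ⟨η₂, hη⟩ := exists_unitCircle_of_heights d₁ c₂ dd hq0 hP hPp hP0 hPq fun s => rfl
    exact ⟨η₂, ((hα.trans hβ).trans hκ).trans (hκ'.trans hη)⟩
  · rw [toE3_sub]
    refine (norm_toE3_le _ _).trans_lt ?_
    have e : w₀ + P s - Real.sin (2 * Real.pi * s) • (q / 2) - horiz (α₁ (φ s))
        = -(Real.sin (2 * Real.pi * s) • (q / 2)) := by simp only [hPdef]; abel
    rw [e, sub_self, abs_zero, add_zero, norm_neg, norm_smul, Real.norm_eq_abs, norm_div,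
      Complex.norm_ofNat]
    have := Real.abs_sin_le_one (2 * Real.pi * s)
    have := norm_nonneg q
    nlinarith

/-! ### Making the second curve perpendicular to the plane -/

lemma hasDerivAt_horiz {γ : ℝ → E3} {γ' : E3} {t : ℝ} (h : HasDerivAt γ γ' t) :
    HasDerivAt (fun t => horiz (γ t)) (horiz γ') t :=
  Complex.equivRealProdCLM.symm.hasFDerivAt.comp_hasDerivAt t
    ((hasDerivAt_coord h 0).prodMk (hasDerivAt_coord h 1))

lemma hasDerivAt_cos_two_pi (t : ℝ) : HasDerivAt (fun t : ℝ => Real.cos (2 * Real.pi * t))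
    (-(2 * Real.pi) * Real.sin (2 * Real.pi * t)) t := by
  have h : HasDerivAt (fun t : ℝ => 2 * Real.pi * t) (2 * Real.pi) t := by
    simpa using (hasDerivAt_id t).const_mul (2 * Real.pi)
  exact h.cos.congr_deriv (by ring)

lemma hasDerivAt_sin_two_pi (t : ℝ) : HasDerivAt (fun t : ℝ => Real.sin (2 * Real.pi * t))
    (2 * Real.pi * Real.cos (2 * Real.pi * t)) t := by
  have h : HasDerivAt (fun t : ℝ => 2 * Real.pi * t) (2 * Real.pi) t := by
    simpa using (hasDerivAt_id t).const_mul (2 * Real.pi)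
  exact h.sin.congr_deriv (by ring)

lemma contDiff_cos_two_pi : ContDiff ℝ ∞ fun t : ℝ => Real.cos (2 * Real.pi * t) :=
  (contDiff_const.mul contDiff_id).cos

lemma contDiff_sin_two_pi : ContDiff ℝ ∞ fun t : ℝ => Real.sin (2 * Real.pi * t) :=
  (contDiff_const.mul contDiff_id).sin

lemma periodic_cos_two_pi : Function.Periodic (fun t : ℝ => Real.cos (2 * Real.pi * t)) 1 :=
  fun t => by simp only [mul_add, mul_one, Real.cos_add_two_pi]

lemma periodic_sin_two_pi : Function.Periodic (fun t : ℝ => Real.sin (2 * Real.pi * t)) 1 :=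
  fun t => by simp only [mul_add, mul_one, Real.sin_add_two_pi]

/-- The third coordinate of a curve vanishes only to first order. -/
def IsRegularHeight (γ : ℝ → E3) : Prop := ∀ t, γ t 2 = 0 → deriv γ t 2 ≠ 0

lemma exists_regularHeight {γ : ℝ → E3} (hγ : IsClosedCurve γ) {δ : ℝ} (hδ : 0 < δ) :
    ∃ η, IsClosedCurve η ∧ (∀ t, ‖η t - γ t‖ < δ) ∧ IsRegularHeight η := by
  set z : ℝ → ℝ := fun t => γ t 2 with hz
  have cz : ContDiff ℝ ∞ z := (contDiff_coord 2).comp hγ.smooth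
  have cz' : ContDiff ℝ ∞ (deriv z) := (contDiff_infty_iff_deriv.1 cz).2
  have pz : Function.Periodic z 1 := fun t => by simp only [hz, hγ.periodic t]
  set f : ℝ → ℝ × ℝ := fun t =>
    (-z t * Real.cos (2 * Real.pi * t) + deriv z t / (2 * Real.pi) * Real.sin (2 * Real.pi * t),
      -z t * Real.sin (2 * Real.pi * t) - deriv z t / (2 * Real.pi) * Real.cos (2 * Real.pi * t))
    with hf
  have cf : ContDiff ℝ ∞ f :=
    ((cz.neg.mul contDiff_cos_two_pi).add ((cz'.div_const _).mul contDiff_sin_two_pi)).prodMk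
      ((cz.neg.mul contDiff_sin_two_pi).sub ((cz'.div_const _).mul contDiff_cos_two_pi))
  obtain ⟨⟨a, b⟩, hab, hgood⟩ := (dense_compl_image isOpen_univ
    (cf.of_le (by simp)).contDiffOn (by simp)).inter_open_nonempty
    (Metric.ball (0 : ℝ × ℝ) (δ / 2)) Metric.isOpen_ball ⟨0, Metric.mem_ball_self (by positivity)⟩
  rw [mem_ball_zero_iff, Prod.norm_def, max_lt_iff] at hab
  set ζ : ℝ → ℝ := fun t => z t + (a * Real.cos (2 * Real.pi * t) + b * Real.sin (2 * Real.pi * t))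
    with hζ
  have cζ : ContDiff ℝ ∞ ζ := cz.add ((contDiff_const.mul contDiff_cos_two_pi).add
    (contDiff_const.mul contDiff_sin_two_pi))
  have hη : IsClosedCurve fun t => toE3 (horiz (γ t)) (ζ t) :=
    isClosedCurve_toE3 (contDiff_horiz.comp hγ.smooth) cζ (fun t => by simp only [hγ.periodic t])
      fun t => by
        have h1 := periodic_cos_two_pi t
        have h2 := periodic_sin_two_pi t
        simp only at h1 h2
        simp only [hζ, pz t, h1, h2]
  refine ⟨_, hη, fun t => ?_, fun t h0 h1 => ?_⟩
  · rw [← toE3_horiz (γ t), horiz_toE3, toE3_sub]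
    refine (norm_toE3_le _ _).trans_lt ?_
    rw [sub_self, norm_zero, zero_add]
    simp only [hζ, hz, add_sub_cancel_left]
    refine (abs_add_le _ _).trans_lt ?_
    rw [abs_mul, abs_mul]
    have h1 := Real.abs_cos_le_one (2 * Real.pi * t)
    have h2 := Real.abs_sin_le_one (2 * Real.pi * t)
    have h3 := mul_le_of_le_one_right (abs_nonneg a) h1
    have h4 := mul_le_of_le_one_right (abs_nonneg b) h2
    have h5 : |a| < δ / 2 := hab.1
    have h6 : |b| < δ / 2 := hab.2
    linarith
  · have hd := hasDerivAt_coord (hη.hasDerivAt t) 2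
    rw [h1] at hd
    simp only [toE3_two] at hd h0
    have hd' := ((cz.differentiable (by simp) t).hasDerivAt.add
      (((hasDerivAt_cos_two_pi t).const_mul a).add ((hasDerivAt_sin_two_pi t).const_mul b)))
    have e := hd'.unique hd
    have hsc := Real.sin_sq_add_cos_sq (2 * Real.pi * t)
    have hpi := Real.pi_ne_zero
    have hdz : deriv z t / (2 * Real.pi)
        = a * Real.sin (2 * Real.pi * t) - b * Real.cos (2 * Real.pi * t) := by
      rw [div_eq_iff (by positivity)]
      linear_combination e
    refine hgood ⟨t, mem_univ t, ?_⟩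
    simp only [hf, hdz, Prod.mk.injEq]
    simp only [hζ] at h0
    constructor
    · linear_combination (-Real.cos (2 * Real.pi * t)) * h0 + a * hsc
    · linear_combination (-Real.sin (2 * Real.pi * t)) * h0 + b * hsc

lemma exists_immersed {γ : ℝ → E3} (hγ : IsClosedCurve γ) (hr : IsRegularHeight γ) {δ : ℝ}
    (hδ : 0 < δ) : ∃ η, IsImmersedClosedCurve η ∧ (∀ t, ‖η t - γ t‖ < δ) ∧ IsRegularHeight η := by
  set w : ℝ → ℂ := fun t => horiz (γ t) with hw
  have cw : ContDiff ℝ ∞ w := contDiff_horiz.comp hγ.smooth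
  have cw' : ContDiff ℝ ∞ (deriv w) := (contDiff_infty_iff_deriv.1 cw).2
  have cz : ContDiff ℝ ∞ fun t => γ t 2 := (contDiff_coord 2).comp hγ.smooth
  set v : ℝ → ℂ := fun t => (-(2 * Real.pi)⁻¹ : ℝ) • deriv w t with hv
  have cv : ContDiff ℝ ∞ v := cw'.const_smul (-(2 * Real.pi)⁻¹ : ℝ)
  set f : ℝ × ℂ → ℂ × ℂ := fun x =>
    (Real.cos (2 * Real.pi * x.1) • x.2 - Real.sin (2 * Real.pi * x.1) • v x.1,
      Real.sin (2 * Real.pi * x.1) • x.2 + Real.cos (2 * Real.pi * x.1) • v x.1) with hf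
  have cc : ContDiff ℝ ∞ fun x : ℝ × ℂ => Real.cos (2 * Real.pi * x.1) :=
    contDiff_cos_two_pi.comp contDiff_fst
  have cs : ContDiff ℝ ∞ fun x : ℝ × ℂ => Real.sin (2 * Real.pi * x.1) :=
    contDiff_sin_two_pi.comp contDiff_fst
  have cvx : ContDiff ℝ ∞ fun x : ℝ × ℂ => v x.1 := cv.comp contDiff_fst
  have cf : ContDiff ℝ ∞ f :=
    ((cc.smul contDiff_snd).sub (cs.smul cvx)).prodMk ((cs.smul contDiff_snd).add (cc.smul cvx))
  obtain ⟨⟨a, b⟩, hab, hgood⟩ := (dense_compl_image isOpen_univ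
    (cf.of_le (by simp)).contDiffOn (by simp [Complex.finrank_real_complex])).inter_open_nonempty
    (Metric.ball (0 : ℂ × ℂ) (δ / 2)) Metric.isOpen_ball ⟨0, Metric.mem_ball_self (by positivity)⟩
  rw [mem_ball_zero_iff, Prod.norm_def, max_lt_iff] at hab
  set u : ℝ → ℂ := fun t => w t + (Real.cos (2 * Real.pi * t) • a + Real.sin (2 * Real.pi * t) • b)
    with hu
  have cu : ContDiff ℝ ∞ u := cw.add ((contDiff_cos_two_pi.smul contDiff_const).add
    (contDiff_sin_two_pi.smul contDiff_const))
  have hη : IsClosedCurve fun t => toE3 (u t) (γ t 2) :=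
    isClosedCurve_toE3 cu cz (fun t => by
        have h1 := periodic_cos_two_pi t
        have h2 := periodic_sin_two_pi t
        simp only at h1 h2
        simp only [hu, hw, hγ.periodic t, h1, h2]) fun t => by simp only [hγ.periodic t]
  refine ⟨_, ⟨hη, fun t h0 => ?_⟩, fun t => ?_, fun t h0 => ?_⟩
  · have hd := hasDerivAt_horiz (hη.hasDerivAt t)
    rw [h0] at hd
    simp only [horiz_toE3] at hd
    have h00 : horiz 0 = 0 := by simp [horiz]; rfl
    rw [h00] at hd
    have hd' := ((cw.differentiable (by simp) t).hasDerivAt.add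
      (((hasDerivAt_cos_two_pi t).smul_const a).add ((hasDerivAt_sin_two_pi t).smul_const b)))
    have e := hd'.unique hd
    have hpi : (2 * Real.pi) ≠ 0 := by positivity
    have hvt : v t = Real.cos (2 * Real.pi * t) • b - Real.sin (2 * Real.pi * t) • a := by
      have e' : deriv w t = (2 * Real.pi) • (Real.sin (2 * Real.pi * t) • a
          - Real.cos (2 * Real.pi * t) • b) := by
        rw [eq_comm, ← sub_eq_zero, ← neg_eq_zero, ← e]
        module
      simp only [hv]
      rw [e', smul_smul, neg_mul, inv_mul_cancel₀ hpi]
      module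
    have hsc := Real.sin_sq_add_cos_sq (2 * Real.pi * t)
    refine hgood ⟨(t, Real.cos (2 * Real.pi * t) • a + Real.sin (2 * Real.pi * t) • b),
      mem_univ _, ?_⟩
    simp only [hf, hvt, Prod.mk.injEq]
    constructor
    · calc _ = (Real.sin (2 * Real.pi * t) ^ 2 + Real.cos (2 * Real.pi * t) ^ 2) • a := by module
        _ = a := by rw [hsc, one_smul]
    · calc _ = (Real.sin (2 * Real.pi * t) ^ 2 + Real.cos (2 * Real.pi * t) ^ 2) • b := by module
        _ = b := by rw [hsc, one_smul]
  · rw [← toE3_horiz (γ t), toE3_two, toE3_sub]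
    refine (norm_toE3_le _ _).trans_lt ?_
    rw [sub_self, abs_zero, add_zero]
    simp only [hu, hw, add_sub_cancel_left]
    refine (norm_add_le _ _).trans_lt ?_
    rw [norm_smul, norm_smul, Real.norm_eq_abs, Real.norm_eq_abs]
    have h1 := Real.abs_cos_le_one (2 * Real.pi * t)
    have h2 := Real.abs_sin_le_one (2 * Real.pi * t)
    have h3 := mul_le_of_le_one_left (norm_nonneg a) h1
    have h4 := mul_le_of_le_one_left (norm_nonneg b) h2
    have h5 : ‖a‖ < δ / 2 := hab.1
    have h6 : ‖b‖ < δ / 2 := hab.2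
    linarith
  · have hd := hasDerivAt_coord (hη.hasDerivAt t) 2
    simp only [toE3_two] at hd h0
    rw [hd.unique (hasDerivAt_coord (hγ.hasDerivAt t) 2)]
    exact hr t h0

lemma exists_abs_le_of_periodic {f : ℝ → ℝ} (hf : Continuous f) (hp : Function.Periodic f 1) :
    ∃ M, ∀ t, |f t| ≤ M := by
  obtain ⟨M, hM⟩ := (isCompact_Icc (a := (0 : ℝ)) (b := 1)).exists_bound_of_continuousOn
    hf.continuousOn
  refine ⟨M, fun t => ?_⟩
  obtain ⟨t', ht', h⟩ := hp.exists_mem_Ico₀ one_pos t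
  rw [h]
  exact hM t' (Ico_subset_Icc_self ht')

lemma exists_pos_le_of_periodic {f : ℝ → ℝ} (hf : Continuous f) (hp : Function.Periodic f 1)
    (hpos : ∀ t, 0 < f t) : ∃ m > 0, ∀ t, m ≤ f t := by
  obtain ⟨t₀, -, hmin⟩ := (isCompact_Icc (a := (0 : ℝ)) (b := 1)).exists_isMinOn
    (nonempty_Icc.2 zero_le_one) hf.continuousOn
  refine ⟨f t₀, hpos t₀, fun t => ?_⟩
  obtain ⟨t', ht', h⟩ := hp.exists_mem_Ico₀ one_pos t
  rw [h]
  exact hmin (Ico_subset_Icc_self ht')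

/-- A curve that crosses the plane `x₃ = 0` transversally becomes perpendicular to the plane if the
horizontal coordinates are reparametrised by `t - ψ(t)`, where `ψ` is a small function with
`ψ = 0` and `ψ' = 1` at the crossings: with `z` the height, `ψ = z z' / (z'² + L² z²)`. -/
lemma exists_perpendicular {γ : ℝ → E3} (hγ : IsImmersedClosedCurve γ) (hr : IsRegularHeight γ)
    {δ : ℝ} (hδ : 0 < δ) : ∃ η, IsImmersedClosedCurve η ∧ (∀ t, ‖η t - γ t‖ < δ) ∧
      ∀ t, η t 2 = 0 → deriv η t 0 = 0 ∧ deriv η t 1 = 0 ∧ deriv η t 2 ≠ 0 := by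
  have hγc : IsClosedCurve γ := hγ.toIsClosedCurve
  set w : ℝ → ℂ := fun t => horiz (γ t) with hw
  set z : ℝ → ℝ := fun t => γ t 2 with hz
  set z' : ℝ → ℝ := fun t => deriv γ t 2 with hz'
  set z'' : ℝ → ℝ := deriv z' with hz''
  have cw : ContDiff ℝ ∞ w := contDiff_horiz.comp hγc.smooth
  have cz : ContDiff ℝ ∞ z := (contDiff_coord 2).comp hγc.smooth
  have cγ' : ContDiff ℝ ∞ (deriv γ) := (contDiff_infty_iff_deriv.1 hγc.smooth).2
  have cz' : ContDiff ℝ ∞ z' := (contDiff_coord 2).comp cγ'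
  have cz'' : ContDiff ℝ ∞ z'' := (contDiff_infty_iff_deriv.1 cz').2
  have dz : ∀ t, HasDerivAt z (z' t) t := fun t => hasDerivAt_coord (hγc.hasDerivAt t) 2
  have dz' : ∀ t, HasDerivAt z' (z'' t) t := fun t =>
    (cz'.differentiable (by simp) t).hasDerivAt
  have pz : Function.Periodic z 1 := fun t => by simp only [hz, hγc.periodic t]
  have pz' : Function.Periodic z' 1 := fun t => by simp only [hz', hγc.deriv_periodic t]
  have pz'' : Function.Periodic z'' 1 := fun t => by
    have h1 : HasDerivAt (fun s => z' (s + 1)) (z'' (t + 1)) t := (dz' (t + 1)).comp_add_const t 1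
    rw [show (fun s => z' (s + 1)) = z' from funext pz'] at h1
    exact h1.unique (dz' t)
  have hreg : ∀ t, z t = 0 → z' t ≠ 0 := hr
  obtain ⟨ρ, hρ, hclose⟩ : ∃ ρ > 0, ∀ x y, |x - y| < ρ → ‖w x - w y‖ < δ := by
    obtain ⟨C, hC⟩ := exists_abs_le_of_periodic (f := fun t => ‖deriv w t‖)
      (contDiff_infty_iff_deriv.1 cw).2.continuous.norm fun t => by
        have h1 : HasDerivAt (fun s => w (s + 1)) (deriv w (t + 1)) t :=
          ((cw.differentiable (by simp) (t + 1)).hasDerivAt).comp_add_const t 1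
        rw [show (fun s => w (s + 1)) = w from funext fun s => by
          simp only [hw, hγc.periodic s]] at h1
        dsimp only
        rw [h1.unique (cw.differentiable (by simp) t).hasDerivAt]
    have hC0 : 0 ≤ C := (abs_nonneg _).trans (hC 0)
    refine ⟨δ / (C + 1), by positivity, fun x y hxy => ?_⟩
    have h1 := convex_univ.norm_image_sub_le_of_norm_deriv_le (f := w) (C := C) (x := y) (y := x)
      (fun t _ => cw.differentiable (by simp) t) (fun t _ => by simpa using hC t)
      (mem_univ y) (mem_univ x)
    rw [lt_div_iff₀ (by positivity)] at hxy
    rw [Real.norm_eq_abs] at h1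
    nlinarith [abs_nonneg (x - y)]
  obtain ⟨m, hm, hmle⟩ := exists_pos_le_of_periodic (f := fun t => z' t ^ 2 + z t ^ 2)
    ((cz'.continuous.pow 2).add (cz.continuous.pow 2)) (fun t => by simp only [pz t, pz' t])
    fun t => by
      rcases eq_or_ne (z t) 0 with h | h
      · have := hreg t h
        positivity
      · positivity
  obtain ⟨M, hM⟩ := exists_abs_le_of_periodic (f := fun t => z t * z'' t)
    (cz.continuous.mul cz''.continuous) fun t => by simp only [pz t, pz'' t]
  have hM0 : 0 ≤ M := (abs_nonneg _).trans (hM 0)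
  obtain ⟨L, hL1, hL⟩ : ∃ L, 1 ≤ L ∧ M / m < L ∧ 1 / ρ < L := by
    refine ⟨1 + M / m + 1 / ρ, ?_, ?_, ?_⟩
    · have : 0 ≤ M / m := by positivity
      have : 0 < 1 / ρ := by positivity
      linarith
    · have : 0 < 1 / ρ := by positivity
      linarith
    · have : 0 ≤ M / m := by positivity
      linarith
  obtain ⟨hLM, hLρ⟩ := hL
  have hL0 : 0 < L := by linarith
  set q : ℝ → ℝ := fun t => z' t ^ 2 + L ^ 2 * z t ^ 2 with hq
  have hqpos : ∀ t, 0 < q t := by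
    intro t
    simp only [hq]
    rcases eq_or_ne (z t) 0 with h | h
    · have := hreg t h
      positivity
    · positivity
  set ψ : ℝ → ℝ := fun t => z t * z' t / q t with hψ
  have cψ : ContDiff ℝ ∞ ψ := (cz.mul cz').div ((cz'.pow 2).add (contDiff_const.mul (cz.pow 2)))
    fun t => (hqpos t).ne'
  have pψ : Function.Periodic ψ 1 := fun t => by simp only [hψ, hq, pz t, pz' t]
  have dψ : ∀ t, HasDerivAt ψ (((z' t * z' t + z t * z'' t) * q t - z t * z' t *
      (2 * z' t * z'' t + L ^ 2 * (2 * z t * z' t))) / q t ^ 2) t := by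
    intro t
    have h1 : HasDerivAt q (2 * z' t * z'' t + L ^ 2 * (2 * z t * z' t)) t := by
      refine HasDerivAt.congr_deriv (f := q)
        (((dz' t).pow 2).add (((dz t).pow 2).const_mul (L ^ 2))) ?_
      simp
    exact ((dz t).mul (dz' t)).div h1 (hqpos t).ne'
  have hψρ : ∀ t, |ψ t| < ρ := by
    intro t
    simp only [hψ]
    rw [abs_div, abs_of_pos (hqpos t), div_lt_iff₀ (hqpos t)]
    rw [div_lt_iff₀ hρ] at hLρ
    have h1 : 2 * L * |z t * z' t| ≤ q t := by
      rw [abs_mul]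
      simp only [hq]
      nlinarith [sq_nonneg (|z' t| - L * |z t|), sq_abs (z t), sq_abs (z' t)]
    have h2 : q t < L * ρ * q t := lt_mul_of_one_lt_left (hqpos t) hLρ
    have h3 : 2 * L * |z t * z' t| < 2 * L * (ρ * q t) := by nlinarith [hqpos t]
    exact lt_of_mul_lt_mul_left h3 (by positivity)
  have cη : IsClosedCurve fun t => toE3 (w (t - ψ t)) (z t) :=
    isClosedCurve_toE3 (cw.comp (contDiff_id.sub cψ)) cz (fun t => by
      have e : t + 1 - ψ t = t - ψ t + 1 := by ring
      simp only [hw, pψ t, e, hγc.periodic (t - ψ t)]) pz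
  have dη : ∀ t, horiz (deriv (fun t => toE3 (w (t - ψ t)) (z t)) t)
      = (1 - deriv ψ t) • deriv w (t - ψ t) := by
    intro t
    have h1 := hasDerivAt_horiz (cη.hasDerivAt t)
    simp only [horiz_toE3] at h1
    have h2 : HasDerivAt (fun t => t - ψ t) (1 - deriv ψ t) t :=
      (hasDerivAt_id t).sub (cψ.differentiable (by simp) t).hasDerivAt
    have h3 : HasDerivAt (fun t => w (t - ψ t)) ((1 - deriv ψ t) • deriv w (t - ψ t)) t :=
      HasDerivAt.scomp (g₁ := w) t (cw.differentiable (by simp) (t - ψ t)).hasDerivAt h2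
    exact h1.unique h3
  have dηz : ∀ t, deriv (fun t => toE3 (w (t - ψ t)) (z t)) t 2 = z' t := by
    intro t
    have h1 := hasDerivAt_coord (cη.hasDerivAt t) 2
    simp only [toE3_two] at h1
    exact h1.unique (dz t)
  refine ⟨_, ⟨cη, fun t h0 => ?_⟩, fun t => ?_, fun t h0 => ?_⟩
  · -- at a critical point of the height, `ψ = 0` and `|ψ'| < 1`
    have h1 := dηz t
    have h2 := dη t
    rw [h0] at h1 h2
    have h3 : z' t = 0 := h1.symm
    have h4 : ψ t = 0 := by simp only [hψ, h3, mul_zero, zero_div]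
    have h00 : horiz 0 = 0 := by simp [horiz]; rfl
    have hw' : deriv w t ≠ 0 := by
      intro h
      refine hγ.immersed t ?_
      have h5 := (hasDerivAt_horiz (hγc.hasDerivAt t)).unique
        (cw.differentiable (by simp) t).hasDerivAt
      rw [h, ← h00] at h5
      have h6 : deriv γ t 2 = 0 := h3
      rw [← toE3_horiz (deriv γ t), h5, h6]
      have := toE3_horiz 0
      simpa using this
    rw [h00, h4, sub_zero, eq_comm, smul_eq_zero, or_iff_left hw', (dψ t).deriv] at h2
    have h7 := hmle t
    simp only [h3] at h7
    have h8 : 0 < z t ^ 2 := by linarith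
    have h9 : 1 = z t * z'' t / (L ^ 2 * z t ^ 2) := by
      rw [sub_eq_zero] at h2
      refine h2.trans ?_
      simp only [hq, h3]
      have : z t ≠ 0 := fun h => by rw [h] at h8; norm_num at h8
      field_simp
      ring
    rw [eq_div_iff (by positivity), one_mul] at h9
    have h10 := (le_abs_self _).trans (hM t)
    rw [← h9] at h10
    rw [div_lt_iff₀ hm] at hLM
    nlinarith
  · rw [← toE3_horiz (γ t), toE3_sub]
    refine (norm_toE3_le _ _).trans_lt ?_
    have : z t - γ t 2 = 0 := sub_self _
    rw [this, abs_zero, add_zero]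
    refine hclose _ _ ?_
    rw [sub_sub_cancel_left, abs_neg]
    exact hψρ t
  · -- at a crossing, `ψ' = 1`
    have h1 : z t = 0 := by simpa using h0
    have h2 := hreg t h1
    have h3 : deriv ψ t = 1 := by
      rw [(dψ t).deriv]
      simp only [hq, h1]
      field_simp
      ring
    have h4 := dη t
    rw [h3, sub_self, zero_smul] at h4
    exact ⟨congrArg Complex.re h4, congrArg Complex.im h4, by rw [dηz t]; exact h2⟩

/-- Every pair of disjoint closed curves can be moved to a pair in planar position, with the unit
circle as first curve. -/
theorem exists_planarPosition {γ₁ γ₂ : ℝ → E3} (h₁ : IsClosedCurve γ₁) (h₂ : IsClosedCurve γ₂)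
    (hd : ∀ s t, γ₁ s ≠ γ₂ t) : ∃ η₂, IsImmersedClosedCurve η₂ ∧
      DisjointlyHomotopic γ₁ γ₂ unitCircle η₂ ∧ IsPlanarPosition unitCircle η₂ := by
  have step : ∀ {α : ℝ → E3}, DisjointlyHomotopic γ₁ γ₂ unitCircle α → ∃ δ > 0,
      ∀ β, IsClosedCurve β → (∀ t, ‖β t - α t‖ < δ) →
        DisjointlyHomotopic γ₁ γ₂ unitCircle β := by
    intro α h
    obtain ⟨a₁, a₂, ad⟩ := DisjointlyHomotopic.target h
    obtain ⟨δ, hδ, hs⟩ := exists_pos_forall_disjointlyHomotopic a₁ a₂ ad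
    exact ⟨δ, hδ, fun β hβ hc => h.trans (hs _ β a₁ hβ (fun s => by simpa using hδ) hc)⟩
  obtain ⟨α, hα⟩ := exists_disjointlyHomotopic_unitCircle h₁ h₂ hd
  obtain ⟨δ, hδ, hs⟩ := step hα
  obtain ⟨β, cβ, hβ, rβ⟩ := exists_regularHeight (DisjointlyHomotopic.target hα).2.1 hδ
  obtain ⟨δ', hδ', hs'⟩ := step (hs β cβ hβ)
  obtain ⟨κ, iκ, hκ, rκ⟩ := exists_immersed cβ rβ hδ'
  obtain ⟨δ'', hδ'', hs''⟩ := step (hs' κ iκ.toIsClosedCurve hκ)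
  obtain ⟨η, iη, hη, pη⟩ := exists_perpendicular iκ rκ hδ''
  exact ⟨η, iη, hs'' η iη.toIsClosedCurve hη, fun s => by simp [unitCircle], pη⟩

/-! ### The disk as a Seifert surface -/

lemma hasDerivAt_unitCircle (s : ℝ) : HasDerivAt unitCircle
    (!₂[-(2 * Real.pi) * Real.sin (2 * Real.pi * s), 2 * Real.pi * Real.cos (2 * Real.pi * s), 0] : E3)
    s := by
  rw [← hasDerivWithinAt_univ, hasDerivWithinAt_iff_hasFDerivWithinAt, hasFDerivWithinAt_euclidean]
  intro i
  rw [hasFDerivWithinAt_univ]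
  fin_cases i
  · refine (hasDerivAt_cos_two_pi s).hasFDerivAt.congr_fderiv ?_
    ext; simp
  · refine (hasDerivAt_sin_two_pi s).hasFDerivAt.congr_fderiv ?_
    ext; simp
  · refine (hasDerivAt_const s (0 : ℝ)).hasFDerivAt.congr_fderiv ?_
    ext; simp

lemma isEmbeddedClosedCurve_unitCircle : IsEmbeddedClosedCurve unitCircle where
  smooth := by
    rw [contDiff_euclidean]
    intro i
    fin_cases i
    · exact contDiff_cos_two_pi
    · exact contDiff_sin_two_pi
    · exact contDiff_const
  periodic := fun s => by
    have h1 := periodic_cos_two_pi s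
    have h2 := periodic_sin_two_pi s
    simp only at h1 h2
    simp only [unitCircle, h1, h2]
  immersed := fun s h => by
    rw [(hasDerivAt_unitCircle s).deriv] at h
    have k0 := congrFun (congrArg WithLp.ofLp h) 0
    have k1 := congrFun (congrArg WithLp.ofLp h) 1
    have hsc := Real.sin_sq_add_cos_sq (2 * Real.pi * s)
    simp [Real.pi_ne_zero] at k0 k1
    rw [k0, k1] at hsc
    norm_num at hsc
  injective := by
    intro s hs t ht h
    have k0 := congrFun (congrArg WithLp.ofLp h) 0
    have k1 := congrFun (congrArg WithLp.ofLp h) 1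
    obtain ⟨k, hk⟩ := exists_int_of_cos_sin_eq (t := s) (t' := t) (by simpa [unitCircle] using k0)
      (by simpa [unitCircle] using k1)
    have h1 : (k : ℝ) < 1 := by linarith [hs.2, ht.1]
    have h2 : (-1 : ℝ) < k := by linarith [hs.1, ht.2]
    have h3 : k = 0 := by
      have h4 : k < 1 := by exact_mod_cast h1
      have h5 : -1 < k := by exact_mod_cast h2
      omega
    rw [hk, h3, Int.cast_zero, add_zero]

/-- The closed unit disk in the horizontal plane. -/
def unitDisk : Set E3 := Metric.closedBall 0 1 ∩ {x | x 2 = 0}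

lemma mem_range_unitCircle {x : E3} : x ∈ range unitCircle ↔ x 2 = 0 ∧ 1 - ‖x‖ ^ 2 = 0 := by
  constructor
  · rintro ⟨s, rfl⟩
    have hsc := Real.sin_sq_add_cos_sq (2 * Real.pi * s)
    refine ⟨by simp [unitCircle], ?_⟩
    rw [norm_sq_eq]
    simp only [unitCircle, PiLp.toLp_apply, Matrix.cons_val_zero, Matrix.cons_val_one,
      Matrix.cons_val]
    linarith
  · rintro ⟨h0, h1⟩
    rw [norm_sq_eq, h0] at h1
    have hn : ‖horiz x‖ = 1 := by
      have h : ‖horiz x‖ ^ 2 = x 0 ^ 2 + x 1 ^ 2 := by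
        rw [Complex.sq_norm, Complex.normSq_apply]
        simp only [horiz]
        ring
      rw [← sq_eq_sq₀ (norm_nonneg _) zero_le_one, h]
      linarith
    have k0 := Complex.norm_mul_cos_arg (horiz x)
    have k1 := Complex.norm_mul_sin_arg (horiz x)
    rw [hn, one_mul] at k0 k1
    have r0 : (horiz x).re = x 0 := rfl
    have r1 : (horiz x).im = x 1 := rfl
    have e : 2 * Real.pi * ((horiz x).arg / (2 * Real.pi)) = (horiz x).arg := by
      have := Real.pi_ne_zero
      field_simp
    refine ⟨(horiz x).arg / (2 * Real.pi), ?_⟩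
    ext i
    fin_cases i
    · simpa [unitCircle, e, r0] using k0
    · simpa [unitCircle, e, r1] using k1
    · simpa [unitCircle] using h0.symm

lemma gradient_coord_two (x : E3) : ∇ (fun x : E3 => x 2) x = e3 := by
  refine ext_inner_right ℝ fun v => ?_
  rw [inner_gradient, inner_e3]
  have : HasFDerivAt (fun x : E3 => x 2) (EuclideanSpace.proj (𝕜 := ℝ) (2 : Fin 3)) x :=
    (EuclideanSpace.proj (𝕜 := ℝ) (2 : Fin 3)).hasFDerivAt
  rw [this.fderiv]
  rfl

lemma gradient_norm_sq (x : E3) : ∇ (fun x : E3 => 1 - ‖x‖ ^ 2) x = (-2 : ℝ) • x := by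
  refine ext_inner_right ℝ fun v => ?_
  rw [inner_gradient, ((hasStrictFDerivAt_norm_sq x).hasFDerivAt.const_sub 1).fderiv]
  simp [real_inner_smul_left]

lemma mem_unitDisk {x : E3} : x ∈ unitDisk ↔ x 2 = 0 ∧ 0 ≤ 1 - ‖x‖ ^ 2 := by
  rw [unitDisk, mem_inter_iff, mem_closedBall_zero_iff, and_comm, sub_nonneg, sq_le_one_iff₀ (norm_nonneg x)]
  rfl

lemma isSeifertSurface_unitDisk : IsSeifertSurface unitDisk (fun _ => e3) unitCircle where
  embedded := isEmbeddedClosedCurve_unitCircle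
  compact := (isCompact_closedBall 0 1).inter_right
    (isClosed_singleton.preimage (continuous_coord 2))
  connected := ⟨⟨0, by simp [mem_unitDisk]⟩,
    ((convex_closedBall 0 1).inter (convex_coord 2 (convex_singleton 0))).isPreconnected⟩
  interior_chart := by
    rintro p ⟨hp, hpσ⟩
    rw [mem_unitDisk] at hp
    refine ⟨Metric.ball 0 1, fun x => x 2, Metric.isOpen_ball, ?_, (contDiff_coord 2).contDiffOn,
      fun q hq => ?_, fun q _ => ?_⟩
    · rw [mem_ball_zero_iff]
      refine lt_of_le_of_ne ((sq_le_one_iff₀ (norm_nonneg p)).1 (by linarith [hp.2])) fun h => ?_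
      exact hpσ (mem_range_unitCircle.2 ⟨hp.1, by rw [h]; norm_num⟩)
    · rw [mem_unitDisk, and_iff_left]
      rw [mem_ball_zero_iff] at hq
      nlinarith [norm_nonneg q]
    · rw [gradient_coord_two, norm_e3, inv_one, one_smul]
      exact ⟨norm_ne_zero_iff.1 (by rw [norm_e3]; exact one_ne_zero), rfl⟩
  boundary_chart := by
    intro p _
    refine ⟨univ, fun x => x 2, fun x => 1 - ‖x‖ ^ 2, isOpen_univ, mem_univ p,
      (contDiff_coord 2).contDiffOn, (contDiff_const.sub (contDiff_norm_sq ℝ)).contDiffOn,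
      fun q _ => mem_unitDisk, fun q _ => mem_range_unitCircle, fun q _ => ?_, fun s _ => ?_⟩
    · rw [gradient_coord_two, norm_e3, inv_one, one_smul]
      exact ⟨norm_ne_zero_iff.1 (by rw [norm_e3]; exact one_ne_zero), rfl⟩
    · rw [gradient_norm_sq, (hasDerivAt_unitCircle s).deriv]
      have e : det3 (-((-2 : ℝ) • unitCircle s)) !₂[-(2 * Real.pi) * Real.sin (2 * Real.pi * s),
          2 * Real.pi * Real.cos (2 * Real.pi * s), 0] e3 = 4 * Real.pi := by
        have hsc := Real.sin_sq_add_cos_sq (2 * Real.pi * s)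
        rw [det3_eq]
        simp [unitCircle, e3]
        linear_combination (4 * Real.pi) * hsc
      rw [e]
      positivity

end GaussLinking

theorem mainTheorem2 (γ₁ γ₂ : ℝ → E3) (h₁ : IsImmersedClosedCurve γ₁)
    (h₂ : IsImmersedClosedCurve γ₂) (hd : ∀ s t, γ₁ s ≠ γ₂ t) :
    -- the pair can be brought into a planar position in which arbitrarily small perturbations of
    -- the first curve to an embedding bound a Seifert surface transverse to the second curve
    (∃ η₁ η₂ : ℝ → E3, IsImmersedClosedCurve η₁ ∧ IsImmersedClosedCurve η₂ ∧
      DisjointlyHomotopic γ₁ γ₂ η₁ η₂ ∧ IsPlanarPosition η₁ η₂ ∧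
      ∀ ε > 0, ∃ (σ₁ : ℝ → E3) (S : Set E3) (n : E3 → E3),
        (∀ s, dist (σ₁ s) (η₁ s) < ε) ∧ DisjointlyHomotopic γ₁ γ₂ σ₁ η₂ ∧
        IsSeifertSurface S n σ₁ ∧ CrossesTransversally η₂ S n) ∧
    -- in every planar position the Gauss integral is a signed sum of winding numbers
    (∀ η₁ η₂ : ℝ → E3, DisjointlyHomotopic γ₁ γ₂ η₁ η₂ → IsPlanarPosition η₁ η₂ →
      (planeCrossings η₂).Finite ∧
      (∀ t ∈ planeCrossings η₂, ∃ k : ℤ,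
        WindsAround η₁ (η₂ t) k ∧ windingNumber η₁ (η₂ t) = k) ∧
      gaussLinkingIntegral γ₁ γ₂ =
        -∑ᶠ t ∈ planeCrossings η₂, planeCrossingSign η₂ t * windingNumber η₁ (η₂ t)) ∧
    -- whenever the first curve is moved to an embedded curve with a Seifert surface transverse to
    -- the second curve, the Gauss integral is the signed intersection number
    (∀ (σ₁ σ₂ : ℝ → E3) (S : Set E3) (n : E3 → E3),
      DisjointlyHomotopic γ₁ γ₂ σ₁ σ₂ → IsSeifertSurface S n σ₁ →
      CrossesTransversally σ₂ S n →
      (surfaceCrossings σ₂ S).Finite ∧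
      gaussLinkingIntegral γ₁ γ₂ = -intersectionNumber σ₂ S n) := by
  refine ⟨?_, fun η₁ η₂ h hp => ?_, fun σ₁ σ₂ S n h hS hT => ?_⟩
  · obtain ⟨η₂, iη, hη, hp⟩ := GaussLinking.exists_planarPosition h₁.toIsClosedCurve
      h₂.toIsClosedCurve hd
    refine ⟨GaussLinking.unitCircle, η₂,
      GaussLinking.isEmbeddedClosedCurve_unitCircle.toIsImmersedClosedCurve, iη, hη, hp,
      fun ε hε => ⟨GaussLinking.unitCircle, GaussLinking.unitDisk, fun _ => GaussLinking.e3,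
        fun s => by rwa [dist_self], hη, GaussLinking.isSeifertSurface_unitDisk, fun t ht => ?_⟩⟩
    rw [GaussLinking.inner_e3]
    exact (hp.perpendicular t (GaussLinking.mem_unitDisk.1 ht).1).2.2
  · obtain ⟨c₁, c₂, hd'⟩ := GaussLinking.DisjointlyHomotopic.target h
    refine ⟨GaussLinking.finite_of_isolated (GaussLinking.planar_isolated c₂ hp),
      fun t ht => GaussLinking.planar_windsAround c₁ hd' hp ht, ?_⟩
    rw [GaussLinking.gaussLinkingIntegral_eq_of_homotopic h]
    exact GaussLinking.gaussLinkingIntegral_planar c₁ c₂ hd' hp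
  · obtain ⟨-, c₂, hd'⟩ := GaussLinking.DisjointlyHomotopic.target h
    refine ⟨GaussLinking.finite_of_isolated (GaussLinking.surface_isolated c₂ hd' hS hT), ?_⟩
    rw [GaussLinking.gaussLinkingIntegral_eq_of_homotopic h]
    exact GaussLinking.gaussLinkingIntegral_seifert c₂ hd' hS hT
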